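/- Let $d\ge 1$ and let $\Omega\subset\mathbb{R}^d$ be open with compact Lipschitz boundary $\Gamma=\partial\Omega$ (for instance a bounded or an exterior Lipschitz domain), let $n$ be the outward unit normal, and let $\Gamma$ carry the surface measure (the $(d-1)$-dimensional Hausdorff measure). Let $\Gamma$ be decomposed, up to a set of surface measure zero, into three disjoint Borel parts $\Gamma_D,\Gamma_N,\Gamma_R$, where $\Gamma_N$ is relatively open in $\Gamma$ up to a set of surface measure zero. Let $\gamma\in L^\infty(\Gamma_R)$ with $\gamma\ge\gamma_0>0$, let $f\in L^2(\Omega)$, and let $u\in H^2(\Omega)$ solve $$-\operatorname{div}\nabla u+u=f\ \text{ in }\Omega,\qquad u=g_1\ \text{ on }\Gamma_D,\qquad n\cdot\nabla u=g_2\ \text{ on }\Gamma_N,\qquad n\cdot\nabla u+\gamma u=g_3\ \text{ on }\Gamma_R ,$$ where boundary values are traces. Set $p:=\nabla u$. Let $D(\Omega)$ be the space of all $\psi\in L^2(\Omega;\mathbb{R}^d)$ with $\operatorname{div}\psi\in L^2(\Omega)$, with its graph norm $\|\psi\|_D^2=\|\psi\|_{L^2}^2+\|\operatorname{div}\psi\|_{L^2}^2$.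 Let $H^1_{\Gamma_D}$ (respectively $D_{\Gamma_N}$) be the closure in $H^1(\Omega)$ (respectively $D(\Omega)$) of the restrictions to $\Omega$ of the functions in $C_c^\infty(\mathbb{R}^d)$ (respectively fields in $C_c^\infty(\mathbb{R}^d;\mathbb{R}^d)$) whose support is bounded away from $\Gamma_D$ (respectively $\Gamma_N$). Suppose that $(\tilde u,\tilde p)\in H^2(\Omega)\times H^1(\Omega;\mathbb{R}^d)$ satisfies $u-\tilde u\in H^1_{\Gamma_D}$, $p-\tilde p\in D_{\Gamma_N}$ and $n\cdot(p-\tilde p)+\gamma(u-\tilde u)=0$ on $\Gamma_R$. Then $$\|u-\tilde u\|_{H^1}^2+\|p-\tilde p\|_{D}^2+\|u-\tilde u\|_{L^2(\Gamma_R),\gamma}^2+\|n\cdot(p-\tilde p)\|_{L^2(\Gamma_R),\gamma^{-1}}^2=\mathcal M_{\mathrm{mix}}(\tilde u,\tilde p):=\|f-\tilde u+\operatorname{div}\tilde p\|_{L^2}^2+\|\tilde p-\nabla\tilde u\|_{L^2}^2,$$ where $\|v\|_{L^2(\Gamma_R),w}^2:=\int_{\Gamma_R}w\,|v|^2$. Moreover,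 $$\|u-\tilde u\|_{L^2(\Gamma_R),\gamma}=\|n\cdot(p-\tilde p)\|_{L^2(\Gamma_R),\gamma^{-1}} .$$ -/

import Mathlib

open MeasureTheory Filter Topology
open scoped ContDiff

noncomputable section

namespace RobinModel

variable {d : ℕ}

/-! ### The domain, its surface measure and its outward unit normal -/

/-- `Ω` has a Lipschitz boundary: near each of its boundary points, `Ω` is the strict epigraph, in
some unit direction `e`, of a Lipschitz function `g` of the component orthogonal to `e`
(only the values of `g` on the hyperplane orthogonal to `e` matter). -/
def HasLipschitzBoundary (Ω : Set (EuclideanSpace ℝ (Fin d))) : Prop :=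
  ∀ x ∈ frontier Ω, ∃ (e : EuclideanSpace ℝ (Fin d)) (g : EuclideanSpace ℝ (Fin d) → ℝ)
    (K : NNReal) (r : ℝ), ‖e‖ = 1 ∧ LipschitzWith K g ∧ 0 < r ∧
      ∀ y ∈ Metric.ball x r, y ∈ Ω ↔ g (y - inner ℝ e y • e) < inner ℝ e y

/-- The surface measure of `Γ = ∂Ω`: the `(d-1)`-dimensional Hausdorff measure, normalized to agree
with Lebesgue measure on `(d-1)`-dimensional Euclidean spaces, restricted to `Γ`. -/
def surfaceMeasure (Ω : Set (EuclideanSpace ℝ (Fin d))) : Measure (EuclideanSpace ℝ (Fin d)) :=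
  (Measure.euclideanHausdorffMeasure (d - 1)).restrict (frontier Ω)

/-- `n` is the outward unit normal of `Ω` at `x`: infinitesimally at `x`, `Ω` is the half space
`{y | (y - x) · n < 0}`. There is at most one such `n`; for a Lipschitz boundary it exists
at almost every boundary point. -/
def IsOutwardNormal (Ω : Set (EuclideanSpace ℝ (Fin d))) (x n : EuclideanSpace ℝ (Fin d)) : Prop :=
  ‖n‖ = 1 ∧ ∀ ε > 0, ∃ r > 0, ∀ y ∈ Metric.ball x r,
    (inner ℝ (y - x) n < -ε * ‖y - x‖ → y ∈ Ω) ∧ (ε * ‖y - x‖ < inner ℝ (y - x) n → y ∉ Ω)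

open Classical in
/-- The outward unit normal field of `Ω` (zero where it does not exist). -/
def outwardNormal (Ω : Set (EuclideanSpace ℝ (Fin d))) (x : EuclideanSpace ℝ (Fin d)) :
    EuclideanSpace ℝ (Fin d) :=
  if h : ∃ n, IsOutwardNormal Ω x n then h.choose else 0

/-- The decomposition of `Γ = ∂Ω` into three disjoint parts `ΓD`, `ΓN`, `ΓR`. Sets of surface
measure zero (the interfaces) are disregarded, and the Neumann part is relatively open in `Γ` up to
such a set. -/
structure IsBoundaryDecomposition (Ω ΓD ΓN ΓR : Set (EuclideanSpace ℝ (Fin d))) : Prop where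
  measurable_D : MeasurableSet ΓD
  measurable_N : MeasurableSet ΓN
  measurable_R : MeasurableSet ΓR
  subset_D : ΓD ⊆ frontier Ω
  subset_N : ΓN ⊆ frontier Ω
  subset_R : ΓR ⊆ frontier Ω
  disjoint_DN : Disjoint ΓD ΓN
  disjoint_DR : Disjoint ΓD ΓR
  disjoint_NR : Disjoint ΓN ΓR
  cover : surfaceMeasure Ω (frontier Ω \ (ΓD ∪ ΓN ∪ ΓR)) = 0
  open_N : ∃ V, IsOpen V ∧ V ∩ frontier Ω ⊆ ΓN ∧ surfaceMeasure Ω (ΓN \ V) = 0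

/-! ### Weak derivatives and Sobolev spaces on `Ω` -/

/-- Square integrability on `Ω`, for scalar- and vector-valued functions. -/
def MemL2 {F : Type*} [NormedAddCommGroup F] (Ω : Set (EuclideanSpace ℝ (Fin d)))
    (v : EuclideanSpace ℝ (Fin d) → F) : Prop :=
  MemLp v 2 (volume.restrict Ω)

/-- `φ ∈ C_c^∞(ℝ^d)`. -/
def IsTest {F : Type*} [NormedAddCommGroup F] [NormedSpace ℝ F]
    (φ : EuclideanSpace ℝ (Fin d) → F) : Prop :=
  ContDiff ℝ ∞ φ ∧ HasCompactSupport φ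

/-- The classical divergence of a smooth vector field. -/
def classicalDiv (ψ : EuclideanSpace ℝ (Fin d) → EuclideanSpace ℝ (Fin d))
    (x : EuclideanSpace ℝ (Fin d)) : ℝ :=
  ∑ i, fderiv ℝ ψ x (EuclideanSpace.single i 1) i

/-- `G ∈ L²(Ω)` is the weak gradient of `v` on `Ω`. -/
def HasWeakGrad (Ω : Set (EuclideanSpace ℝ (Fin d))) (v : EuclideanSpace ℝ (Fin d) → ℝ)
    (G : EuclideanSpace ℝ (Fin d) → EuclideanSpace ℝ (Fin d)) : Prop :=
  MemL2 Ω G ∧ ∀ φ : EuclideanSpace ℝ (Fin d) → EuclideanSpace ℝ (Fin d),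
    IsTest φ → tsupport φ ⊆ Ω →
      ∫ x in Ω, inner ℝ (G x) (φ x) = -∫ x in Ω, v x * classicalDiv φ x

/-- `δ ∈ L²(Ω)` is the weak divergence of `ψ` on `Ω`. -/
def HasWeakDiv (Ω : Set (EuclideanSpace ℝ (Fin d)))
    (ψ : EuclideanSpace ℝ (Fin d) → EuclideanSpace ℝ (Fin d))
    (δ : EuclideanSpace ℝ (Fin d) → ℝ) : Prop :=
  MemL2 Ω δ ∧ ∀ φ : EuclideanSpace ℝ (Fin d) → ℝ, IsTest φ → tsupport φ ⊆ Ω →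
    ∫ x in Ω, δ x * φ x = -∫ x in Ω, inner ℝ (ψ x) (gradient φ x)

open Classical in
/-- The weak gradient `∇v` (a representative of the unique class; zero if there is none). -/
def weakGrad (Ω : Set (EuclideanSpace ℝ (Fin d))) (v : EuclideanSpace ℝ (Fin d) → ℝ) :
    EuclideanSpace ℝ (Fin d) → EuclideanSpace ℝ (Fin d) :=
  if h : ∃ G, HasWeakGrad Ω v G then h.choose else 0

open Classical in
/-- The weak divergence `div ψ` (a representative of the unique class; zero if there is none). -/
def weakDiv (Ω : Set (EuclideanSpace ℝ (Fin d)))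
    (ψ : EuclideanSpace ℝ (Fin d) → EuclideanSpace ℝ (Fin d)) :
    EuclideanSpace ℝ (Fin d) → ℝ :=
  if h : ∃ δ, HasWeakDiv Ω ψ δ then h.choose else 0

/-- `v ∈ H¹(Ω)`. -/
def MemH1 (Ω : Set (EuclideanSpace ℝ (Fin d))) (v : EuclideanSpace ℝ (Fin d) → ℝ) : Prop :=
  MemL2 Ω v ∧ ∃ G, HasWeakGrad Ω v G

/-- `ψ ∈ H¹(Ω)` for a vector field `ψ`, componentwise. -/
def MemH1Vec (Ω : Set (EuclideanSpace ℝ (Fin d)))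
    (ψ : EuclideanSpace ℝ (Fin d) → EuclideanSpace ℝ (Fin d)) : Prop :=
  ∀ i, MemH1 Ω (fun x => ψ x i)

/-- `v ∈ H²(Ω)`. -/
def MemH2 (Ω : Set (EuclideanSpace ℝ (Fin d))) (v : EuclideanSpace ℝ (Fin d) → ℝ) : Prop :=
  MemH1 Ω v ∧ MemH1Vec Ω (weakGrad Ω v)

/-- `ψ ∈ D(Ω)`: the field `ψ` and its weak divergence are in `L²(Ω)`. -/
def MemD (Ω : Set (EuclideanSpace ℝ (Fin d)))
    (ψ : EuclideanSpace ℝ (Fin d) → EuclideanSpace ℝ (Fin d)) : Prop :=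
  MemL2 Ω ψ ∧ ∃ δ, HasWeakDiv Ω ψ δ

/-- The sequence of test functions `φ k` converges to `v` in the norm of `H¹(Ω)`. -/
def TendstoH1 (Ω : Set (EuclideanSpace ℝ (Fin d)))
    (φ : ℕ → EuclideanSpace ℝ (Fin d) → ℝ) (v : EuclideanSpace ℝ (Fin d) → ℝ) : Prop :=
  Tendsto (fun k => eLpNorm (φ k - v) 2 (volume.restrict Ω)) atTop (𝓝 0) ∧
  Tendsto (fun k => eLpNorm (gradient (φ k) - weakGrad Ω v) 2 (volume.restrict Ω)) atTop (𝓝 0)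

/-- The sequence of test fields `φ k` converges to `ψ` in the norm of `D(Ω)`. -/
def TendstoD (Ω : Set (EuclideanSpace ℝ (Fin d)))
    (φ : ℕ → EuclideanSpace ℝ (Fin d) → EuclideanSpace ℝ (Fin d))
    (ψ : EuclideanSpace ℝ (Fin d) → EuclideanSpace ℝ (Fin d)) : Prop :=
  Tendsto (fun k => eLpNorm (φ k - ψ) 2 (volume.restrict Ω)) atTop (𝓝 0) ∧
  Tendsto (fun k => eLpNorm (classicalDiv (φ k) - weakDiv Ω ψ) 2 (volume.restrict Ω)) atTop (𝓝 0)

/-- The support of `φ` is bounded away from `S`. -/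
def SupportAwayFrom {F : Type*} [Zero F] (φ : EuclideanSpace ℝ (Fin d) → F)
    (S : Set (EuclideanSpace ℝ (Fin d))) : Prop :=
  ∃ δ > 0, ∀ x ∈ tsupport φ, ∀ y ∈ S, δ ≤ dist x y

/-- `v ∈ H¹_S(Ω)`: the closure in `H¹(Ω)` of the test functions with support bounded away
from `S`. -/
def MemH1Vanishing (Ω S : Set (EuclideanSpace ℝ (Fin d)))
    (v : EuclideanSpace ℝ (Fin d) → ℝ) : Prop :=
  MemH1 Ω v ∧ ∃ φ : ℕ → EuclideanSpace ℝ (Fin d) → ℝ,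
    (∀ k, IsTest (φ k) ∧ SupportAwayFrom (φ k) S) ∧ TendstoH1 Ω φ v

/-- `ψ ∈ D_S(Ω)`: the closure in `D(Ω)` of the test fields with support bounded away from `S`. -/
def MemDVanishing (Ω S : Set (EuclideanSpace ℝ (Fin d)))
    (ψ : EuclideanSpace ℝ (Fin d) → EuclideanSpace ℝ (Fin d)) : Prop :=
  MemD Ω ψ ∧ ∃ φ : ℕ → EuclideanSpace ℝ (Fin d) → EuclideanSpace ℝ (Fin d),
    (∀ k, IsTest (φ k) ∧ SupportAwayFrom (φ k) S) ∧ TendstoD Ω φ ψ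

/-! ### Boundary traces -/

/-- `t ∈ L²(Γ)` is the trace of `v ∈ H¹(Ω)` under the continuous extension to `H¹(Ω)` of the
restriction `φ ↦ φ|_Γ` of test functions `φ ∈ C_c^∞(ℝ^d)`. -/
def IsTrace (Ω : Set (EuclideanSpace ℝ (Fin d))) (v t : EuclideanSpace ℝ (Fin d) → ℝ) : Prop :=
  MemLp t 2 (surfaceMeasure Ω) ∧ ∃ φ : ℕ → EuclideanSpace ℝ (Fin d) → ℝ,
    (∀ k, IsTest (φ k)) ∧ TendstoH1 Ω φ v ∧
    Tendsto (fun k => eLpNorm (φ k - t) 2 (surfaceMeasure Ω)) atTop (𝓝 0)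

open Classical in
/-- The trace of `v` on `Γ` (a representative of the unique class; zero if there is none). -/
def trace (Ω : Set (EuclideanSpace ℝ (Fin d))) (v : EuclideanSpace ℝ (Fin d) → ℝ) :
    EuclideanSpace ℝ (Fin d) → ℝ :=
  if h : ∃ t, IsTrace Ω v t then h.choose else 0

/-- The normal trace `n · ψ` on `Γ` of a vector field `ψ ∈ H¹(Ω)`. -/
def normalTrace (Ω : Set (EuclideanSpace ℝ (Fin d)))
    (ψ : EuclideanSpace ℝ (Fin d) → EuclideanSpace ℝ (Fin d))
    (x : EuclideanSpace ℝ (Fin d)) : ℝ :=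
  ∑ i, outwardNormal Ω x i * trace Ω (fun y => ψ y i) x

/-! ### Norms, coefficient, model problem, majorant -/

/-- The norm of `L²(Ω)`, for scalar- and vector-valued functions. -/
def l2Norm {F : Type*} [NormedAddCommGroup F] (Ω : Set (EuclideanSpace ℝ (Fin d)))
    (v : EuclideanSpace ℝ (Fin d) → F) : ℝ :=
  Real.sqrt (∫ x in Ω, ‖v x‖ ^ 2)

/-- The norm of `H¹(Ω)`. -/
def h1Norm (Ω : Set (EuclideanSpace ℝ (Fin d))) (v : EuclideanSpace ℝ (Fin d) → ℝ) : ℝ :=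
  Real.sqrt (l2Norm Ω v ^ 2 + l2Norm Ω (weakGrad Ω v) ^ 2)

/-- The norm of `D(Ω)`. -/
def dNorm (Ω : Set (EuclideanSpace ℝ (Fin d)))
    (ψ : EuclideanSpace ℝ (Fin d) → EuclideanSpace ℝ (Fin d)) : ℝ :=
  Real.sqrt (l2Norm Ω ψ ^ 2 + l2Norm Ω (weakDiv Ω ψ) ^ 2)

/-- The combined norm of a pair in `H¹(Ω) × D(Ω)`. -/
def combinedNorm (Ω : Set (EuclideanSpace ℝ (Fin d))) (v : EuclideanSpace ℝ (Fin d) → ℝ)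
    (ψ : EuclideanSpace ℝ (Fin d) → EuclideanSpace ℝ (Fin d)) : ℝ :=
  Real.sqrt (h1Norm Ω v ^ 2 + dNorm Ω ψ ^ 2)

/-- The weighted boundary norm of `L²(S)`, `S ⊆ Γ`, with weight `w`. -/
def boundaryNorm (Ω S : Set (EuclideanSpace ℝ (Fin d))) (w t : EuclideanSpace ℝ (Fin d) → ℝ) : ℝ :=
  Real.sqrt (∫ x in S, w x * t x ^ 2 ∂surfaceMeasure Ω)

/-- The Robin coefficient: `γ ∈ L^∞(ΓR)` and `γ ≥ γ₀ > 0`. -/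
def IsRobinCoefficient (Ω ΓR : Set (EuclideanSpace ℝ (Fin d)))
    (γ : EuclideanSpace ℝ (Fin d) → ℝ) : Prop :=
  MemLp γ ⊤ ((surfaceMeasure Ω).restrict ΓR) ∧
    ∃ γ₀ > 0, ∀ᵐ x ∂(surfaceMeasure Ω).restrict ΓR, γ₀ ≤ γ x

/-- `u ∈ H²(Ω)` solves `-div ∇u + u = f` in `Ω` with `u = g₁` on `ΓD`, `n · ∇u = g₂` on `ΓN` and
`n · ∇u + γ u = g₃` on `ΓR`. -/
structure SolvesModelProblem (Ω ΓD ΓN ΓR : Set (EuclideanSpace ℝ (Fin d)))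
    (γ f g₁ g₂ g₃ u : EuclideanSpace ℝ (Fin d) → ℝ) : Prop where
  memH2 : MemH2 Ω u
  equation : ∀ᵐ x ∂volume.restrict Ω, -weakDiv Ω (weakGrad Ω u) x + u x = f x
  dirichlet : ∀ᵐ x ∂(surfaceMeasure Ω).restrict ΓD, trace Ω u x = g₁ x
  neumann : ∀ᵐ x ∂(surfaceMeasure Ω).restrict ΓN, normalTrace Ω (weakGrad Ω u) x = g₂ x
  robin : ∀ᵐ x ∂(surfaceMeasure Ω).restrict ΓR,
    normalTrace Ω (weakGrad Ω u) x + γ x * trace Ω u x = g₃ x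

/-- The functional `M_mix(v, ψ) = ‖f - v + div ψ‖² + ‖ψ - ∇v‖²`. -/
def mixMajorant (Ω : Set (EuclideanSpace ℝ (Fin d))) (f v : EuclideanSpace ℝ (Fin d) → ℝ)
    (ψ : EuclideanSpace ℝ (Fin d) → EuclideanSpace ℝ (Fin d)) : ℝ :=
  l2Norm Ω (f - v + weakDiv Ω ψ) ^ 2 + l2Norm Ω (ψ - weakGrad Ω v) ^ 2

end RobinModel

end

/-!
Put `w = u - ũ` and `q = p - p̃`. Since `(u, p)` solves the first order system `f = u - div p`,
`p = ∇u`, the majorant is the residual of the error, `‖w - div q‖² + ‖∇w - q‖²`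
(`mixMajorant_eq`). Expanding the squares gives `‖w‖²_{H¹} + ‖q‖²_D` minus twice
`∫_Ω (w div q + ∇w · q)`, which Green's formula (`green_normalTrace`) turns into
`∫_Γ w (n · q)`. The trace of `w` vanishes on `Γ_D`, the normal trace of `q` vanishes on `Γ_N`, and
`n · q = -γ w` on `Γ_R`; so the boundary integral is `-‖w‖²_{L²(Γ_R),γ}`, and the same relation gives
`γ⁻¹ (n · q)² = γ w²`, that is, the equality of the two boundary norms. The signs and the factor two
yield the identity.

What has to be proved is therefore that traces exist and satisfy Green's formula on an open set with
compact Lipschitz boundary, for the Hausdorff measure and the infinitesimal outward normal.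

* The boundary is locally the graph of a Lipschitz function `g` over a hyperplane. By Rademacher's
  theorem `g` is almost everywhere differentiable; on small pieces it is close to a linear
  functional, and comparing Hausdorff measures piece by piece gives the area formula
  `map_graphMeasure`, with density `√(1 + |∇g|²)`. Where `g` is differentiable, the outward normal is
  `(∇g - e) / √(1 + |∇g|²)` (`IsEpigraphChart.isOutwardNormal_graphNormal`).
* Over the epigraph of `g`, a directional derivative splits into a part tangential to the translated
  graphs, whose integral vanishes, and a multiple of the derivative along `e`, which is integrated by
  the fundamental theorem of calculus (`setIntegral_epigraph_fderiv`). A partition of unity yields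
  the divergence theorem for test functions (`setIntegral_fderiv_eq_boundary`).
* Tested with `b φ² e`, where `e` is a chart direction and `b` a cutoff, the divergence theorem gives
  the trace inequality (`exists_trace_bound`), because `-e · n` is bounded from below.
* Test functions are dense in `H¹(Ω)` (`HasWeakGrad.testApproximable`): localize, translate into the
  domain along the chart direction, and mollify.
* Hence every function in `H¹(Ω)` has a trace, to which the boundary values of each approximating
  sequence of test functions converge, and Green's formula passes to the limit (`green`). For
  `H¹_{Γ_D}` the vanishing of the trace is then immediate. For `D_{Γ_N}` the approximating fields
  converge only in `D(Ω)`, so the normal trace is tested, through Green's formula, against test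
  functions supported near the relatively open part `Γ_N`
  (`MemDVanishing.ae_normalTrace_eq_zero`).
-/

noncomputable section

namespace RobinModel

/-! ### The area formula for Lipschitz graphs -/

section AreaFormula

open Measure Set
open scoped NNReal ENNReal

/-- If distances of `P`-images are at most `K` times distances of `Q`-images, then the same holds,
with factor `K ^ m`, for the `m`-dimensional Hausdorff measures of the images. -/
lemma euclideanHausdorffMeasure_image_le_image {A X Y : Type*}
    [MetricSpace X] [MeasurableSpace X] [BorelSpace X]
    [MetricSpace Y] [MeasurableSpace Y] [BorelSpace Y]
    {P : A → X} {Q : A → Y} {K : ℝ≥0} {s : Set A} (m : ℕ)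
    (h : ∀ x ∈ s, ∀ y ∈ s, dist (P x) (P y) ≤ K * dist (Q x) (Q y)) :
    euclideanHausdorffMeasure m (P '' s)
      ≤ (K : ℝ≥0∞) ^ m * euclideanHausdorffMeasure m (Q '' s) := by
  rcases s.eq_empty_or_nonempty with rfl | ⟨a, ha⟩
  · simp
  have : Nonempty A := ⟨a⟩
  have hmem : ∀ z ∈ Q '' s, Function.invFunOn Q s z ∈ s ∧ Q (Function.invFunOn Q s z) = z :=
    fun z hz => ⟨Function.invFunOn_mem hz, Function.invFunOn_eq hz⟩
  have hL : LipschitzOnWith K (P ∘ Function.invFunOn Q s) (Q '' s) := by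
    refine LipschitzOnWith.of_dist_le_mul fun z hz w hw => ?_
    have := h _ (hmem z hz).1 _ (hmem w hw).1
    rwa [(hmem z hz).2, (hmem w hw).2] at this
  have himg : P '' s ⊆ (P ∘ Function.invFunOn Q s) '' (Q '' s) := by
    rintro _ ⟨x, hx, rfl⟩
    refine ⟨Q x, ⟨x, hx, rfl⟩, ?_⟩
    have hz := hmem (Q x) ⟨x, hx, rfl⟩
    have := h _ hz.1 _ hx
    rw [hz.2, dist_self, mul_zero] at this
    exact dist_le_zero.1 this
  refine (measure_mono himg).trans ?_
  have := hL.hausdorffMeasure_image_le (d := (m : ℝ)) (by positivity)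
  simp only [euclideanHausdorffMeasure_def, Measure.smul_apply, ENNReal.smul_def, smul_eq_mul]
  rw [ENNReal.rpow_natCast] at this
  calc _ ≤ _ := mul_le_mul_right this _
    _ = _ := by ring

/-- The factor `√(1 + ‖ℓ‖²)` by which the graph of a linear functional `ℓ` stretches volume. -/
def areaFactor {H : Type*} [NormedAddCommGroup H] [InnerProductSpace ℝ H] (l : H →L[ℝ] ℝ) : ℝ :=
  Real.sqrt (1 + ‖l‖ ^ 2)

section
variable {H : Type*} [NormedAddCommGroup H] [InnerProductSpace ℝ H]

lemma sq_areaFactor (l : H →L[ℝ] ℝ) : areaFactor l ^ 2 = 1 + ‖l‖ ^ 2 :=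
  Real.sq_sqrt (by positivity)

lemma one_le_areaFactor (l : H →L[ℝ] ℝ) : 1 ≤ areaFactor l := by
  have := sq_areaFactor l
  have h0 : 0 ≤ areaFactor l := Real.sqrt_nonneg _
  nlinarith [sq_nonneg ‖l‖]

lemma areaFactor_pos (l : H →L[ℝ] ℝ) : 0 < areaFactor l :=
  zero_lt_one.trans_le (one_le_areaFactor l)

lemma continuous_areaFactor : Continuous (areaFactor : (H →L[ℝ] ℝ) → ℝ) := by
  unfold areaFactor; fun_prop

lemma areaFactor_le_add (l k : H →L[ℝ] ℝ) : areaFactor l ≤ areaFactor k + ‖l - k‖ := by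
  have h1 : ‖l‖ ≤ ‖k‖ + ‖l - k‖ := by
    simpa using norm_add_le k (l - k)
  have hk : ‖k‖ ≤ areaFactor k := Real.le_sqrt_of_sq_le (by linarith)
  refine Real.sqrt_le_iff.2 ⟨by have := areaFactor_pos k; positivity, ?_⟩
  nlinarith [sq_areaFactor k, norm_nonneg l, norm_nonneg k, norm_nonneg (l - k)]

lemma areaFactor_le_mul {l k : H →L[ℝ] ℝ} {r : ℝ} (h : ‖l - k‖ ≤ r) :
    areaFactor l ≤ (1 + r) * areaFactor k := by
  have := areaFactor_le_add l k
  nlinarith [one_le_areaFactor k, norm_nonneg (l - k)]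

/-- The graph of a linear functional `l` on `H` is, metrically, the image of `H` under an
endomorphism of determinant `areaFactor l`. -/
lemma exists_linearMap_norm_sq_eq [FiniteDimensional ℝ H] (l : H →L[ℝ] ℝ) :
    ∃ B : H →ₗ[ℝ] H, (∀ y, ‖B y‖ ^ 2 = ‖y‖ ^ 2 + l y ^ 2) ∧ LinearMap.det B = areaFactor l := by
  set a : H := (InnerProductSpace.toDual ℝ H).symm l with ha
  have hl : ∀ y, l y = inner ℝ a y := fun y => by simp [ha]
  have hna : ‖a‖ = ‖l‖ := by simp [ha]
  set J := areaFactor l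
  have hJ : J ^ 2 = 1 + ‖a‖ ^ 2 := by rw [hna]; exact sq_areaFactor l
  have hJ1 : 1 ≤ J := one_le_areaFactor l
  -- `c` solves `2 c + c² ‖a‖² = 1`, so that `y ↦ y + c (l y) a` has the required norms.
  have hc : 2 * (1 + J)⁻¹ + ((1 + J)⁻¹) ^ 2 * ‖a‖ ^ 2 = 1 := by
    rw [show ‖a‖ ^ 2 = J ^ 2 - 1 by linarith]
    have : 1 + J ≠ 0 := by positivity
    field_simp; ring
  refine ⟨LinearMap.transvection (l : Module.Dual ℝ H) ((1 + J)⁻¹ • a), fun y => ?_, ?_⟩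
  · simp only [LinearMap.transvection.apply]
    have : ((l : Module.Dual ℝ H)) y = l y := rfl
    rw [this, norm_add_sq_real, norm_smul, norm_smul, mul_pow, mul_pow, inner_smul_right,
      inner_smul_right, real_inner_comm a y, ← hl, Real.norm_eq_abs, Real.norm_eq_abs, sq_abs, sq_abs]
    linear_combination (l y) ^ 2 * hc
  · rw [LinearMap.transvection.det]
    have : ((l : Module.Dual ℝ H)) ((1 + J)⁻¹ • a) = (1 + J)⁻¹ * ‖a‖ ^ 2 := by
      have : ((l : Module.Dual ℝ H)) ((1 + J)⁻¹ • a) = l ((1 + J)⁻¹ • a) := rfl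
      rw [this, hl, inner_smul_right, real_inner_self_eq_norm_sq]
    rw [this, show ‖a‖ ^ 2 = J ^ 2 - 1 by linarith]
    have : 1 + J ≠ 0 := by positivity
    field_simp; ring

end

/-- A comparison of two measures on the pieces of a countable partition gives a comparison. -/
lemma measure_le_mul_of_partition {A : Type*} [MeasurableSpace A] {ν ν' : Measure A} {c : ℝ≥0∞}
    {s : Set A} (hs : MeasurableSet s) {t : ℕ → Set A} (ht : ∀ n, MeasurableSet (t n))
    (hd : Pairwise (Function.onFun Disjoint t)) (hst : s ⊆ ⋃ n, t n)
    (h : ∀ n, ν (s ∩ t n) ≤ c * ν' (s ∩ t n)) : ν s ≤ c * ν' s := by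
  have hs' : s = ⋃ n, s ∩ t n := by rw [← inter_iUnion, inter_eq_left.2 hst]
  calc ν s = ν (⋃ n, s ∩ t n) := by rw [← hs']
    _ ≤ ∑' n, ν (s ∩ t n) := measure_iUnion_le _
    _ ≤ ∑' n, c * ν' (s ∩ t n) := ENNReal.tsum_le_tsum h
    _ = c * ∑' n, ν' (s ∩ t n) := ENNReal.tsum_mul_left
    _ = c * ν' (⋃ n, s ∩ t n) := by
      rw [measure_iUnion (fun i j hij => (hd hij).mono inter_subset_right inter_subset_right)
        (fun n => hs.inter (ht n))]
    _ = c * ν' s := by rw [← hs']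

variable {V : Type*} [NormedAddCommGroup V] [InnerProductSpace ℝ V]

/-- The graph map `y ↦ y + g(y) e` of a function `g` on the hyperplane orthogonal to `e`. -/
def graphMap (e : V) (g : (ℝ ∙ e)ᗮ → ℝ) (y : (ℝ ∙ e)ᗮ) : V := (y : V) + g y • e

lemma inner_hyperplane (e : V) (y : (ℝ ∙ e)ᗮ) : inner ℝ e (y : V) = 0 :=
  Submodule.mem_orthogonal_singleton_iff_inner_right.1 y.2

lemma norm_sq_add_smul {e : V} (he : ‖e‖ = 1) (y : (ℝ ∙ e)ᗮ) (t : ℝ) :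
    ‖(y : V) + t • e‖ ^ 2 = ‖y‖ ^ 2 + t ^ 2 := by
  rw [norm_add_sq_real, inner_smul_right, real_inner_comm, inner_hyperplane, norm_smul, he]
  simp

lemma graphMap_sub (e : V) (g : (ℝ ∙ e)ᗮ → ℝ) (x y : (ℝ ∙ e)ᗮ) :
    graphMap e g x - graphMap e g y = ((x - y : (ℝ ∙ e)ᗮ) : V) + (g x - g y) • e := by
  simp only [graphMap, Submodule.coe_sub, sub_smul]; abel

lemma graphMap_injective {e : V} (he : ‖e‖ = 1) (g : (ℝ ∙ e)ᗮ → ℝ) :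
    Function.Injective (graphMap e g) := by
  intro x y hxy
  have h := norm_sq_add_smul he (x - y) (g x - g y)
  rw [← graphMap_sub, hxy, sub_self, norm_zero] at h
  have : ‖x - y‖ ^ 2 = 0 := by nlinarith [sq_nonneg ‖x - y‖, sq_nonneg (g x - g y)]
  exact sub_eq_zero.1 (norm_eq_zero.1 (pow_eq_zero_iff two_ne_zero |>.1 this))

lemma dist_graphMap_le {e : V} (he : ‖e‖ = 1) {g : (ℝ ∙ e)ᗮ → ℝ} {K : ℝ≥0}
    (hg : LipschitzWith K g) (x y : (ℝ ∙ e)ᗮ) :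
    dist (graphMap e g x) (graphMap e g y) ≤ ((1 + K : ℝ≥0) : ℝ) * dist x y := by
  rw [dist_eq_norm, graphMap_sub]
  refine (norm_add_le _ _).trans ?_
  rw [norm_smul, he, mul_one, ← Submodule.coe_norm]
  have := hg.dist_le_mul x y
  rw [dist_eq_norm, dist_eq_norm] at this
  rw [dist_eq_norm]
  push_cast
  linarith

lemma continuous_graphMap (e : V) {g : (ℝ ∙ e)ᗮ → ℝ} (hg : Continuous g) :
    Continuous (graphMap e g) := by
  unfold graphMap; fun_prop

variable [FiniteDimensional ℝ V] [MeasurableSpace V] [BorelSpace V]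

lemma measurableEmbedding_graphMap {e : V} (he : ‖e‖ = 1) {g : (ℝ ∙ e)ᗮ → ℝ} (hg : Continuous g) :
    MeasurableEmbedding (graphMap e g) :=
  (continuous_graphMap e hg).measurableEmbedding (graphMap_injective he g)

/-- On a set where `g` is close to the linear functional `l`, the Hausdorff measure of the graph is
close to `areaFactor l` times the volume. -/
lemma graphMap_image_le_and_ge {e : V} (he : ‖e‖ = 1) {g : (ℝ ∙ e)ᗮ → ℝ} {l : (ℝ ∙ e)ᗮ →L[ℝ] ℝ}
    {s : Set (ℝ ∙ e)ᗮ} {r : ℝ≥0} (hr : r < 1) (h : ApproximatesLinearOn g l s r)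
    {m : ℕ} (hm : Module.finrank ℝ (ℝ ∙ e)ᗮ = m) :
    euclideanHausdorffMeasure m (graphMap e g '' s)
        ≤ ((1 + r : ℝ≥0) : ℝ≥0∞) ^ m * (ENNReal.ofReal (areaFactor l) * volume s) ∧
      ENNReal.ofReal (areaFactor l) * volume s
        ≤ (((1 - r)⁻¹ : ℝ≥0) : ℝ≥0∞) ^ m * euclideanHausdorffMeasure m (graphMap e g '' s) := by
  obtain ⟨B, hB, hdet⟩ := exists_linearMap_norm_sq_eq l
  have hvol : euclideanHausdorffMeasure m (B '' s) = ENNReal.ofReal (areaFactor l) * volume s := by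
    subst hm
    rw [InnerProductSpace.euclideanHausdorffMeasure_eq_volume, Measure.addHaar_image_linearMap,
      hdet, abs_of_pos (areaFactor_pos l)]
  have hnB : ∀ z, ‖B z‖ = ‖(z : V) + l z • e‖ := fun z => by
    have := (hB z).trans (norm_sq_add_smul he z (l z)).symm
    exact (sq_eq_sq₀ (norm_nonneg _) (norm_nonneg _)).1 this
  have hzB : ∀ z, ‖z‖ ≤ ‖B z‖ := fun z =>
    le_of_sq_le_sq (by rw [hB]; nlinarith [sq_nonneg (l z)]) (norm_nonneg _)
  -- the graph differs from the graph of `l` by a small multiple of `e`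
  have key : ∀ x ∈ s, ∀ y ∈ s,
      ‖graphMap e g x - graphMap e g y - (((x - y : (ℝ ∙ e)ᗮ) : V) + l (x - y) • e)‖
        ≤ r * ‖B (x - y)‖ := by
    intro x hx y hy
    have h1 := h x hx y hy
    rw [graphMap_sub, add_sub_add_left_eq_sub, ← sub_smul, norm_smul, he, mul_one]
    exact h1.trans (mul_le_mul_of_nonneg_left (hzB _) r.2)
  rw [← hvol]
  constructor
  · refine euclideanHausdorffMeasure_image_le_image m fun x hx y hy => ?_
    rw [dist_eq_norm, dist_eq_norm, ← map_sub]
    have h1 := key x hx y hy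
    have h2 := norm_le_norm_add_norm_sub' (graphMap e g x - graphMap e g y)
      (((x - y : (ℝ ∙ e)ᗮ) : V) + l (x - y) • e)
    rw [← hnB] at h2
    push_cast
    linarith
  · refine euclideanHausdorffMeasure_image_le_image m fun x hx y hy => ?_
    rw [dist_eq_norm, dist_eq_norm, ← map_sub]
    have h1 := key x hx y hy
    have h2 := norm_le_norm_add_norm_sub' (((x - y : (ℝ ∙ e)ᗮ) : V) + l (x - y) • e)
      (graphMap e g x - graphMap e g y)
    rw [← hnB, norm_sub_rev _ (graphMap e g x - graphMap e g y)] at h2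
    have h3 : (0 : ℝ) < 1 - r := by have : (r : ℝ) < 1 := hr
                                    linarith
    rw [NNReal.coe_inv, NNReal.coe_sub hr.le, NNReal.coe_one, inv_mul_eq_div, le_div_iff₀ h3]
    linarith

/-- The surface measure of the graph of `g`, expressed in the hyperplane: volume with density
`√(1 + |∇g|²)`. Where `g` is not differentiable, the density is the junk value `1`; this is a null
set for Lipschitz `g`. -/
def graphMeasure (e : V) (g : (ℝ ∙ e)ᗮ → ℝ) : Measure (ℝ ∙ e)ᗮ :=
  volume.withDensity fun y => ENNReal.ofReal (areaFactor (fderiv ℝ g y))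

lemma measurable_areaFactor_fderiv {H : Type*} [NormedAddCommGroup H] [InnerProductSpace ℝ H]
    [FiniteDimensional ℝ H] [MeasurableSpace H] [BorelSpace H] (g : H → ℝ) :
    Measurable fun y => areaFactor (fderiv ℝ g y) :=
  continuous_areaFactor.measurable.comp (measurable_fderiv ℝ g)

lemma graphMeasure_le_and_ge {e : V} {g : (ℝ ∙ e)ᗮ → ℝ} {s : Set (ℝ ∙ e)ᗮ}
    (hs : MeasurableSet s) {l : (ℝ ∙ e)ᗮ →L[ℝ] ℝ} {r : ℝ} (h0 : 0 ≤ r)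
    (h : ∀ y ∈ s, ‖fderiv ℝ g y - l‖ ≤ r) :
    graphMeasure e g s ≤ ENNReal.ofReal (1 + r) * (ENNReal.ofReal (areaFactor l) * volume s) ∧
    ENNReal.ofReal (areaFactor l) * volume s ≤ ENNReal.ofReal (1 + r) * graphMeasure e g s := by
  rw [graphMeasure, withDensity_apply _ hs]
  constructor
  · rw [← mul_assoc, ← ENNReal.ofReal_mul (by linarith), ← setLIntegral_const]
    exact setLIntegral_mono measurable_const
      fun y hy => ENNReal.ofReal_le_ofReal (areaFactor_le_mul (h y hy))
  · rw [← lintegral_const_mul _ (measurable_areaFactor_fderiv g).ennreal_ofReal,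
      ← setLIntegral_const]
    refine setLIntegral_mono ((measurable_areaFactor_fderiv g).ennreal_ofReal.const_mul _)
      fun y hy => ?_
    rw [← ENNReal.ofReal_mul (by linarith)]
    refine ENNReal.ofReal_le_ofReal (areaFactor_le_mul ?_)
    rw [norm_sub_rev]; exact h y hy

/-- Approximate area formula: up to a factor that tends to one with `r`, the two measures agree. -/
lemma comap_graphMap_le_and_ge {e : V} (he : ‖e‖ = 1) {g : (ℝ ∙ e)ᗮ → ℝ} (hg : Continuous g)
    {s : Set (ℝ ∙ e)ᗮ} (hs : MeasurableSet s) (hd : ∀ y ∈ s, DifferentiableAt ℝ g y)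
    {m : ℕ} (hm : Module.finrank ℝ (ℝ ∙ e)ᗮ = m) {r : ℝ≥0} (hr0 : 0 < r) (hr : r < 1) :
    (euclideanHausdorffMeasure m).comap (graphMap e g) s
        ≤ (((1 + r : ℝ≥0) : ℝ≥0∞) ^ m * ENNReal.ofReal (1 + 2 * r)) * graphMeasure e g s ∧
      graphMeasure e g s ≤ ((((1 - r)⁻¹ : ℝ≥0) : ℝ≥0∞) ^ m * ENNReal.ofReal (1 + 2 * r)) *
        (euclideanHausdorffMeasure m).comap (graphMap e g) s := by
  have hemb := measurableEmbedding_graphMap he hg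
  -- it suffices to treat sets on which the derivative of `g` varies by less than `2 r`
  suffices H : ∀ (c : (ℝ ∙ e)ᗮ →L[ℝ] ℝ) (s : Set (ℝ ∙ e)ᗮ), MeasurableSet s →
      (∀ y ∈ s, DifferentiableAt ℝ g y) → (∀ y ∈ s, dist (fderiv ℝ g y) c < r) →
      (euclideanHausdorffMeasure m).comap (graphMap e g) s
        ≤ (((1 + r : ℝ≥0) : ℝ≥0∞) ^ m * ENNReal.ofReal (1 + 2 * r)) * graphMeasure e g s ∧
      graphMeasure e g s ≤ ((((1 - r)⁻¹ : ℝ≥0) : ℝ≥0∞) ^ m * ENNReal.ofReal (1 + 2 * r)) *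
        (euclideanHausdorffMeasure m).comap (graphMap e g) s by
    set c := TopologicalSpace.denseSeq ((ℝ ∙ e)ᗮ →L[ℝ] ℝ)
    set t : ℕ → Set (ℝ ∙ e)ᗮ := fun n => {y | dist (fderiv ℝ g y) (c n) < r}
    have ht : ∀ n, MeasurableSet (t n) := fun n =>
      (measurable_fderiv ℝ g) (Metric.isOpen_ball (x := c n) (ε := r)).measurableSet
    have hst : s ⊆ ⋃ n, disjointed t n := by
      rw [iUnion_disjointed]
      intro y _
      obtain ⟨n, hn⟩ := (TopologicalSpace.denseRange_denseSeq
        ((ℝ ∙ e)ᗮ →L[ℝ] ℝ)).exists_dist_lt (fderiv ℝ g y) (NNReal.coe_pos.2 hr0)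
      exact mem_iUnion.2 ⟨n, hn⟩
    have hdm := fun n => MeasurableSet.disjointed (f := t) ht n
    have Hn := fun n => H (c n) (s ∩ disjointed t n) (hs.inter (hdm n)) (fun y hy => hd y hy.1)
      (fun y hy => disjointed_subset t n hy.2)
    exact ⟨measure_le_mul_of_partition hs hdm (disjoint_disjointed t) hst fun n => (Hn n).1,
      measure_le_mul_of_partition hs hdm (disjoint_disjointed t) hst fun n => (Hn n).2⟩
  intro c s hs hd hc
  rcases s.eq_empty_or_nonempty with rfl | hne
  · simp
  obtain ⟨t, A, htd, htm, hst, happ, hA⟩ :=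
    exists_partition_approximatesLinearOn_of_hasFDerivWithinAt g s (fderiv ℝ g)
      (fun y hy => (hd y hy).hasFDerivAt.hasFDerivWithinAt) (fun _ => r) (fun _ => hr0.ne')
  have hclose : ∀ n, ∀ y ∈ s ∩ t n, ‖fderiv ℝ g y - A n‖ ≤ 2 * r := by
    intro n y hy
    obtain ⟨z, hz, hzA⟩ := hA hne n
    rw [hzA]
    have h1 := dist_triangle_right (fderiv ℝ g y) (fderiv ℝ g z) c
    have h2 : dist (fderiv ℝ g y) (fderiv ℝ g z) = ‖fderiv ℝ g y - fderiv ℝ g z‖ :=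
      dist_eq_norm (E := (ℝ ∙ e)ᗮ →L[ℝ] ℝ) _ _
    linarith [hc y hy.1, hc z hz]
  constructor
  · refine measure_le_mul_of_partition hs htm htd hst fun n => ?_
    rw [hemb.comap_apply]
    refine (graphMap_image_le_and_ge he hr (happ n) hm).1.trans ?_
    rw [mul_assoc]
    exact mul_le_mul_right (graphMeasure_le_and_ge (hs.inter (htm n)) (by positivity)
      (hclose n)).2 _
  · refine measure_le_mul_of_partition hs htm htd hst fun n => ?_
    rw [hemb.comap_apply]
    refine (graphMeasure_le_and_ge (hs.inter (htm n)) (by positivity) (hclose n)).1.trans ?_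
    rw [mul_comm (_ ^ m), mul_assoc]
    exact mul_le_mul_right (graphMap_image_le_and_ge he hr (happ n) hm).2 _

/-- The area formula for the graph of a Lipschitz function. -/
theorem comap_graphMap_eq {e : V} (he : ‖e‖ = 1) {g : (ℝ ∙ e)ᗮ → ℝ} {K : ℝ≥0}
    (hg : LipschitzWith K g) {m : ℕ} (hm : Module.finrank ℝ (ℝ ∙ e)ᗮ = m) :
    (euclideanHausdorffMeasure m).comap (graphMap e g) = graphMeasure e g := by
  have hemb := measurableEmbedding_graphMap he hg.continuous
  set D : Set (ℝ ∙ e)ᗮ := {y | DifferentiableAt ℝ g y}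
  have hDm : MeasurableSet D := measurableSet_of_differentiableAt ℝ g
  have hD : volume Dᶜ = 0 := hg.ae_differentiableAt
  -- the part of the graph over the points of nondifferentiability is null, as a Lipschitz image
  have hν : (euclideanHausdorffMeasure m).comap (graphMap e g) Dᶜ = 0 := by
    rw [hemb.comap_apply]
    have h := euclideanHausdorffMeasure_image_le_image (P := graphMap e g)
      (Q := (id : (ℝ ∙ e)ᗮ → (ℝ ∙ e)ᗮ)) (s := Dᶜ) (K := 1 + K) m
      (fun x _ y _ => dist_graphMap_le he hg x y)
    rw [image_id] at h
    subst hm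
    rw [InnerProductSpace.euclideanHausdorffMeasure_eq_volume, hD, mul_zero] at h
    exact le_antisymm h zero_le
  have hν' : graphMeasure e g Dᶜ = 0 := withDensity_absolutelyContinuous _ _ hD
  have tendsto_coe : Tendsto (fun r : ℝ≥0 => (r : ℝ)) (𝓝[>] 0) (𝓝 0) :=
    (NNReal.continuous_coe.tendsto 0).mono_left nhdsWithin_le_nhds
  have hlt : ∀ᶠ r : ℝ≥0 in 𝓝[>] 0, 0 < r ∧ r < 1 :=
    Ioo_mem_nhdsGT (zero_lt_one)
  have t2 : Tendsto (fun r : ℝ≥0 => ENNReal.ofReal (1 + 2 * r)) (𝓝[>] 0) (𝓝 1) := by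
    have := ENNReal.tendsto_ofReal ((tendsto_coe.const_mul 2).const_add 1)
    simpa using this
  have tid : Tendsto (fun r : ℝ≥0 => r) (𝓝[>] 0) (𝓝 0) := tendsto_id.mono_left nhdsWithin_le_nhds
  have t1 : Tendsto (fun r : ℝ≥0 => ((1 + r : ℝ≥0) : ℝ≥0∞) ^ m) (𝓝[>] 0) (𝓝 1) := by
    have := (ENNReal.tendsto_coe.2 (tid.const_add 1))
    simpa using ENNReal.Tendsto.pow (n := m) this
  have t3 : Tendsto (fun r : ℝ≥0 => (((1 - r)⁻¹ : ℝ≥0) : ℝ≥0∞) ^ m) (𝓝[>] 0) (𝓝 1) := by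
    have h1 : Tendsto (fun r : ℝ≥0 => (1 - r)⁻¹) (𝓝[>] 0) (𝓝 1) := by
      have h2 : Tendsto (fun r : ℝ≥0 => 1 - r) (𝓝[>] 0) (𝓝 1) := by
        simpa using (tendsto_const_nhds (x := (1 : ℝ≥0))).sub tid
      simpa using h2.inv₀ one_ne_zero
    have := ENNReal.tendsto_coe.2 h1
    simpa using ENNReal.Tendsto.pow (n := m) this
  have hle : ∀ {ν ν' : Measure (ℝ ∙ e)ᗮ} {c : ℝ≥0 → ℝ≥0∞} {s : Set (ℝ ∙ e)ᗮ},
      Tendsto c (𝓝[>] 0) (𝓝 1) → (∀ r, 0 < r → r < 1 → ν s ≤ c r * ν' s) → ν s ≤ ν' s := by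
    intro ν ν' c s hc h
    have := ENNReal.Tendsto.mul_const (b := ν' s) hc (Or.inl one_ne_zero)
    rw [one_mul] at this
    refine ge_of_tendsto this ?_
    filter_upwards [hlt] with r hr using h r hr.1 hr.2
  have hc1 : Tendsto (fun r : ℝ≥0 => ((1 + r : ℝ≥0) : ℝ≥0∞) ^ m * ENNReal.ofReal (1 + 2 * r))
      (𝓝[>] 0) (𝓝 1) := by
    simpa using ENNReal.Tendsto.mul t1 (by simp) t2 (by simp)
  have hc2 : Tendsto (fun r : ℝ≥0 =>
      (((1 - r)⁻¹ : ℝ≥0) : ℝ≥0∞) ^ m * ENNReal.ofReal (1 + 2 * r)) (𝓝[>] 0) (𝓝 1) := by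
    simpa using ENNReal.Tendsto.mul t3 (by simp) t2 (by simp)
  ext s hs
  rw [← measure_inter_conull hν, ← measure_inter_conull (μ := graphMeasure e g) hν']
  have H := fun (r : ℝ≥0) (h0 : 0 < r) (h1 : r < 1) => comap_graphMap_le_and_ge he hg.continuous
    (hs.inter hDm) (fun y hy => hy.2) hm h0 h1
  exact le_antisymm (hle hc1 fun r h0 h1 => (H r h0 h1).1) (hle hc2 fun r h0 h1 => (H r h0 h1).2)

/-- On the graph of a Lipschitz function, the Hausdorff measure is the image of `graphMeasure`. -/
theorem map_graphMeasure {e : V} (he : ‖e‖ = 1) {g : (ℝ ∙ e)ᗮ → ℝ} {K : ℝ≥0}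
    (hg : LipschitzWith K g) {m : ℕ} (hm : Module.finrank ℝ (ℝ ∙ e)ᗮ = m) :
    (graphMeasure e g).map (graphMap e g)
      = (euclideanHausdorffMeasure m).restrict (range (graphMap e g)) := by
  rw [← comap_graphMap_eq he hg hm, (measurableEmbedding_graphMap he hg.continuous).map_comap]

end AreaFormula

/-! ### Integration by parts over a Lipschitz epigraph -/

section Epigraph

open Measure Set
open scoped NNReal ENNReal

variable {V : Type*} [NormedAddCommGroup V] [InnerProductSpace ℝ V]

/-- The orthogonal projection onto the hyperplane orthogonal to `e`. -/
def hyperplaneProj (e : V) : V →L[ℝ] (ℝ ∙ e)ᗮ := (ℝ ∙ e)ᗮ.orthogonalProjectionOnto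

lemma coe_hyperplaneProj {e : V} (he : ‖e‖ = 1) (x : V) :
    (hyperplaneProj e x : V) = x - inner ℝ e x • e := by
  rw [hyperplaneProj, Submodule.orthogonalProjectionOnto_orthogonal]
  simp [Submodule.starProjection_unit_singleton ℝ he]

lemma hyperplaneProj_add_smul {e : V} (he : ‖e‖ = 1) (x : V) :
    (hyperplaneProj e x : V) + inner ℝ e x • e = x := by
  rw [coe_hyperplaneProj he, sub_add_cancel]

lemma norm_hyperplaneProj_le (e : V) (x : V) : ‖hyperplaneProj e x‖ ≤ ‖x‖ :=
  Submodule.norm_orthogonalProjectionOnto_apply_le _ _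

lemma hyperplaneProj_coe_add_smul {e : V} (he : ‖e‖ = 1) (y : (ℝ ∙ e)ᗮ) (t : ℝ) :
    hyperplaneProj e ((y : V) + t • e) = y := by
  have h : inner ℝ e ((y : V) + t • e) = t := by
    rw [inner_add_right, inner_hyperplane, inner_smul_right, real_inner_self_eq_norm_sq, he]; simp
  exact Subtype.ext (by rw [coe_hyperplaneProj he, h, add_sub_cancel_right])

lemma inner_coe_add_smul {e : V} (he : ‖e‖ = 1) (y : (ℝ ∙ e)ᗮ) (t : ℝ) :
    inner ℝ e ((y : V) + t • e) = t := by
  rw [inner_add_right, inner_hyperplane, inner_smul_right, real_inner_self_eq_norm_sq, he]; simp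

lemma hyperplaneProj_graphMap_add_smul {e : V} (he : ‖e‖ = 1) (g : (ℝ ∙ e)ᗮ → ℝ) (y : (ℝ ∙ e)ᗮ)
    (t : ℝ) : hyperplaneProj e (graphMap e g y + t • e) = y := by
  rw [graphMap, add_assoc, ← add_smul, hyperplaneProj_coe_add_smul he]

lemma hyperplaneProj_graphMap {e : V} (he : ‖e‖ = 1) (g : (ℝ ∙ e)ᗮ → ℝ) (y : (ℝ ∙ e)ᗮ) :
    hyperplaneProj e (graphMap e g y) = y := hyperplaneProj_coe_add_smul he _ _

lemma inner_graphMap_add_smul {e : V} (he : ‖e‖ = 1) (g : (ℝ ∙ e)ᗮ → ℝ) (y : (ℝ ∙ e)ᗮ)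
    (t : ℝ) : inner ℝ e (graphMap e g y + t • e) = g y + t := by
  rw [graphMap, add_assoc, ← add_smul, inner_coe_add_smul he]

/-- The strict epigraph of `g` in direction `e`. -/
def epigraph (e : V) (g : (ℝ ∙ e)ᗮ → ℝ) : Set V := {x | g (hyperplaneProj e x) < inner ℝ e x}

variable [FiniteDimensional ℝ V] [MeasurableSpace V] [BorelSpace V]

/-- Fubini coordinates along `e` and its orthogonal hyperplane. -/
lemma measurePreserving_coe_add_smul {e : V} (he : ‖e‖ = 1) :
    MeasurePreserving (fun p : (ℝ ∙ e)ᗮ × ℝ => (p.1 : V) + p.2 • e)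
      (volume.prod volume) volume := by
  have h1 := ((ℝ ∙ e).measurePreserving_measurableEquivProd (0 : V)).symm
  rw [InnerProductSpace.euclideanHausdorffMeasure_eq_volume] at h1
  have h2 : MeasurePreserving (Prod.map (LinearIsometryEquiv.toSpanUnitSingleton (𝕜 := ℝ) e he)
      (id : (ℝ ∙ e)ᗮ → (ℝ ∙ e)ᗮ)) (volume.prod volume) (volume.prod volume) :=
    (LinearIsometryEquiv.measurePreserving _).prod (MeasurePreserving.id _)
  have h3 := h1.comp (h2.comp (Measure.measurePreserving_swap (μ := (volume : Measure (ℝ ∙ e)ᗮ))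
    (ν := (volume : Measure ℝ))))
  have h4 : (fun p : (ℝ ∙ e)ᗮ × ℝ => (p.1 : V) + p.2 • e) =
      ((ℝ ∙ e).measurableEquivProd (0 : V)).symm ∘
        Prod.map (LinearIsometryEquiv.toSpanUnitSingleton (𝕜 := ℝ) e he)
          (id : (ℝ ∙ e)ᗮ → (ℝ ∙ e)ᗮ) ∘ Prod.swap := by
    ext p
    simp [add_comm]
  rw [h4]
  exact h3

/-- The shear that flattens the graph of `g` preserves volume. -/
lemma measurePreserving_graphMap_add_smul {e : V} (he : ‖e‖ = 1) {g : (ℝ ∙ e)ᗮ → ℝ}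
    (hg : Continuous g) :
    MeasurePreserving (fun p : (ℝ ∙ e)ᗮ × ℝ => graphMap e g p.1 + p.2 • e)
      (volume.prod volume) volume := by
  have h1 : MeasurePreserving (fun p : (ℝ ∙ e)ᗮ × ℝ => (p.1, g p.1 + p.2))
      (volume.prod volume) (volume.prod volume) :=
    (MeasurePreserving.id _).skew_product (g := fun y t => g y + t)
      (by simp only [Function.uncurry_def]; fun_prop)
      (ae_of_all _ fun y => (measurePreserving_add_left volume (g y)).map_eq)
  convert (measurePreserving_coe_add_smul he).comp h1 using 1
  ext p
  simp [graphMap, add_smul, add_assoc]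

lemma measurableEmbedding_graphMap_add_smul {e : V} (he : ‖e‖ = 1) {g : (ℝ ∙ e)ᗮ → ℝ}
    (hg : Continuous g) :
    MeasurableEmbedding (fun p : (ℝ ∙ e)ᗮ × ℝ => graphMap e g p.1 + p.2 • e) := by
  refine Continuous.measurableEmbedding ?_ fun p q hpq => ?_
  · have := continuous_graphMap e hg
    fun_prop
  · have h1 := congrArg (hyperplaneProj e) hpq
    have h2 := congrArg (inner ℝ e) hpq
    simp only [hyperplaneProj_graphMap_add_smul he] at h1
    simp only [inner_graphMap_add_smul he, h1] at h2
    exact Prod.ext h1 (by linarith)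

/-- The integral of a tangential derivative over a translate of the graph vanishes: it is the integral
of a directional derivative of a compactly supported Lipschitz function on the hyperplane. -/
lemma integral_tangential_derivative_eq_zero {e : V} (he : ‖e‖ = 1) {g : (ℝ ∙ e)ᗮ → ℝ} {K : ℝ≥0}
    (hg : LipschitzWith K g) {φ : V → ℝ} (hφ : ContDiff ℝ 1 φ) (hc : HasCompactSupport φ)
    (w : (ℝ ∙ e)ᗮ) (t : ℝ) :
    ∫ y, fderiv ℝ φ (graphMap e g y + t • e) ((w : V) + fderiv ℝ g y w • e) = 0 := by
  set ψ : (ℝ ∙ e)ᗮ → ℝ := fun y => φ (graphMap e g y + t • e)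
  obtain ⟨C, hC⟩ := ContDiff.lipschitzWith_of_hasCompactSupport hc hφ one_ne_zero
  have hF : LipschitzWith (1 + K) fun y => graphMap e g y + t • e := by
    refine LipschitzWith.of_dist_le_mul fun x y => ?_
    rw [dist_add_right]
    exact dist_graphMap_le he hg x y
  have hψ : LipschitzWith (C * (1 + K)) ψ := hC.comp hF
  have hψc : HasCompactSupport ψ := by
    refine HasCompactSupport.intro ((show IsCompact (tsupport φ) from hc).image (hyperplaneProj e).continuous)
      fun y hy => ?_
    by_contra hne
    exact hy ⟨_, subset_tsupport _ hne, hyperplaneProj_graphMap_add_smul he g y t⟩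
  have h := LipschitzWith.integral_lineDeriv_mul_eq (μ := (volume : Measure (ℝ ∙ e)ᗮ))
    (LipschitzWith.const (1 : ℝ)) hψ hψc (-w)
  simp only [neg_neg, mul_one] at h
  have h0 : ∀ x : (ℝ ∙ e)ᗮ, lineDeriv ℝ (fun _ : (ℝ ∙ e)ᗮ => (1 : ℝ)) x (-w) = 0 := fun x => by
    simp [lineDeriv]
  simp only [h0, zero_mul, integral_zero] at h
  rw [h]
  refine integral_congr_ae ?_
  filter_upwards [hg.ae_differentiableAt (μ := volume)] with y hy
  have h1 : HasFDerivAt (fun y => graphMap e g y + t • e)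
      ((ℝ ∙ e)ᗮ.subtypeL + (fderiv ℝ g y).smulRight e) y := by
    unfold graphMap
    exact (((ℝ ∙ e)ᗮ.subtypeL.hasFDerivAt).add (hy.hasFDerivAt.smul_const e)).add_const _
  have h2 := ((hφ.differentiable one_ne_zero _).hasFDerivAt.comp y h1)
  exact (h2.hasLineDerivAt w).lineDeriv.symm

/-- Integration by parts over the epigraph of a Lipschitz function, with the boundary integral
written in the graph parametrization. -/
theorem setIntegral_epigraph_fderiv {e : V} (he : ‖e‖ = 1) {g : (ℝ ∙ e)ᗮ → ℝ} {K : ℝ≥0}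
    (hg : LipschitzWith K g) {φ : V → ℝ} (hφ : ContDiff ℝ 1 φ) (hc : HasCompactSupport φ) (v : V) :
    ∫ x in epigraph e g, fderiv ℝ φ x v
      = ∫ y, φ (graphMap e g y) * (fderiv ℝ g y (hyperplaneProj e v) - inner ℝ e v) := by
  set Ψ : (ℝ ∙ e)ᗮ × ℝ → V := fun p => graphMap e g p.1 + p.2 • e
  have hmp : MeasurePreserving Ψ (volume.prod volume) volume :=
    measurePreserving_graphMap_add_smul he hg.continuous
  have hemb : MeasurableEmbedding Ψ := measurableEmbedding_graphMap_add_smul he hg.continuous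
  have hpre : Ψ ⁻¹' epigraph e g = univ ×ˢ Ioi 0 := by
    ext p
    simp [Ψ, epigraph, hyperplaneProj_graphMap_add_smul he, inner_graphMap_add_smul he]
  set w := hyperplaneProj e v
  have hint : ∀ u : V, Integrable (fun p => fderiv ℝ φ (Ψ p) u) (volume.prod volume) := fun u =>
    (hmp.integrable_comp_emb hemb).2 (((hφ.continuous_fderiv one_ne_zero).clm_apply
      continuous_const).integrable_of_hasCompactSupport (hc.fderiv_apply (𝕜 := ℝ) u))
  set c : (ℝ ∙ e)ᗮ → ℝ := fun y => inner ℝ e v - fderiv ℝ g y w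
  have hcm : Measurable c := measurable_const.sub (measurable_fderiv_apply_const ℝ g w)
  have hcb : ∀ y, ‖c y‖ ≤ ‖inner ℝ e v‖ + K * ‖w‖ := fun y =>
    (norm_sub_le _ _).trans (add_le_add le_rfl (((fderiv ℝ g y).le_opNorm w).trans
      (mul_le_mul_of_nonneg_right (norm_fderiv_le_of_lipschitz ℝ hg) (norm_nonneg _))))
  -- split `v` into a component tangential to the graph and a multiple of `e`
  have hsplit : ∀ p, fderiv ℝ φ (Ψ p) v
      = fderiv ℝ φ (Ψ p) ((w : V) + fderiv ℝ g p.1 w • e) + c p.1 * fderiv ℝ φ (Ψ p) e := by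
    intro p
    conv_lhs => rw [← hyperplaneProj_add_smul he v]
    simp only [map_add, map_smul, smul_eq_mul, c]
    ring
  have hb : Integrable (fun p : (ℝ ∙ e)ᗮ × ℝ => c p.1 * fderiv ℝ φ (Ψ p) e)
      (volume.prod volume) :=
    (hint e).bdd_mul (hcm.comp measurable_fst).aestronglyMeasurable (ae_of_all _ fun p => hcb p.1)
  have ha : Integrable (fun p : (ℝ ∙ e)ᗮ × ℝ =>
      fderiv ℝ φ (Ψ p) ((w : V) + fderiv ℝ g p.1 w • e)) (volume.prod volume) := by
    refine ((hint v).sub hb).congr (ae_of_all _ fun p => ?_)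
    simp only [Pi.sub_apply, hsplit p, add_sub_cancel_right]
  have hrestr : (volume.prod volume).restrict ((univ : Set (ℝ ∙ e)ᗮ) ×ˢ Ioi (0 : ℝ))
      = volume.prod (volume.restrict (Ioi 0)) := by
    rw [← Measure.prod_restrict, Measure.restrict_univ]
  have hle : (volume.prod (volume.restrict (Ioi (0 : ℝ))) : Measure ((ℝ ∙ e)ᗮ × ℝ))
      ≤ volume.prod volume := by
    rw [← hrestr]; exact Measure.restrict_le_self
  rw [← hmp.setIntegral_preimage_emb hemb, hpre, hrestr]
  simp only [hsplit]
  rw [integral_add (ha.mono_measure hle) (hb.mono_measure hle),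
    integral_prod_symm _ (ha.mono_measure hle), integral_prod _ (hb.mono_measure hle)]
  have h0 : ∀ t : ℝ, ∫ y, fderiv ℝ φ (Ψ (y, t)) ((w : V) + fderiv ℝ g y w • e) = 0 := fun t =>
    integral_tangential_derivative_eq_zero he hg hφ hc w t
  simp only [h0, integral_zero, zero_add]
  refine integral_congr_ae (ae_of_all _ fun y => ?_)
  simp only
  rw [integral_const_mul]
  have hline : ∀ t : ℝ, HasFDerivAt φ (fderiv ℝ φ (graphMap e g y + t • e)) (graphMap e g y + t • e) :=
    fun t => (hφ.differentiable one_ne_zero _).hasFDerivAt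
  have hder : ∀ t, deriv (fun t : ℝ => φ (graphMap e g y + t • e)) t
      = fderiv ℝ φ (graphMap e g y + t • e) e := fun t => by
    have h1 : HasDerivAt (fun t : ℝ => graphMap e g y + t • e) e t := by
      simpa using ((hasDerivAt_id t).smul_const e).const_add (graphMap e g y)
    exact ((hline t).comp_hasDerivAt t h1).deriv
  have hcs : HasCompactSupport fun t : ℝ => φ (graphMap e g y + t • e) := by
    have hcont : Continuous fun x : V => (inner ℝ e x : ℝ) - g y := by fun_prop
    refine HasCompactSupport.intro ((show IsCompact (tsupport φ) from hc).image hcont)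
      fun t ht => ?_
    by_contra hne
    exact ht ⟨_, subset_tsupport _ hne, by simp [inner_graphMap_add_smul he]⟩
  have h2 := HasCompactSupport.integral_Ioi_deriv_eq
    (f := fun t : ℝ => φ (graphMap e g y + t • e)) (by fun_prop) hcs 0
  simp only [hder, zero_smul, add_zero] at h2
  rw [h2]
  simp only [c]
  ring

end Epigraph

/-! ### Boundary charts, surface measure and outward normal -/

section Charts

open Measure Set
open scoped NNReal ENNReal

variable {d : ℕ}

/-- The outward unit normal of the epigraph of `g` in direction `e` over a point `y` at which `g`
is differentiable. -/
def graphNormal (e : EuclideanSpace ℝ (Fin d)) (g : (ℝ ∙ e)ᗮ → ℝ) (y : (ℝ ∙ e)ᗮ) :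
    EuclideanSpace ℝ (Fin d) :=
  (areaFactor (fderiv ℝ g y))⁻¹ •
    (((InnerProductSpace.toDual ℝ (ℝ ∙ e)ᗮ).symm (fderiv ℝ g y) : EuclideanSpace ℝ (Fin d)) - e)

lemma inner_graphNormal {e : EuclideanSpace ℝ (Fin d)} (he : ‖e‖ = 1) (g : (ℝ ∙ e)ᗮ → ℝ)
    (y : (ℝ ∙ e)ᗮ) (v : EuclideanSpace ℝ (Fin d)) :
    inner ℝ v (graphNormal e g y) = (areaFactor (fderiv ℝ g y))⁻¹ *
      (fderiv ℝ g y (hyperplaneProj e v) - inner ℝ e v) := by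
  set a := (InnerProductSpace.toDual ℝ (ℝ ∙ e)ᗮ).symm (fderiv ℝ g y)
  have h1 : inner ℝ v (a : EuclideanSpace ℝ (Fin d)) = fderiv ℝ g y (hyperplaneProj e v) := by
    conv_lhs => rw [← hyperplaneProj_add_smul he v]
    rw [inner_add_left, inner_smul_left, inner_hyperplane, mul_zero, add_zero,
      real_inner_comm, ← Submodule.coe_inner]
    exact InnerProductSpace.toDual_symm_apply
  rw [graphNormal, inner_smul_right, inner_sub_right, h1, real_inner_comm v e]

lemma norm_graphNormal {e : EuclideanSpace ℝ (Fin d)} (he : ‖e‖ = 1) (g : (ℝ ∙ e)ᗮ → ℝ)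
    (y : (ℝ ∙ e)ᗮ) : ‖graphNormal e g y‖ = 1 := by
  have hpos := areaFactor_pos (fderiv ℝ g y)
  have h := norm_sq_add_smul he
    ((InnerProductSpace.toDual ℝ (ℝ ∙ e)ᗮ).symm (fderiv ℝ g y)) (-1)
  rw [LinearIsometryEquiv.norm_map, neg_smul, one_smul, ← sub_eq_add_neg, neg_one_sq,
    add_comm, ← sq_areaFactor] at h
  have h' := (sq_eq_sq₀ (norm_nonneg _) hpos.le).1 h
  rw [graphNormal, norm_smul, h', norm_inv, Real.norm_of_nonneg hpos.le, inv_mul_cancel₀ hpos.ne']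

lemma measurable_graphNormal (e : EuclideanSpace ℝ (Fin d)) (g : (ℝ ∙ e)ᗮ → ℝ) :
    Measurable (graphNormal e g) := by
  unfold graphNormal
  exact (measurable_areaFactor_fderiv g).inv.smul
    ((((ℝ ∙ e)ᗮ.subtypeL.continuous.comp
      (InnerProductSpace.toDual ℝ (ℝ ∙ e)ᗮ).symm.continuous).measurable.comp
        (measurable_fderiv ℝ g)).sub_const e)

lemma IsOutwardNormal.unique {Ω : Set (EuclideanSpace ℝ (Fin d))} {x n n' : EuclideanSpace ℝ (Fin d)}
    (h : IsOutwardNormal Ω x n) (h' : IsOutwardNormal Ω x n') : n = n' := by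
  by_contra hne
  set w := n' - n with hw
  have hw0 : 0 < ‖w‖ := norm_pos_iff.2 (sub_ne_zero.2 (Ne.symm hne))
  -- `w` points strictly into `Ω` according to `n`, and strictly out of `Ω` according to `n'`
  have hsq : ‖w‖ ^ 2 = 2 - 2 * inner ℝ n' n := by
    rw [hw, norm_sub_sq_real, h.1, h'.1]; ring
  have h1 : inner ℝ w n = -(‖w‖ ^ 2 / 2) := by
    rw [hw, inner_sub_left, real_inner_self_eq_norm_sq, h.1, ← hw, hsq]; ring
  have h2 : inner ℝ w n' = ‖w‖ ^ 2 / 2 := by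
    rw [hw, inner_sub_left, real_inner_self_eq_norm_sq, h'.1, ← hw, hsq, real_inner_comm n' n]; ring
  obtain ⟨r, hr, H⟩ := h.2 (‖w‖ / 4) (by positivity)
  obtain ⟨r', hr', H'⟩ := h'.2 (‖w‖ / 4) (by positivity)
  obtain ⟨s, hs0, hs⟩ : ∃ s > 0, s * ‖w‖ < min r r' :=
    ⟨min r r' / (2 * ‖w‖), by positivity, by
      have := lt_min hr hr'
      field_simp; linarith⟩
  have hb : ‖(x + s • w) - x‖ = s * ‖w‖ := by
    rw [add_sub_cancel_left, norm_smul, Real.norm_of_nonneg hs0.le]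
  have hin : ∀ v, inner ℝ ((x + s • w) - x) v = s * inner ℝ w v := fun v => by
    rw [add_sub_cancel_left, inner_smul_left]; rfl
  have hpos : 0 < s * ‖w‖ ^ 2 := by positivity
  have k1 := (H (x + s • w) (by
    rw [Metric.mem_ball, dist_eq_norm, hb]; exact hs.trans_le (min_le_left _ _))).1 (by
      rw [hb, hin, h1]; nlinarith)
  exact (H' (x + s • w) (by
    rw [Metric.mem_ball, dist_eq_norm, hb]; exact hs.trans_le (min_le_right _ _))).2 (by
      rw [hb, hin, h2]; nlinarith) k1

lemma IsOutwardNormal.outwardNormal_eq {Ω : Set (EuclideanSpace ℝ (Fin d))}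
    {x n : EuclideanSpace ℝ (Fin d)} (h : IsOutwardNormal Ω x n) : outwardNormal Ω x = n := by
  have hex : ∃ n, IsOutwardNormal Ω x n := ⟨n, h⟩
  rw [outwardNormal, dif_pos hex]
  exact hex.choose_spec.unique h

lemma norm_outwardNormal_le (Ω : Set (EuclideanSpace ℝ (Fin d))) (x : EuclideanSpace ℝ (Fin d)) :
    ‖outwardNormal Ω x‖ ≤ 1 := by
  unfold outwardNormal
  split_ifs with h
  · exact h.choose_spec.1.le
  · simp

/-- In the ball of radius `r` around `x`, the set `Ω` is the strict epigraph, in the unit direction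
`e`, of the `K`-Lipschitz function `g` on the hyperplane orthogonal to `e`. -/
structure IsEpigraphChart (Ω : Set (EuclideanSpace ℝ (Fin d))) (x e : EuclideanSpace ℝ (Fin d))
    (g : (ℝ ∙ e)ᗮ → ℝ) (K : ℝ≥0) (r : ℝ) : Prop where
  norm_eq : ‖e‖ = 1
  lipschitz : LipschitzWith K g
  pos : 0 < r
  mem_iff : ∀ y ∈ Metric.ball x r, y ∈ Ω ↔ y ∈ epigraph e g

lemma HasLipschitzBoundary.exists_chart {Ω : Set (EuclideanSpace ℝ (Fin d))}
    (h : HasLipschitzBoundary Ω) {x : EuclideanSpace ℝ (Fin d)} (hx : x ∈ frontier Ω) :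
    ∃ (e : EuclideanSpace ℝ (Fin d)) (g : (ℝ ∙ e)ᗮ → ℝ) (K : ℝ≥0) (r : ℝ),
      IsEpigraphChart Ω x e g K r := by
  obtain ⟨e, g, K, r, he, hg, hr, hm⟩ := h x hx
  refine ⟨e, fun y => g y, K, r, he, LipschitzWith.of_dist_le_mul fun y z => hg.dist_le_mul y z, hr,
    fun y hy => ?_⟩
  rw [hm y hy, epigraph, mem_ofPred_eq, coe_hyperplaneProj he]

lemma mem_frontier_epigraph_iff {e : EuclideanSpace ℝ (Fin d)} (he : ‖e‖ = 1)
    {g : (ℝ ∙ e)ᗮ → ℝ} (hg : Continuous g) (y : EuclideanSpace ℝ (Fin d)) :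
    y ∈ frontier (epigraph e g) ↔ y ∈ range (graphMap e g) := by
  have hc1 : Continuous fun y => g (hyperplaneProj e y) := hg.comp (hyperplaneProj e).continuous
  have hc2 : Continuous fun y : EuclideanSpace ℝ (Fin d) => (inner ℝ e y : ℝ) := by fun_prop
  have hopen : IsOpen (epigraph e g) := isOpen_lt hc1 hc2
  constructor
  · intro hy
    refine ⟨hyperplaneProj e y, ?_⟩
    have h : g (hyperplaneProj e y) = inner ℝ e y := frontier_lt_subset_eq hc1 hc2 hy
    rw [graphMap, h, hyperplaneProj_add_smul he]
  · rintro ⟨z, rfl⟩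
    rw [hopen.frontier_eq]
    refine ⟨?_, ?_⟩
    · have ht : Tendsto (fun t : ℝ => graphMap e g z + t • e) (𝓝[>] 0) (𝓝 (graphMap e g z)) := by
        have : Continuous fun t : ℝ => graphMap e g z + t • e := by fun_prop
        have := (this.tendsto 0).mono_left (nhdsWithin_le_nhds (s := Ioi 0))
        simpa using this
      refine mem_closure_of_tendsto ht ?_
      filter_upwards [self_mem_nhdsWithin] with t ht
      simpa [epigraph, hyperplaneProj_graphMap_add_smul he, inner_graphMap_add_smul he] using ht
    · have h1 := inner_graphMap_add_smul he g z 0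
      rw [zero_smul, add_zero, add_zero] at h1
      simp [epigraph, hyperplaneProj_graphMap he, h1]

lemma finrank_hyperplane {e : EuclideanSpace ℝ (Fin d)} (he : ‖e‖ = 1) :
    Module.finrank ℝ (ℝ ∙ e)ᗮ = d - 1 := by
  have h := (ℝ ∙ e).finrank_add_finrank_orthogonal
  rw [finrank_span_singleton (norm_pos_iff.1 (he ▸ one_pos)), finrank_euclideanSpace_fin] at h
  omega

namespace IsEpigraphChart

variable {Ω : Set (EuclideanSpace ℝ (Fin d))} {x e : EuclideanSpace ℝ (Fin d)}
  {g : (ℝ ∙ e)ᗮ → ℝ} {K : ℝ≥0} {r : ℝ}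

lemma mem_frontier_iff (h : IsEpigraphChart Ω x e g K r) {y : EuclideanSpace ℝ (Fin d)}
    (hy : y ∈ Metric.ball x r) : y ∈ frontier Ω ↔ y ∈ range (graphMap e g) := by
  rw [← mem_frontier_epigraph_iff h.norm_eq h.lipschitz.continuous]
  have hev : ∀ᶠ z in 𝓝 y, z ∈ Ω ↔ z ∈ epigraph e g := by
    filter_upwards [Metric.isOpen_ball.mem_nhds hy] with z hz using h.mem_iff z hz
  rw [frontier, frontier, Set.mem_sdiff, Set.mem_sdiff, mem_closure_iff_frequently,
    mem_closure_iff_frequently, mem_interior_iff_mem_nhds, mem_interior_iff_mem_nhds]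
  exact and_congr (frequently_congr hev) (not_congr (eventually_congr hev))

lemma isOutwardNormal_graphNormal (h : IsEpigraphChart Ω x e g K r) {y : (ℝ ∙ e)ᗮ}
    (hy : graphMap e g y ∈ Metric.ball x r) (hd : DifferentiableAt ℝ g y) :
    IsOutwardNormal Ω (graphMap e g y) (graphNormal e g y) := by
  have he := h.norm_eq
  refine ⟨norm_graphNormal he g y, fun ε hε => ?_⟩
  have hJ := areaFactor_pos (fderiv ℝ g y)
  have hJ1 := one_le_areaFactor (fderiv ℝ g y)
  have hlo := hd.hasFDerivAt.isLittleO.def hε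
  obtain ⟨ρ, hρ, hball⟩ := Metric.eventually_nhds_iff.1 hlo
  obtain ⟨ρ', hρ', hball'⟩ := Metric.isOpen_iff.1 Metric.isOpen_ball _ hy
  refine ⟨min ρ ρ', lt_min hρ hρ', fun z hz => ?_⟩
  rw [Metric.mem_ball] at hz
  have hzΩ := h.mem_iff z (hball' (hz.trans_le (min_le_right _ _)))
  have hp : hyperplaneProj e (z - graphMap e g y) = hyperplaneProj e z - y := by
    rw [map_sub, hyperplaneProj_graphMap he]
  have hnp : ‖hyperplaneProj e z - y‖ ≤ ‖z - graphMap e g y‖ := by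
    rw [← hp]; exact norm_hyperplaneProj_le e _
  have h1 := hball (y := hyperplaneProj e z) (by
    rw [dist_eq_norm]
    rw [dist_eq_norm] at hz
    exact hnp.trans_lt (hz.trans_le (min_le_left _ _)))
  have hie : inner ℝ e (graphMap e g y) = g y := by
    simpa using inner_graphMap_add_smul he g y 0
  have h2 := inner_graphNormal he g y (z - graphMap e g y)
  rw [hp, inner_sub_right, hie] at h2
  have h3 : areaFactor (fderiv ℝ g y) * inner ℝ (z - graphMap e g y) (graphNormal e g y)
      = fderiv ℝ g y (hyperplaneProj e z - y) - (inner ℝ e z - g y) := by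
    rw [h2, mul_inv_cancel_left₀ hJ.ne']
  rw [Real.norm_eq_abs, abs_le] at h1
  have h4 : ε * ‖hyperplaneProj e z - y‖ ≤ ε * ‖z - graphMap e g y‖ :=
    mul_le_mul_of_nonneg_left hnp hε.le
  have h5 : 0 ≤ ε * ‖z - graphMap e g y‖ := by positivity
  constructor
  · intro hlt
    rw [hzΩ, epigraph, mem_ofPred_eq]
    nlinarith [h1.2]
  · intro hlt hmem
    rw [hzΩ, epigraph, mem_ofPred_eq] at hmem
    nlinarith [h1.1]

lemma surfaceMeasure_restrict_ball_le (h : IsEpigraphChart Ω x e g K r) :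
    (surfaceMeasure Ω).restrict (Metric.ball x r)
      ≤ (euclideanHausdorffMeasure (d - 1)).restrict (range (graphMap e g)) := by
  rw [surfaceMeasure, restrict_restrict Metric.isOpen_ball.measurableSet]
  exact restrict_mono_set _ fun y hy => (h.mem_frontier_iff hy.1).1 hy.2

/-- Almost-everywhere statements on the boundary can be checked in the graph parametrization. -/
lemma ae_surfaceMeasure (h : IsEpigraphChart Ω x e g K r) {P : EuclideanSpace ℝ (Fin d) → Prop}
    (hP : ∀ᵐ y, graphMap e g y ∈ Metric.ball x r → P (graphMap e g y)) :
    ∀ᵐ z ∂(surfaceMeasure Ω).restrict (Metric.ball x r), P z := by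
  have h1 : ∀ᵐ z ∂(surfaceMeasure Ω).restrict (Metric.ball x r), z ∈ Metric.ball x r → P z := by
    have h2 : ∀ᵐ z ∂(euclideanHausdorffMeasure (d - 1)).restrict (range (graphMap e g)),
        z ∈ Metric.ball x r → P z := by
      rw [← map_graphMeasure h.norm_eq h.lipschitz (finrank_hyperplane h.norm_eq),
        (measurableEmbedding_graphMap h.norm_eq h.lipschitz.continuous).ae_map_iff]
      exact (withDensity_absolutelyContinuous _ _).ae_le hP
    exact ae_mono h.surfaceMeasure_restrict_ball_le h2
  filter_upwards [h1, ae_restrict_mem Metric.isOpen_ball.measurableSet] with z h2 h3 using h2 h3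

lemma ae_outwardNormal_eq (h : IsEpigraphChart Ω x e g K r) :
    ∀ᵐ z ∂(surfaceMeasure Ω).restrict (Metric.ball x r),
      outwardNormal Ω z = graphNormal e g (hyperplaneProj e z) := by
  refine h.ae_surfaceMeasure ?_
  filter_upwards [h.lipschitz.ae_differentiableAt (μ := volume)] with y hd hy
  rw [hyperplaneProj_graphMap h.norm_eq]
  exact (h.isOutwardNormal_graphNormal hy hd).outwardNormal_eq

lemma aestronglyMeasurable_outwardNormal (h : IsEpigraphChart Ω x e g K r) :
    AEStronglyMeasurable (outwardNormal Ω) ((surfaceMeasure Ω).restrict (Metric.ball x r)) :=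
  ⟨_, ((measurable_graphNormal e g).comp (hyperplaneProj e).measurable).stronglyMeasurable,
    h.ae_outwardNormal_eq⟩

/-- The chart direction is uniformly transversal to the boundary. -/
lemma ae_inner_outwardNormal_le (h : IsEpigraphChart Ω x e g K r) :
    ∀ᵐ z ∂(surfaceMeasure Ω).restrict (Metric.ball x r),
      inner ℝ e (outwardNormal Ω z) ≤ -(Real.sqrt (1 + K ^ 2))⁻¹ := by
  filter_upwards [h.ae_outwardNormal_eq] with z hz
  have h0 : hyperplaneProj e e = 0 := Subtype.ext (by
    rw [coe_hyperplaneProj h.norm_eq, real_inner_self_eq_norm_sq, h.norm_eq]; simp)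
  rw [hz, inner_graphNormal h.norm_eq, h0, map_zero, real_inner_self_eq_norm_sq, h.norm_eq]
  have h1 : areaFactor (fderiv ℝ g (hyperplaneProj e z)) ≤ Real.sqrt (1 + K ^ 2) := by
    refine Real.sqrt_le_sqrt ?_
    have := norm_fderiv_le_of_lipschitz ℝ h.lipschitz (x₀ := hyperplaneProj e z)
    gcongr
  have := inv_anti₀ (areaFactor_pos _) h1
  linarith

lemma surfaceMeasure_ball_lt_top (h : IsEpigraphChart Ω x e g K r) :
    surfaceMeasure Ω (Metric.ball x r) < ⊤ := by
  have h1 := h.surfaceMeasure_restrict_ball_le (Metric.ball x r)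
  rw [restrict_apply_self, Measure.restrict_apply Metric.isOpen_ball.measurableSet] at h1
  refine h1.trans_lt ?_
  have hsub : Metric.ball x r ∩ range (graphMap e g)
      ⊆ graphMap e g '' Metric.ball (hyperplaneProj e x) r := by
    rintro _ ⟨hz, y, rfl⟩
    refine ⟨y, ?_, rfl⟩
    rw [Metric.mem_ball, dist_eq_norm] at hz ⊢
    refine lt_of_le_of_lt ?_ hz
    conv_lhs => rw [← hyperplaneProj_graphMap h.norm_eq g y]
    rw [← map_sub]
    exact norm_hyperplaneProj_le e _
  refine (measure_mono hsub).trans_lt ?_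
  have h2 := euclideanHausdorffMeasure_image_le_image (P := graphMap e g)
    (Q := (id : (ℝ ∙ e)ᗮ → (ℝ ∙ e)ᗮ)) (s := Metric.ball (hyperplaneProj e x) r) (K := 1 + K)
    (Module.finrank ℝ (ℝ ∙ e)ᗮ) (fun y _ z _ => dist_graphMap_le h.norm_eq h.lipschitz y z)
  rw [image_id, InnerProductSpace.euclideanHausdorffMeasure_eq_volume,
    finrank_hyperplane h.norm_eq] at h2
  exact h2.trans_lt (ENNReal.mul_lt_top (ENNReal.pow_lt_top ENNReal.coe_lt_top)
    Metric.isBounded_ball.measure_lt_top)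

/-- Integration by parts for functions supported in the domain of a boundary chart. -/
lemma setIntegral_fderiv_eq (h : IsEpigraphChart Ω x e g K r)
    {φ : EuclideanSpace ℝ (Fin d) → ℝ} (hΩ : IsOpen Ω) (hφ : ContDiff ℝ 1 φ)
    (hc : HasCompactSupport φ) (hsupp : tsupport φ ⊆ Metric.ball x r)
    (v : EuclideanSpace ℝ (Fin d)) :
    ∫ z in Ω, fderiv ℝ φ z v = ∫ z, φ z * inner ℝ v (outwardNormal Ω z) ∂surfaceMeasure Ω := by
  have he := h.norm_eq
  have hgc := h.lipschitz.continuous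
  have hemb := measurableEmbedding_graphMap he hgc
  have hepi : IsOpen (epigraph e g) :=
    isOpen_lt (hgc.comp (hyperplaneProj e).continuous) (by fun_prop)
  have hφ0 : ∀ z ∉ Metric.ball x r, φ z = 0 := fun z hz =>
    image_eq_zero_of_notMem_tsupport fun hz' => hz (hsupp hz')
  have hφ0' : ∀ z ∉ Metric.ball x r, fderiv ℝ φ z = 0 := fun z hz =>
    image_eq_zero_of_notMem_tsupport fun hz' => hz (hsupp (tsupport_fderiv_subset ℝ hz'))
  have hL : ∫ z in Ω, fderiv ℝ φ z v = ∫ z in epigraph e g, fderiv ℝ φ z v := by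
    rw [← integral_indicator hΩ.measurableSet, ← integral_indicator hepi.measurableSet]
    congr 1
    ext z
    by_cases hz : z ∈ Metric.ball x r
    · classical
      simp only [indicator_apply, h.mem_iff z hz]
    · simp [indicator, hφ0' z hz]
  have hR : ∫ z, φ z * inner ℝ v (outwardNormal Ω z) ∂surfaceMeasure Ω
      = ∫ z in range (graphMap e g), φ z * inner ℝ v (outwardNormal Ω z)
          ∂euclideanHausdorffMeasure (d - 1) := by
    rw [surfaceMeasure, ← integral_indicator isClosed_frontier.measurableSet,
      ← integral_indicator hemb.measurableSet_range]
    congr 1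
    ext z
    by_cases hz : z ∈ Metric.ball x r
    · classical
      simp only [indicator_apply, h.mem_frontier_iff hz]
    · simp [indicator, hφ0 z hz]
  rw [hL, hR, setIntegral_epigraph_fderiv he h.lipschitz hφ hc,
    ← map_graphMeasure he h.lipschitz (finrank_hyperplane he), hemb.integral_map, graphMeasure,
    integral_withDensity_eq_integral_toReal_smul
      (measurable_areaFactor_fderiv g).ennreal_ofReal (ae_of_all _ fun _ => ENNReal.ofReal_lt_top)]
  refine integral_congr_ae ?_
  filter_upwards [h.lipschitz.ae_differentiableAt (μ := volume)] with y hd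
  by_cases hy : graphMap e g y ∈ Metric.ball x r
  · have hJ := areaFactor_pos (fderiv ℝ g y)
    rw [(h.isOutwardNormal_graphNormal hy hd).outwardNormal_eq, inner_graphNormal he,
      ENNReal.toReal_ofReal hJ.le, smul_eq_mul, mul_left_comm, mul_inv_cancel_left₀ hJ.ne']
  · simp [hφ0 _ hy]

end IsEpigraphChart

end Charts

/-! ### Localization, the divergence theorem and the trace inequality -/

section Global

open Set
open scoped NNReal ENNReal

variable {d : ℕ}

section IsTest

variable {F : Type*} [NormedAddCommGroup F] [NormedSpace ℝ F]

lemma IsTest.continuous {φ : EuclideanSpace ℝ (Fin d) → F} (h : IsTest φ) : Continuous φ :=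
  h.1.continuous

lemma IsTest.differentiable {φ : EuclideanSpace ℝ (Fin d) → F} (h : IsTest φ) :
    Differentiable ℝ φ := h.1.differentiable (by simp)

lemma isTest_zero : IsTest (0 : EuclideanSpace ℝ (Fin d) → F) :=
  ⟨contDiff_const, HasCompactSupport.zero⟩

lemma IsTest.add {φ ψ : EuclideanSpace ℝ (Fin d) → F} (h : IsTest φ) (h' : IsTest ψ) :
    IsTest (φ + ψ) := ⟨h.1.add h'.1, h.2.add h'.2⟩

lemma IsTest.sub {φ ψ : EuclideanSpace ℝ (Fin d) → F} (h : IsTest φ) (h' : IsTest ψ) :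
    IsTest (φ - ψ) := ⟨h.1.sub h'.1, h.2.sub h'.2⟩

lemma IsTest.fderiv_apply {φ : EuclideanSpace ℝ (Fin d) → F} (h : IsTest φ)
    (v : EuclideanSpace ℝ (Fin d)) : IsTest fun x => fderiv ℝ φ x v :=
  ⟨(h.1.fderiv_right (m := ∞) (by simp)).clm_apply contDiff_const, h.2.fderiv_apply (𝕜 := ℝ) v⟩

lemma IsTest.mul {φ ψ : EuclideanSpace ℝ (Fin d) → ℝ} (h : ContDiff ℝ ∞ φ) (h' : IsTest ψ) :
    IsTest fun x => φ x * ψ x := ⟨h.mul h'.1, h'.2.mul_left⟩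

lemma IsTest.comp_apply {φ : EuclideanSpace ℝ (Fin d) → EuclideanSpace ℝ (Fin d)} (h : IsTest φ)
    (i : Fin d) : IsTest fun x => φ x i :=
  ⟨by have := h.1; fun_prop, h.2.comp_left (g := fun y : EuclideanSpace ℝ (Fin d) => y i) rfl⟩

lemma IsTest.smul_const {φ : EuclideanSpace ℝ (Fin d) → ℝ} (h : IsTest φ) (c : F) :
    IsTest fun x => φ x • c :=
  ⟨h.1.smul contDiff_const, h.2.smul_right⟩

lemma IsTest.continuous_gradient {φ : EuclideanSpace ℝ (Fin d) → ℝ} (h : IsTest φ) :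
    Continuous (gradient φ) :=
  (InnerProductSpace.toDual ℝ _).symm.continuous.comp (h.1.continuous_fderiv (by simp))

lemma inner_gradient {φ : EuclideanSpace ℝ (Fin d) → ℝ} (x v : EuclideanSpace ℝ (Fin d)) :
    inner ℝ (gradient φ x) v = fderiv ℝ φ x v := by
  simp [gradient]

lemma gradient_apply {φ : EuclideanSpace ℝ (Fin d) → ℝ} (x : EuclideanSpace ℝ (Fin d))
    (i : Fin d) : gradient φ x i = fderiv ℝ φ x (EuclideanSpace.single i 1) := by
  rw [← inner_gradient, EuclideanSpace.inner_single_right]; simp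

lemma norm_gradient {φ : EuclideanSpace ℝ (Fin d) → ℝ} (x : EuclideanSpace ℝ (Fin d)) :
    ‖gradient φ x‖ = ‖fderiv ℝ φ x‖ := by simp [gradient]

lemma IsTest.hasCompactSupport_gradient {φ : EuclideanSpace ℝ (Fin d) → ℝ} (h : IsTest φ) :
    HasCompactSupport (gradient φ) :=
  (h.2.fderiv ℝ).comp_left (g := (InnerProductSpace.toDual ℝ _).symm) (map_zero _)

end IsTest

lemma eLpNorm_two_sq {A F : Type*} [MeasurableSpace A] [NormedAddCommGroup F] (f : A → F)
    (μ : Measure A) : eLpNorm f 2 μ ^ 2 = ∫⁻ z, ‖f z‖ₑ ^ 2 ∂μ := by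
  have := eLpNorm_nnreal_pow_eq_lintegral (f := f) (μ := μ) (p := 2) two_ne_zero
  simpa only [NNReal.coe_ofNat, ENNReal.rpow_ofNat, ENNReal.coe_ofNat] using this

/-- A property of test functions that is stable under sums holds for all test functions if it holds
for those supported near an arbitrary point. -/
lemma IsTest.induction_of_local {Q : (EuclideanSpace ℝ (Fin d) → ℝ) → Prop} (h0 : Q 0)
    (hadd : ∀ φ ψ, IsTest φ → IsTest ψ → Q φ → Q ψ → Q (φ + ψ))
    (hloc : ∀ x, ∃ U ∈ 𝓝 x, ∀ φ, IsTest φ → tsupport φ ⊆ U → Q φ)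
    {φ : EuclideanSpace ℝ (Fin d) → ℝ} (hφ : IsTest φ) : Q φ := by
  choose U hU hQ using hloc
  obtain ⟨t, -, ht⟩ := (show IsCompact (tsupport φ) from hφ.2).elim_nhds_subcover
    (fun x => interior (U x)) (fun x _ => interior_mem_nhds.2 (hU x))
  obtain ⟨ρ, hρ⟩ := SmoothPartitionOfUnity.exists_isSubordinate
    (modelWithCornersSelf ℝ (EuclideanSpace ℝ (Fin d))) (isClosed_tsupport φ)
    (fun x : t => interior (U x)) (fun _ => isOpen_interior) (by simpa [iUnion_subtype] using ht)
  have htest : ∀ i, IsTest fun x => ρ i x * φ x := fun i =>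
    IsTest.mul (ρ i).contMDiff.contDiff hφ
  have hsum : φ = ∑ i, fun x => ρ i x * φ x := by
    ext x
    rw [Finset.sum_apply, ← Finset.sum_mul, ← finsum_eq_sum_of_fintype]
    by_cases hx : x ∈ tsupport φ
    · rw [ρ.sum_eq_one hx, one_mul]
    · rw [image_eq_zero_of_notMem_tsupport hx, mul_zero]
  have hmain : ∀ s : Finset t, IsTest (∑ i ∈ s, fun x => ρ i x * φ x) ∧
      Q (∑ i ∈ s, fun x => ρ i x * φ x) := by
    classical
    intro s
    induction s using Finset.induction_on with
    | empty => exact ⟨isTest_zero, h0⟩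
    | insert i s hi ih =>
      rw [Finset.sum_insert hi]
      refine ⟨(htest i).add ih.1, hadd _ _ (htest i) ih.1 (hQ i _ (htest i) ?_) ih.2⟩
      exact (closure_mono (Function.support_mul_subset_left _ _)).trans
        ((hρ i).trans interior_subset)
  rw [hsum]
  exact (hmain Finset.univ).2

variable {Ω : Set (EuclideanSpace ℝ (Fin d))}

lemma isFiniteMeasure_surfaceMeasure (hΓ : IsCompact (frontier Ω)) (hLip : HasLipschitzBoundary Ω) :
    IsFiniteMeasure (surfaceMeasure Ω) := by
  refine ⟨?_⟩
  have h : surfaceMeasure Ω (frontier Ω) < ⊤ := by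
    refine hΓ.induction_on (p := fun s => surfaceMeasure Ω s < ⊤) (by simp)
      (fun s t hst ht => (measure_mono hst).trans_lt ht)
      (fun s t hs ht => measure_union_lt_top hs ht) fun x hx => ?_
    obtain ⟨e, g, K, r, hch⟩ := hLip.exists_chart hx
    exact ⟨_, mem_nhdsWithin_of_mem_nhds (Metric.ball_mem_nhds x hch.pos),
      hch.surfaceMeasure_ball_lt_top⟩
  have h2 : surfaceMeasure Ω univ = surfaceMeasure Ω (frontier Ω) := by
    rw [surfaceMeasure, Measure.restrict_apply_univ, Measure.restrict_apply_self]
  rwa [h2]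

lemma surfaceMeasure_restrict_frontier (Ω : Set (EuclideanSpace ℝ (Fin d))) :
    (surfaceMeasure Ω).restrict (frontier Ω) = surfaceMeasure Ω := by
  rw [surfaceMeasure, Measure.restrict_restrict isClosed_frontier.measurableSet, inter_self]

lemma aestronglyMeasurable_outwardNormal (hΓ : IsCompact (frontier Ω))
    (hLip : HasLipschitzBoundary Ω) :
    AEStronglyMeasurable (outwardNormal Ω) (surfaceMeasure Ω) := by
  rw [← surfaceMeasure_restrict_frontier]
  refine hΓ.induction_on
    (p := fun s => AEStronglyMeasurable (outwardNormal Ω) ((surfaceMeasure Ω).restrict s))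
    (by simp) (fun s t hst ht => ht.mono_set hst)
    (fun s t hs ht => aestronglyMeasurable_union_iff.2 ⟨hs, ht⟩) fun x hx => ?_
  obtain ⟨e, g, K, r, hch⟩ := hLip.exists_chart hx
  exact ⟨_, mem_nhdsWithin_of_mem_nhds (Metric.ball_mem_nhds x hch.pos),
    hch.aestronglyMeasurable_outwardNormal⟩

lemma norm_inner_outwardNormal_le (Ω : Set (EuclideanSpace ℝ (Fin d)))
    (v x : EuclideanSpace ℝ (Fin d)) : ‖inner ℝ v (outwardNormal Ω x)‖ ≤ ‖v‖ :=
  (norm_inner_le_norm _ _).trans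
    (mul_le_of_le_one_right (norm_nonneg _) (norm_outwardNormal_le Ω x))

lemma integrable_mul_inner_outwardNormal (hΓ : IsCompact (frontier Ω))
    (hLip : HasLipschitzBoundary Ω) {f : EuclideanSpace ℝ (Fin d) → ℝ}
    (hf : Integrable f (surfaceMeasure Ω)) (v : EuclideanSpace ℝ (Fin d)) :
    Integrable (fun x => f x * inner ℝ v (outwardNormal Ω x)) (surfaceMeasure Ω) :=
  hf.mul_bdd (c := ‖v‖) (aestronglyMeasurable_const.inner
    (aestronglyMeasurable_outwardNormal hΓ hLip))
    (ae_of_all _ fun x => norm_inner_outwardNormal_le Ω v x)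

/-- Derivatives of test functions have mean zero. This is the divergence theorem on the whole
space. -/
lemma integral_fderiv_eq_zero {φ : EuclideanSpace ℝ (Fin d) → ℝ} (hφ : IsTest φ)
    (v : EuclideanSpace ℝ (Fin d)) : ∫ x, fderiv ℝ φ x v = 0 := by
  obtain ⟨C, hC⟩ := ContDiff.lipschitzWith_of_hasCompactSupport hφ.2 hφ.1 (by simp)
  have h := LipschitzWith.integral_lineDeriv_mul_eq
    (μ := (volume : Measure (EuclideanSpace ℝ (Fin d))))
    (LipschitzWith.const (1 : ℝ)) hC hφ.2 (-v)
  have h0 : ∀ x : EuclideanSpace ℝ (Fin d),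
      lineDeriv ℝ (fun _ : EuclideanSpace ℝ (Fin d) => (1 : ℝ)) x (-v) = 0 := fun x => by
    simp [lineDeriv]
  simp only [neg_neg, mul_one, h0, zero_mul, integral_zero] at h
  rw [h]
  exact integral_congr_ae (ae_of_all _ fun x =>
    ((hφ.differentiable x).lineDeriv_eq_fderiv).symm)

/-- The divergence theorem for test functions on a domain with compact Lipschitz boundary, in the
form of one directional derivative. -/
theorem setIntegral_fderiv_eq_boundary (hΩ : IsOpen Ω) (hΓ : IsCompact (frontier Ω))
    (hLip : HasLipschitzBoundary Ω) {φ : EuclideanSpace ℝ (Fin d) → ℝ} (hφ : IsTest φ)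
    (v : EuclideanSpace ℝ (Fin d)) :
    ∫ x in Ω, fderiv ℝ φ x v = ∫ x, φ x * inner ℝ v (outwardNormal Ω x) ∂surfaceMeasure Ω := by
  have := isFiniteMeasure_surfaceMeasure hΓ hLip
  refine hφ.induction_of_local (Q := fun φ => ∫ x in Ω, fderiv ℝ φ x v
    = ∫ x, φ x * inner ℝ v (outwardNormal Ω x) ∂surfaceMeasure Ω) (by simp) ?_ ?_
  · intro φ ψ hφ hψ h1 h2
    have hi : ∀ {φ : EuclideanSpace ℝ (Fin d) → ℝ}, IsTest φ →
        Integrable (fun x => fderiv ℝ φ x v) (volume.restrict Ω) := fun hφ =>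
      ((hφ.fderiv_apply v).continuous.integrable_of_hasCompactSupport
        (hφ.fderiv_apply v).2).restrict
    have hb : ∀ {φ : EuclideanSpace ℝ (Fin d) → ℝ}, IsTest φ →
        Integrable (fun x => φ x * inner ℝ v (outwardNormal Ω x)) (surfaceMeasure Ω) := fun hφ =>
      integrable_mul_inner_outwardNormal hΓ hLip
        (hφ.continuous.integrable_of_hasCompactSupport hφ.2) v
    have e1 : ∀ x, fderiv ℝ (φ + ψ) x v = fderiv ℝ φ x v + fderiv ℝ ψ x v := fun x => by
      rw [fderiv_add (hφ.differentiable x) (hψ.differentiable x)]; rfl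
    simp only [e1, Pi.add_apply, add_mul]
    rw [integral_add (hi hφ) (hi hψ), integral_add (hb hφ) (hb hψ), h1, h2]
  · intro x
    by_cases hx : x ∈ frontier Ω
    · obtain ⟨e, g, K, r, hch⟩ := hLip.exists_chart hx
      exact ⟨_, Metric.ball_mem_nhds x hch.pos, fun φ hφ hs =>
        hch.setIntegral_fderiv_eq hΩ (hφ.1.of_le (by simp)) hφ.2 hs v⟩
    -- away from the boundary the boundary term vanishes
    refine ⟨(frontier Ω)ᶜ, isClosed_frontier.isOpen_compl.mem_nhds hx, fun φ hφ hs => ?_⟩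
    have hR : ∫ x, φ x * inner ℝ v (outwardNormal Ω x) ∂surfaceMeasure Ω = 0 := by
      rw [← surfaceMeasure_restrict_frontier]
      refine (setIntegral_congr_fun isClosed_frontier.measurableSet
        (g := fun _ => (0 : ℝ)) fun z hz => ?_).trans (by simp)
      simp only
      rw [image_eq_zero_of_notMem_tsupport fun hz' => hs hz' hz, zero_mul]
    rw [hR, ← integral_indicator hΩ.measurableSet]
    -- `φ` restricted to `Ω` and extended by zero is again a test function
    have hψ : IsTest (Ω.indicator φ) := by
      refine ⟨contDiff_iff_contDiffAt.2 fun z => ?_, hφ.2.mono (by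
        rw [Set.support_indicator]; exact inter_subset_right)⟩
      by_cases hz : z ∈ tsupport φ
      · have hz' : z ∉ frontier Ω := hs hz
        rw [hΩ.frontier_eq] at hz'
        by_cases hzΩ : z ∈ Ω
        · exact hφ.1.contDiffAt.congr_of_eventuallyEq (by
            filter_upwards [hΩ.mem_nhds hzΩ] with y hy using indicator_of_mem hy φ)
        · have hzc : z ∉ closure Ω := fun h => hz' ⟨h, hzΩ⟩
          refine (contDiffAt_const (c := (0 : ℝ))).congr_of_eventuallyEq ?_
          filter_upwards [isClosed_closure.isOpen_compl.mem_nhds hzc] with y hy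
          exact indicator_of_notMem (fun h => hy (subset_closure h)) φ
      · refine (contDiffAt_const (c := (0 : ℝ))).congr_of_eventuallyEq ?_
        filter_upwards [(isClosed_tsupport φ).isOpen_compl.mem_nhds hz] with y hy
        simp [indicator, image_eq_zero_of_notMem_tsupport hy]
    rw [← integral_fderiv_eq_zero hψ v]
    refine integral_congr_ae (ae_of_all _ fun z => ?_)
    simp only
    by_cases hzΩ : z ∈ Ω
    · rw [indicator_of_mem hzΩ]
      have : Ω.indicator φ =ᶠ[𝓝 z] φ := by
        filter_upwards [hΩ.mem_nhds hzΩ] with y hy using indicator_of_mem hy φ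
      rw [this.fderiv_eq]
    · rw [indicator_of_notMem hzΩ]
      have hmin : Ω.indicator φ =ᶠ[𝓝 z] fun _ => 0 := by
        by_cases hzc : z ∈ closure Ω
        · have hzf : z ∈ frontier Ω := by rw [hΩ.frontier_eq]; exact ⟨hzc, hzΩ⟩
          have hzt : z ∉ tsupport φ := fun h => hs h hzf
          filter_upwards [(isClosed_tsupport φ).isOpen_compl.mem_nhds hzt] with y hy
          simp [indicator, image_eq_zero_of_notMem_tsupport hy]
        · filter_upwards [isClosed_closure.isOpen_compl.mem_nhds hzc] with y hy
          exact indicator_of_notMem (fun h => hy (subset_closure h)) φ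
      rw [hmin.fderiv_eq]
      simp

/-- The trace inequality near a boundary point: test the divergence theorem with a localized
constant field that is transversal to the boundary. -/
lemma exists_trace_bound_of_chart (hΩ : IsOpen Ω) (hΓ : IsCompact (frontier Ω))
    (hLip : HasLipschitzBoundary Ω) {x : EuclideanSpace ℝ (Fin d)} (hx : x ∈ frontier Ω) :
    ∃ U ∈ 𝓝 x, ∃ C : ℝ≥0, ∀ φ : EuclideanSpace ℝ (Fin d) → ℝ, IsTest φ →
      ∫⁻ z in U, ‖φ z‖ₑ ^ 2 ∂surfaceMeasure Ω
        ≤ C * ((∫⁻ z in Ω, ‖φ z‖ₑ ^ 2) + ∫⁻ z in Ω, ‖gradient φ z‖ₑ ^ 2) := by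
  have := isFiniteMeasure_surfaceMeasure hΓ hLip
  obtain ⟨e, g, K, r, hch⟩ := hLip.exists_chart hx
  have hr := hch.pos
  let b : ContDiffBump x := ⟨r / 3, r / 2, by linarith, by linarith⟩
  have hbt : IsTest (b : EuclideanSpace ℝ (Fin d) → ℝ) := ⟨b.contDiff, b.hasCompactSupport⟩
  have hbs : tsupport (b : EuclideanSpace ℝ (Fin d) → ℝ) ⊆ Metric.ball x r := by
    rw [b.tsupport_eq]; exact Metric.closedBall_subset_ball (by simp only [b]; linarith)
  obtain ⟨M, hM⟩ := (hbt.fderiv_apply e).2.exists_bound_of_continuous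
    (hbt.fderiv_apply e).continuous
  have hM0 : 0 ≤ M := (norm_nonneg _).trans (hM x)
  set c := (Real.sqrt (1 + K ^ 2))⁻¹ with hc
  have hc0 : 0 < c := by positivity
  refine ⟨Metric.ball x (r / 3), Metric.ball_mem_nhds x (by linarith),
    Real.toNNReal (c⁻¹ * (M + 1)), fun φ hφ => ?_⟩
  -- the field `b φ² e` has outward flux at most `-c b φ²`
  set ψ : EuclideanSpace ℝ (Fin d) → ℝ := fun z => b z * φ z ^ 2 with hψdef
  have hψ : IsTest ψ := by
    have : ψ = fun z => (b z * φ z) * φ z := by ext z; simp only [hψdef]; ring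
    rw [this]
    exact IsTest.mul (hbt.1.mul hφ.1) hφ
  have hgauss := setIntegral_fderiv_eq_boundary hΩ hΓ hLip hψ e
  have hder : ∀ z, fderiv ℝ ψ z e = fderiv ℝ b z e * φ z ^ 2 + 2 * b z * φ z * fderiv ℝ φ z e := by
    intro z
    rw [hψdef, fderiv_fun_mul (hbt.differentiable z) ((hφ.differentiable z).fun_pow 2),
      fderiv_fun_pow 2 (hφ.differentiable z)]
    simp only [add_apply, smul_apply, smul_eq_mul]
    ring
  have hφi : Integrable (fun z => φ z ^ 2) (volume.restrict Ω) := by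
    have : IsTest fun z => φ z ^ 2 := by
      simp only [sq]; exact IsTest.mul hφ.1 hφ
    exact (this.continuous.integrable_of_hasCompactSupport this.2).restrict
  have hgi : Integrable (fun z => ‖gradient φ z‖ ^ 2) (volume.restrict Ω) := by
    simp only [sq]
    exact (Continuous.integrable_of_hasCompactSupport
      (hφ.continuous_gradient.norm.mul hφ.continuous_gradient.norm)
      hφ.hasCompactSupport_gradient.norm.mul_left).restrict
  have hbound : -∫ z in Ω, fderiv ℝ ψ z e
      ≤ (M + 1) * ∫ z in Ω, (φ z ^ 2 + ‖gradient φ z‖ ^ 2) := by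
    rw [← integral_neg, ← integral_const_mul]
    refine integral_mono ((hψ.fderiv_apply e).continuous.integrable_of_hasCompactSupport
      (hψ.fderiv_apply e).2).restrict.neg ((hφi.add hgi).const_mul _) fun z => ?_
    simp only [hder]
    have h1 : |fderiv ℝ b z e| ≤ M := hM z
    have h2 : |fderiv ℝ φ z e| ≤ ‖gradient φ z‖ := by
      rw [norm_gradient]
      simpa [hch.norm_eq] using (fderiv ℝ φ z).le_opNorm e
    have hb0 : 0 ≤ b z := b.nonneg
    have hb1 : b z ≤ 1 := b.le_one
    have h3 : -(2 * b z * φ z * fderiv ℝ φ z e) ≤ φ z ^ 2 + ‖gradient φ z‖ ^ 2 := by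
      have h4 : fderiv ℝ φ z e ^ 2 ≤ ‖gradient φ z‖ ^ 2 := by
        rw [← sq_abs]; exact pow_le_pow_left₀ (abs_nonneg _) h2 2
      have h5 : 0 ≤ (φ z + fderiv ℝ φ z e) ^ 2 := sq_nonneg _
      nlinarith [mul_nonneg hb0 h5, mul_nonneg (sub_nonneg.2 hb1) (sq_nonneg (φ z)),
        mul_nonneg (sub_nonneg.2 hb1) (sq_nonneg (fderiv ℝ φ z e))]
    have h6 : -(fderiv ℝ b z e * φ z ^ 2) ≤ M * φ z ^ 2 := by
      nlinarith [neg_abs_le (fderiv ℝ b z e), sq_nonneg (φ z)]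
    nlinarith [mul_nonneg hM0 (sq_nonneg ‖gradient φ z‖)]
  have hψi : Integrable ψ (surfaceMeasure Ω) :=
    hψ.continuous.integrable_of_hasCompactSupport hψ.2
  have hψ0 : ∀ z, 0 ≤ ψ z := fun z => mul_nonneg b.nonneg (sq_nonneg _)
  have hlow : c * ∫ z, ψ z ∂surfaceMeasure Ω
      ≤ -∫ z, ψ z * inner ℝ e (outwardNormal Ω z) ∂surfaceMeasure Ω := by
    rw [← integral_neg, ← integral_const_mul]
    refine integral_mono_ae (hψi.const_mul _)
      (integrable_mul_inner_outwardNormal hΓ hLip hψi e).neg ?_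
    have h1 := (ae_restrict_iff' Metric.isOpen_ball.measurableSet).1 hch.ae_inner_outwardNormal_le
    filter_upwards [h1] with z hz
    by_cases hzb : z ∈ Metric.ball x r
    · have := hz hzb
      nlinarith [hψ0 z]
    · have hb0 : b z = 0 := image_eq_zero_of_notMem_tsupport fun h => hzb (hbs h)
      simp [hψdef, hb0]
  have hfinal : ∫ z, ψ z ∂surfaceMeasure Ω
      ≤ c⁻¹ * (M + 1) * ∫ z in Ω, (φ z ^ 2 + ‖gradient φ z‖ ^ 2) := by
    rw [mul_assoc, ← div_eq_inv_mul, le_div_iff₀ hc0, mul_comm]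
    rw [← hgauss] at hlow
    exact hlow.trans hbound
  have hsq : ∀ t : ℝ, ‖t‖ₑ ^ 2 = ENNReal.ofReal (t ^ 2) := fun t => by
    rw [Real.enorm_eq_ofReal_abs, ← ENNReal.ofReal_pow (abs_nonneg _), sq_abs]
  have hsq' : ∀ z, ‖gradient φ z‖ₑ ^ 2 = ENNReal.ofReal (‖gradient φ z‖ ^ 2) := fun z => by
    rw [← ofReal_norm, ← ENNReal.ofReal_pow (norm_nonneg _)]
  calc ∫⁻ z in Metric.ball x (r / 3), ‖φ z‖ₑ ^ 2 ∂surfaceMeasure Ω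
      ≤ ∫⁻ z, ENNReal.ofReal (ψ z) ∂surfaceMeasure Ω := by
        rw [← lintegral_indicator Metric.isOpen_ball.measurableSet]
        refine lintegral_mono fun z => ?_
        by_cases hz : z ∈ Metric.ball x (r / 3)
        · rw [indicator_of_mem hz, hsq]
          have : b z = 1 := b.one_of_mem_closedBall (Metric.ball_subset_closedBall hz)
          simp [hψdef, this]
        · rw [indicator_of_notMem hz]; exact zero_le
    _ = ENNReal.ofReal (∫ z, ψ z ∂surfaceMeasure Ω) :=
        (ofReal_integral_eq_lintegral_ofReal hψi (ae_of_all _ hψ0)).symm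
    _ ≤ ENNReal.ofReal (c⁻¹ * (M + 1) * ∫ z in Ω, (φ z ^ 2 + ‖gradient φ z‖ ^ 2)) :=
        ENNReal.ofReal_le_ofReal hfinal
    _ = _ := by
        rw [ENNReal.ofReal_mul (by positivity), integral_add hφi hgi,
          ENNReal.ofReal_add (integral_nonneg fun _ => sq_nonneg _)
            (integral_nonneg fun _ => sq_nonneg _),
          ofReal_integral_eq_lintegral_ofReal hφi (ae_of_all _ fun _ => sq_nonneg _),
          ofReal_integral_eq_lintegral_ofReal hgi (ae_of_all _ fun _ => sq_nonneg _)]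
        simp only [hsq, hsq']
        rfl

/-- The trace inequality for test functions. -/
theorem exists_trace_bound (hΩ : IsOpen Ω) (hΓ : IsCompact (frontier Ω))
    (hLip : HasLipschitzBoundary Ω) :
    ∃ C : ℝ≥0, ∀ φ : EuclideanSpace ℝ (Fin d) → ℝ, IsTest φ →
      eLpNorm φ 2 (surfaceMeasure Ω)
        ≤ C * (eLpNorm φ 2 (volume.restrict Ω) + eLpNorm (gradient φ) 2 (volume.restrict Ω)) := by
  obtain ⟨C, hC⟩ : ∃ C : ℝ≥0, ∀ φ : EuclideanSpace ℝ (Fin d) → ℝ, IsTest φ →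
      ∫⁻ z in frontier Ω, ‖φ z‖ₑ ^ 2 ∂surfaceMeasure Ω
        ≤ C * ((∫⁻ z in Ω, ‖φ z‖ₑ ^ 2) + ∫⁻ z in Ω, ‖gradient φ z‖ₑ ^ 2) := by
    refine hΓ.induction_on (p := fun s => ∃ C : ℝ≥0, ∀ φ : EuclideanSpace ℝ (Fin d) → ℝ, IsTest φ →
      ∫⁻ z in s, ‖φ z‖ₑ ^ 2 ∂surfaceMeasure Ω
        ≤ C * ((∫⁻ z in Ω, ‖φ z‖ₑ ^ 2) + ∫⁻ z in Ω, ‖gradient φ z‖ₑ ^ 2)) ⟨0, by simp⟩ ?_ ?_ ?_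
    · rintro s t hst ⟨C, hC⟩
      exact ⟨C, fun φ hφ => (lintegral_mono_set hst).trans (hC φ hφ)⟩
    · rintro s t ⟨C, hC⟩ ⟨C', hC'⟩
      refine ⟨C + C', fun φ hφ => (lintegral_union_le _ _ _).trans ?_⟩
      rw [ENNReal.coe_add, add_mul]
      exact add_le_add (hC φ hφ) (hC' φ hφ)
    · intro x hx
      obtain ⟨U, hU, h⟩ := exists_trace_bound_of_chart hΩ hΓ hLip hx
      exact ⟨U, mem_nhdsWithin_of_mem_nhds hU, h⟩
  rw [surfaceMeasure_restrict_frontier] at hC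
  refine ⟨NNReal.sqrt C, fun φ hφ => ?_⟩
  have h := hC φ hφ
  rw [← eLpNorm_two_sq, ← eLpNorm_two_sq, ← eLpNorm_two_sq] at h
  rw [← ENNReal.pow_le_pow_left_iff two_ne_zero]
  refine h.trans ?_
  rw [mul_pow, ← ENNReal.coe_pow, NNReal.sq_sqrt]
  gcongr
  rw [add_sq]
  calc _ ≤ eLpNorm φ 2 (volume.restrict Ω) ^ 2 + 2 * eLpNorm φ 2 (volume.restrict Ω) *
        eLpNorm (gradient φ) 2 (volume.restrict Ω) + eLpNorm (gradient φ) 2 (volume.restrict Ω) ^ 2 :=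
      add_le_add_left le_self_add _
    _ = _ := rfl

end Global

/-! ### Mollification in `L²` -/

section Mollification

open Set
open scoped NNReal ENNReal Convolution

variable {V F : Type*} [NormedAddCommGroup V] [InnerProductSpace ℝ V] [FiniteDimensional ℝ V]
  [MeasurableSpace V] [BorelSpace V] [NormedAddCommGroup F]

/-- Translation is continuous in `L²`. -/
lemma exists_eLpNorm_translate_sub_le {f : V → F} (hf : MemLp f 2 (volume : Measure V)) {η : ℝ≥0∞}
    (hη : η ≠ 0) :
    ∃ δ > 0, ∀ t : V, ‖t‖ ≤ δ → eLpNorm (fun x => f (x - t) - f x) 2 volume ≤ η := by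
  have : Fact ((2 : ℝ≥0∞) ≠ ⊤) := ⟨ENNReal.ofNat_ne_top⟩
  set g : Lp F 2 (volume : Measure V) := hf.toLp f
  have hcont : Continuous fun t : V => DomAddAct.mk (-t) +ᵥ g := by
    have h1 : Continuous fun t : V => (DomAddAct.mk (-t) : Vᵈᵃᵃ) :=
      DomAddAct.continuous_mk.comp continuous_neg
    exact h1.vadd continuous_const
  have h0 : DomAddAct.mk (-(0 : V)) +ᵥ g = g := by
    rw [neg_zero]
    exact zero_vadd _ g
  have hev : ∀ᶠ t : V in 𝓝 (0 : V), edist (DomAddAct.mk (-t) +ᵥ g) g < η := by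
    have := (hcont.tendsto 0)
    rw [h0] at this
    exact this.eventually (Metric.eball_mem_nhds g (pos_iff_ne_zero.2 hη))
  obtain ⟨δ, hδ, hball⟩ := Metric.eventually_nhds_iff.1 hev
  refine ⟨δ / 2, by positivity, fun t ht => ?_⟩
  have h := (hball (y := t) (by rw [dist_zero_right]; linarith)).le
  rw [Lp.edist_def] at h
  refine le_trans (le_of_eq (eLpNorm_congr_ae ?_)) h
  have h1 : ((DomAddAct.mk (-t) +ᵥ g : Lp F 2 (volume : Measure V)) : V → F)
      =ᵐ[volume] fun x => f (x - t) := by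
    rw [DomAddAct.mk_vadd_toLp]
    refine (MemLp.coeFn_toLp _).trans (ae_of_all _ fun x => ?_)
    simp [sub_eq_neg_add]
  filter_upwards [h1, hf.coeFn_toLp] with x h2 h3
  rw [Pi.sub_apply, h2, h3]

variable [NormedSpace ℝ F] [CompleteSpace F]

/-- A translated mollification is an average of translations; by Jensen's inequality its distance
from the original function in `L²` is at most that of the translates. -/
lemma eLpNorm_convolution_sub_le {f : V → F} (hf : MemLp f 2 (volume : Measure V))
    (ρ : ContDiffBump (0 : V)) (a : V) {η : ℝ≥0∞}
    (h : ∀ t : V, ‖t‖ ≤ ‖a‖ + ρ.rOut → eLpNorm (fun x => f (x - t) - f x) 2 volume ≤ η) :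
    eLpNorm (fun y => (ρ.normed volume ⋆[ContinuousLinearMap.lsmul ℝ ℝ, volume] f) (y + a) - f y)
      2 volume ≤ η := by
  -- pass to a strongly measurable representative
  wlog hsm : StronglyMeasurable f generalizing f
  · have hae : f =ᵐ[volume] hf.1.mk f := hf.1.ae_eq_mk
    have := this (f := hf.1.mk f) (hf.ae_eq hae) (fun t ht => ?_) hf.1.stronglyMeasurable_mk
    · refine le_trans (le_of_eq (eLpNorm_congr_ae ?_)) this
      filter_upwards [hae] with y hy
      rw [convolution_congr _ (ae_eq_refl (ρ.normed volume)) hae, hy]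
    · refine le_trans (le_of_eq (eLpNorm_congr_ae ?_)) (h t ht)
      have h2 := (measurePreserving_sub_right volume t).quasiMeasurePreserving.ae_eq_comp hae
      filter_upwards [hae, h2] with x hx hx'
      simp only [Function.comp_apply] at hx'
      rw [hx, hx']
  set m : Measure V := volume.withDensity fun t => ENNReal.ofReal (ρ.normed volume t)
  have hρm : Measurable fun t => ENNReal.ofReal (ρ.normed volume t) :=
    ρ.continuous_normed.measurable.ennreal_ofReal
  have hρi : Integrable (ρ.normed volume) volume := ρ.integrable_normed
  have hprob : IsProbabilityMeasure m := ⟨by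
    rw [withDensity_apply _ MeasurableSet.univ, Measure.restrict_univ,
      ← ofReal_integral_eq_lintegral_ofReal hρi (ae_of_all _ ρ.nonneg_normed), ρ.integral_normed,
      ENNReal.ofReal_one]⟩
  set D : V → V → F := fun y t => f (y - (t - a)) - f y
  have hDm : StronglyMeasurable (Function.uncurry D) := by
    have h1 : Measurable fun p : V × V => p.1 - (p.2 - a) := by fun_prop
    exact (hsm.comp_measurable h1).sub (hsm.comp_measurable measurable_fst)
  have hpt : ∀ y, ‖(ρ.normed volume ⋆[ContinuousLinearMap.lsmul ℝ ℝ, volume] f) (y + a) - f y‖ₑ ^ 2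
      ≤ ∫⁻ t, ‖D y t‖ₑ ^ 2 ∂m := by
    intro y
    have hex : ConvolutionExistsAt (ρ.normed volume) f (y + a) (ContinuousLinearMap.lsmul ℝ ℝ)
        volume := ρ.hasCompactSupport_normed.convolutionExists_left _ ρ.continuous_normed
          (hf.locallyIntegrable (by norm_num)) _
    have heq : (ρ.normed volume ⋆[ContinuousLinearMap.lsmul ℝ ℝ, volume] f) (y + a) - f y
        = ∫ t, ρ.normed volume t • D y t := by
      have h1 : ∫ t, ρ.normed volume t • f y = f y := by
        rw [integral_smul_const, ρ.integral_normed, one_smul]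
      rw [convolution_def]
      conv_lhs => rw [← h1]
      rw [← integral_sub hex (hρi.smul_const (f y))]
      refine integral_congr_ae (ae_of_all _ fun t => ?_)
      simp only [D, ContinuousLinearMap.lsmul_apply, smul_sub]
      rw [show y + a - t = y - (t - a) by abel]
    have hDy : StronglyMeasurable (D y) := hDm.comp_measurable measurable_prodMk_left
    have hle : ‖(ρ.normed volume ⋆[ContinuousLinearMap.lsmul ℝ ℝ, volume] f) (y + a) - f y‖ₑ
        ≤ eLpNorm (D y) 2 m := by
      rw [heq]
      refine (enorm_integral_le_lintegral_enorm _).trans ?_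
      refine le_trans (le_of_eq ?_) (eLpNorm_le_eLpNorm_of_exponent_le (p := 1) (by norm_num)
        hDy.aestronglyMeasurable)
      rw [eLpNorm_one_eq_lintegral_enorm, lintegral_withDensity_eq_lintegral_mul _ hρm hDy.enorm]
      refine lintegral_congr fun t => ?_
      rw [enorm_smul, Real.enorm_eq_ofReal (ρ.nonneg_normed t)]
      rfl
    rw [← eLpNorm_two_sq]
    gcongr
  rw [← ENNReal.pow_le_pow_left_iff two_ne_zero, eLpNorm_two_sq]
  calc _ ≤ ∫⁻ y, ∫⁻ t, ‖D y t‖ₑ ^ 2 ∂m := lintegral_mono hpt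
    _ = ∫⁻ t, (∫⁻ y, ‖D y t‖ₑ ^ 2) ∂m :=
        lintegral_lintegral_swap (hDm.enorm.pow_const 2).aemeasurable
    _ ≤ ∫⁻ _, η ^ 2 ∂m := by
        refine lintegral_mono_ae ?_
        rw [ae_withDensity_iff hρm]
        refine ae_of_all _ fun t ht => ?_
        have ht' : t ∈ Metric.ball (0 : V) ρ.rOut := by
          rw [← ρ.support_normed_eq (μ := volume)]
          intro h0
          exact ht (by rw [h0, ENNReal.ofReal_zero])
        rw [← eLpNorm_two_sq]
        gcongr
        refine h (t - a) ((norm_sub_le _ _).trans ?_)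
        rw [mem_ball_zero_iff] at ht'
        linarith
    _ = η ^ 2 := by simp

end Mollification

/-! ### Density of test functions in `H¹(Ω)` -/

section Density

open Set
open scoped NNReal ENNReal Convolution

variable {d : ℕ} {Ω : Set (EuclideanSpace ℝ (Fin d))}

lemma IsTest.memLp {F : Type*} [NormedAddCommGroup F] [NormedSpace ℝ F]
    {φ : EuclideanSpace ℝ (Fin d) → F} (h : IsTest φ) (μ : Measure (EuclideanSpace ℝ (Fin d)))
    [IsFiniteMeasureOnCompacts μ] {p : ℝ≥0∞} : MemLp φ p μ :=
  h.continuous.memLp_of_hasCompactSupport h.2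

lemma IsTest.memLp_gradient {φ : EuclideanSpace ℝ (Fin d) → ℝ} (h : IsTest φ)
    (μ : Measure (EuclideanSpace ℝ (Fin d))) [IsFiniteMeasureOnCompacts μ] {p : ℝ≥0∞} :
    MemLp (gradient φ) p μ :=
  h.continuous_gradient.memLp_of_hasCompactSupport h.hasCompactSupport_gradient

lemma MemL2.apply {ψ : EuclideanSpace ℝ (Fin d) → EuclideanSpace ℝ (Fin d)} (h : MemL2 Ω ψ)
    (i : Fin d) : MemL2 Ω fun x => ψ x i :=
  (EuclideanSpace.proj (𝕜 := ℝ) i).comp_memLp' h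

lemma IsTest.tsupport_smul_const_subset {θ : EuclideanSpace ℝ (Fin d) → ℝ}
    (c : EuclideanSpace ℝ (Fin d)) : tsupport (fun x => θ x • c) ⊆ tsupport θ :=
  closure_mono (Function.support_smul_subset_left θ fun _ => c)

lemma classicalDiv_smul_single {θ : EuclideanSpace ℝ (Fin d) → ℝ} (hθ : Differentiable ℝ θ)
    (i : Fin d) (x : EuclideanSpace ℝ (Fin d)) :
    classicalDiv (fun x => θ x • EuclideanSpace.single i (1 : ℝ)) x
      = fderiv ℝ θ x (EuclideanSpace.single i 1) := by
  have h : fderiv ℝ (fun x => θ x • EuclideanSpace.single i (1 : ℝ)) x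
      = (fderiv ℝ θ x).smulRight (EuclideanSpace.single i (1 : ℝ)) :=
    ((hθ x).hasFDerivAt.smul_const _).fderiv
  rw [classicalDiv, h]
  simp

/-- A weak gradient, tested componentwise. -/
lemma HasWeakGrad.setIntegral_apply_mul {v : EuclideanSpace ℝ (Fin d) → ℝ}
    {G : EuclideanSpace ℝ (Fin d) → EuclideanSpace ℝ (Fin d)} (h : HasWeakGrad Ω v G)
    {θ : EuclideanSpace ℝ (Fin d) → ℝ} (hθ : IsTest θ) (hs : tsupport θ ⊆ Ω) (i : Fin d) :
    ∫ x in Ω, G x i * θ x = -∫ x in Ω, v x * fderiv ℝ θ x (EuclideanSpace.single i 1) := by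
  have h1 := h.2 _ (hθ.smul_const (EuclideanSpace.single i 1))
    ((IsTest.tsupport_smul_const_subset _).trans hs)
  simp only [classicalDiv_smul_single hθ.differentiable, inner_smul_right,
    EuclideanSpace.inner_single_right] at h1
  rw [← h1]
  refine integral_congr_ae (ae_of_all _ fun x => ?_)
  simp [mul_comm]

/-- The pair `(v, G)` can be approximated in `L²(Ω)` by test functions and their gradients. -/
def TestApproximable (Ω : Set (EuclideanSpace ℝ (Fin d))) (v : EuclideanSpace ℝ (Fin d) → ℝ)
    (G : EuclideanSpace ℝ (Fin d) → EuclideanSpace ℝ (Fin d)) : Prop :=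
  ∀ η : ℝ≥0∞, η ≠ 0 → ∃ φ, IsTest φ ∧ eLpNorm (φ - v) 2 (volume.restrict Ω) ≤ η ∧
    eLpNorm (gradient φ - G) 2 (volume.restrict Ω) ≤ η

lemma gradient_add' {φ ψ : EuclideanSpace ℝ (Fin d) → ℝ} (hφ : Differentiable ℝ φ)
    (hψ : Differentiable ℝ ψ) : gradient (φ + ψ) = gradient φ + gradient ψ := by
  ext1 x
  simp [gradient, fderiv_add (hφ x) (hψ x)]

lemma gradient_sub' {φ ψ : EuclideanSpace ℝ (Fin d) → ℝ} (hφ : Differentiable ℝ φ)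
    (hψ : Differentiable ℝ ψ) : gradient (φ - ψ) = gradient φ - gradient ψ := by
  ext1 x
  simp [gradient, fderiv_sub (hφ x) (hψ x)]

lemma TestApproximable.add {v v' : EuclideanSpace ℝ (Fin d) → ℝ}
    {G G' : EuclideanSpace ℝ (Fin d) → EuclideanSpace ℝ (Fin d)}
    (hv : MemL2 Ω v) (hv' : MemL2 Ω v') (hG : MemL2 Ω G) (hG' : MemL2 Ω G')
    (h : TestApproximable Ω v G) (h' : TestApproximable Ω v' G') :
    TestApproximable Ω (v + v') (G + G') := by
  intro η hη
  obtain ⟨φ, hφ, h1, h2⟩ := h (η / 2) (by simp [hη])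
  obtain ⟨φ', hφ', h1', h2'⟩ := h' (η / 2) (by simp [hη])
  refine ⟨φ + φ', hφ.add hφ', ?_, ?_⟩
  · rw [add_sub_add_comm]
    refine (eLpNorm_add_le ((hφ.memLp _ (p := 2)).sub hv).1 ((hφ'.memLp _ (p := 2)).sub hv').1
      (by norm_num)).trans ?_
    exact (add_le_add h1 h1').trans (ENNReal.add_halves η).le
  · rw [gradient_add' hφ.differentiable hφ'.differentiable, add_sub_add_comm]
    refine (eLpNorm_add_le ((hφ.memLp_gradient _ (p := 2)).sub hG).1
      ((hφ'.memLp_gradient _ (p := 2)).sub hG').1 (by norm_num)).trans ?_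
    exact (add_le_add h2 h2').trans (ENNReal.add_halves η).le

/-- The pairs approximable by test functions form a closed set. -/
lemma TestApproximable.of_tendsto {v : EuclideanSpace ℝ (Fin d) → ℝ}
    {G : EuclideanSpace ℝ (Fin d) → EuclideanSpace ℝ (Fin d)} (hv : MemL2 Ω v) (hG : MemL2 Ω G)
    {w : ℕ → EuclideanSpace ℝ (Fin d) → ℝ}
    {H : ℕ → EuclideanSpace ℝ (Fin d) → EuclideanSpace ℝ (Fin d)}
    (hw : ∀ n, MemL2 Ω (w n)) (hH : ∀ n, MemL2 Ω (H n)) (h : ∀ n, TestApproximable Ω (w n) (H n))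
    (h1 : Tendsto (fun n => eLpNorm (w n - v) 2 (volume.restrict Ω)) atTop (𝓝 0))
    (h2 : Tendsto (fun n => eLpNorm (H n - G) 2 (volume.restrict Ω)) atTop (𝓝 0)) :
    TestApproximable Ω v G := by
  intro η hη
  have hη2 : 0 < η / 2 := pos_iff_ne_zero.2 (by simp [hη])
  obtain ⟨n, hn1, hn2⟩ := ((h1.eventually_lt_const hη2).and (h2.eventually_lt_const hη2)).exists
  obtain ⟨φ, hφ, k1, k2⟩ := h n (η / 2) hη2.ne'
  refine ⟨φ, hφ, ?_, ?_⟩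
  · rw [← sub_add_sub_cancel φ (w n) v]
    refine (eLpNorm_add_le ((hφ.memLp _ (p := 2)).sub (hw n)).1 ((hw n).sub hv).1
      (by norm_num)).trans ?_
    exact (add_le_add k1 hn1.le).trans (ENNReal.add_halves η).le
  · rw [← sub_add_sub_cancel (gradient φ) (H n) G]
    refine (eLpNorm_add_le ((hφ.memLp_gradient _ (p := 2)).sub (hH n)).1 ((hH n).sub hG).1
      (by norm_num)).trans ?_
    exact (add_le_add k2 hn2.le).trans (ENNReal.add_halves η).le

/-- The gradient that the product rule assigns to `χ v`, for `χ` smooth and `v` with weak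
gradient `G`. -/
def productGrad (χ v : EuclideanSpace ℝ (Fin d) → ℝ)
    (G : EuclideanSpace ℝ (Fin d) → EuclideanSpace ℝ (Fin d)) (x : EuclideanSpace ℝ (Fin d)) :
    EuclideanSpace ℝ (Fin d) := χ x • G x + v x • gradient χ x

lemma IsTest.memL2_mul {χ v : EuclideanSpace ℝ (Fin d) → ℝ} (hχ : IsTest χ) (hv : MemL2 Ω v) :
    MemL2 Ω fun x => χ x * v x :=
  hv.mul (hχ.memLp (volume.restrict Ω) (p := ⊤))

lemma IsTest.memL2_productGrad {χ v : EuclideanSpace ℝ (Fin d) → ℝ}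
    {G : EuclideanSpace ℝ (Fin d) → EuclideanSpace ℝ (Fin d)} (hχ : IsTest χ) (hv : MemL2 Ω v)
    (hG : MemL2 Ω G) : MemL2 Ω (productGrad χ v G) :=
  (hG.smul (hχ.memLp (volume.restrict Ω) (p := ⊤))).add
    ((hχ.memLp_gradient (volume.restrict Ω) (p := ⊤)).smul hv)

/-- Partial derivatives of a mollification. -/
lemma fderiv_convolution_apply {ρ f : EuclideanSpace ℝ (Fin d) → ℝ} (hρ : IsTest ρ)
    (hf : LocallyIntegrable f volume) (x w : EuclideanSpace ℝ (Fin d)) :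
    fderiv ℝ (ρ ⋆[ContinuousLinearMap.lsmul ℝ ℝ, volume] f) x w
      = ∫ z, fderiv ℝ ρ (x - z) w * f z := by
  have hρ1 : ContDiff ℝ 1 ρ := hρ.1.of_le (by simp)
  have h := hρ.2.hasFDerivAt_convolution_left (ContinuousLinearMap.lsmul ℝ ℝ) (μ := volume)
    hρ1 hf x
  rw [h.fderiv, convolution_def, ContinuousLinearMap.integral_apply]
  · rw [← integral_sub_left_eq_self _ volume x]
    refine integral_congr_ae (ae_of_all _ fun z => ?_)
    simp
  · exact (hρ.2.fderiv ℝ).convolutionExists_left _ (hρ1.continuous_fderiv one_ne_zero) hf x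

/-- Mollification at a translated point commutes with the weak gradient of `χ v`, extended by zero,
provided that the ball seen by the kernel lies inside `Ω` or misses the support of `χ`. -/
lemma gradient_translated_mollification {v χ : EuclideanSpace ℝ (Fin d) → ℝ} (hΩ : IsOpen Ω)
    {G : EuclideanSpace ℝ (Fin d) → EuclideanSpace ℝ (Fin d)} (hv : MemL2 Ω v)
    (hG : HasWeakGrad Ω v G) (hχ : IsTest χ) (ρ : ContDiffBump (0 : EuclideanSpace ℝ (Fin d)))
    {a y : EuclideanSpace ℝ (Fin d)}
    (hsub : (Metric.closedBall (y + a) ρ.rOut ∩ tsupport χ).Nonempty →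
      Metric.closedBall (y + a) ρ.rOut ⊆ Ω) :
    gradient (fun y => (ρ.normed volume ⋆[ContinuousLinearMap.lsmul ℝ ℝ, volume]
        Ω.indicator fun x => χ x * v x) (y + a)) y
      = (ρ.normed volume ⋆[ContinuousLinearMap.lsmul ℝ ℝ, volume]
        Ω.indicator (productGrad χ v G)) (y + a) := by
  have hρ : IsTest (ρ.normed (volume : Measure (EuclideanSpace ℝ (Fin d)))) :=
    ⟨ρ.contDiff_normed, ρ.hasCompactSupport_normed⟩
  have hv' : MemLp (Ω.indicator fun x => χ x * v x) 2 volume :=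
    (memLp_indicator_iff_restrict hΩ.measurableSet).2 (hχ.memL2_mul hv)
  have hG' : MemLp (Ω.indicator (productGrad χ v G)) 2 volume :=
    (memLp_indicator_iff_restrict hΩ.measurableSet).2 (hχ.memL2_productGrad hv hG.1)
  set x := y + a with hx
  ext i
  set w : EuclideanSpace ℝ (Fin d) := EuclideanSpace.single i 1
  rw [gradient_apply, fderiv_comp_add_right, ← hx,
    fderiv_convolution_apply hρ (hv'.locallyIntegrable (by norm_num))]
  -- the kernel centred at `x`, multiplied by the cutoff, is an admissible test function
  set θ : EuclideanSpace ℝ (Fin d) → ℝ := fun z => ρ.normed volume (x - z) with hθdef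
  have hθ : IsTest θ := by
    refine ⟨ρ.contDiff_normed.comp (contDiff_const.sub contDiff_id), ?_⟩
    exact ρ.hasCompactSupport_normed.comp_homeomorph (Homeomorph.subLeft x)
  have hθ' : ∀ z, fderiv ℝ θ z w = -fderiv ℝ (ρ.normed volume) (x - z) w := fun z => by
    have h1 : HasFDerivAt (fun z => x - z) (-ContinuousLinearMap.id ℝ _) z :=
      (hasFDerivAt_id z).const_sub x
    rw [show fderiv ℝ θ z = _ from ((hρ.differentiable (x - z)).hasFDerivAt.comp z h1).fderiv]
    simp
  have hθs : tsupport θ ⊆ Metric.closedBall x ρ.rOut := by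
    refine closure_minimal (fun z hz => ?_) Metric.isClosed_closedBall
    have : x - z ∈ Metric.ball (0 : EuclideanSpace ℝ (Fin d)) ρ.rOut := by
      rw [← ρ.support_normed_eq (μ := volume)]; exact hz
    rw [mem_ball_zero_iff] at this
    rw [mem_closedBall_iff_norm']
    exact this.le
  have hθχ : IsTest fun z => θ z * χ z := IsTest.mul hθ.1 hχ
  have hs : tsupport (fun z => θ z * χ z) ⊆ Ω := by
    intro z hz
    have h1 : z ∈ tsupport θ := closure_mono (Function.support_mul_subset_left θ χ) hz
    have h2 : z ∈ tsupport χ := closure_mono (Function.support_mul_subset_right θ χ) hz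
    exact hsub ⟨z, hθs h1, h2⟩ (hθs h1)
  have hweak : ∫ z in Ω, G z i * (θ z * χ z)
      = -∫ z in Ω, v z * fderiv ℝ (fun z => θ z * χ z) z w :=
    hG.setIntegral_apply_mul hθχ hs i
  have hder : ∀ z, fderiv ℝ (fun z => θ z * χ z) z w
      = θ z * fderiv ℝ χ z w - fderiv ℝ (ρ.normed volume) (x - z) w * χ z := fun z => by
    rw [fderiv_fun_mul (hθ.differentiable z) (hχ.differentiable z)]
    simp only [add_apply, smul_apply, smul_eq_mul, hθ']
    ring
  have hI1 : Integrable (fun z => v z * (fderiv ℝ (ρ.normed volume) (x - z) w * χ z))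
      (volume.restrict Ω) := by
    have : IsTest fun z => fderiv ℝ (ρ.normed volume) (x - z) w * χ z :=
      IsTest.mul ((hρ.fderiv_apply w).1.comp (contDiff_const.sub contDiff_id)) hχ
    exact hv.integrable_mul (this.memLp _ (p := 2))
  have hI2 : Integrable (fun z => v z * (θ z * fderiv ℝ χ z w)) (volume.restrict Ω) :=
    hv.integrable_mul ((IsTest.mul hθ.1 (hχ.fderiv_apply w)).memLp _ (p := 2))
  have hI3 : Integrable (fun z => G z i * (θ z * χ z)) (volume.restrict Ω) :=
    (hG.1.apply i).integrable_mul (hθχ.memLp _ (p := 2))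
  simp only [hder, mul_sub] at hweak
  rw [integral_sub hI2 hI1] at hweak
  have hL : ∫ z, fderiv ℝ (ρ.normed volume) (x - z) w * Ω.indicator (fun x => χ x * v x) z
      = ∫ z in Ω, v z * (fderiv ℝ (ρ.normed volume) (x - z) w * χ z) := by
    rw [← integral_indicator hΩ.measurableSet]
    refine integral_congr_ae (ae_of_all _ fun z => ?_)
    by_cases hz : z ∈ Ω
    · simp only [indicator_of_mem hz]; ring
    · simp only [indicator_of_notMem hz, mul_zero]
  have hR : (ρ.normed volume ⋆[ContinuousLinearMap.lsmul ℝ ℝ, volume]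
        Ω.indicator (productGrad χ v G)) x i
      = ∫ z in Ω, (G z i * (θ z * χ z) + v z * (θ z * fderiv ℝ χ z w)) := by
    have hex : ConvolutionExistsAt (ρ.normed volume) (Ω.indicator (productGrad χ v G)) x
        (ContinuousLinearMap.lsmul ℝ ℝ) volume :=
      ρ.hasCompactSupport_normed.convolutionExists_left _ ρ.continuous_normed
        (hG'.locallyIntegrable (by norm_num)) _
    have h1 := (EuclideanSpace.proj (𝕜 := ℝ) i).integral_comp_comm hex
    rw [convolution_def]
    refine h1.symm.trans ?_
    rw [← integral_sub_left_eq_self _ volume x, ← integral_indicator hΩ.measurableSet]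
    refine integral_congr_ae (ae_of_all _ fun z => ?_)
    by_cases hz : z ∈ Ω
    · simp only [indicator_of_mem hz, sub_sub_cancel, productGrad]
      have h2 : fderiv ℝ χ z w = gradient χ z i := (gradient_apply z i).symm
      rw [h2]
      simp [hθdef]
      ring
    · simp [indicator_of_notMem hz]
  rw [hL, hR, integral_add hI3 hI2]
  linarith

/-- Suppose that, for arbitrarily small translations `a` and radii `ε`, every `ε`-ball around a point
`y + a` with `y ∈ Ω` that meets the support of the cutoff `χ` lies inside `Ω`. Then the translated
mollifications of `χ v` approximate it in `H¹(Ω)`. -/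
lemma testApproximable_mul_of_shift {v χ : EuclideanSpace ℝ (Fin d) → ℝ} (hΩ : IsOpen Ω)
    {G : EuclideanSpace ℝ (Fin d) → EuclideanSpace ℝ (Fin d)} (hv : MemL2 Ω v)
    (hG : HasWeakGrad Ω v G) (hχ : IsTest χ)
    (hshift : ∀ δ > 0, ∃ (a : EuclideanSpace ℝ (Fin d)) (ε : ℝ), 0 < ε ∧ ‖a‖ + ε ≤ δ ∧ ∀ y ∈ Ω,
      (Metric.closedBall (y + a) ε ∩ tsupport χ).Nonempty → Metric.closedBall (y + a) ε ⊆ Ω) :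
    TestApproximable Ω (fun x => χ x * v x) (productGrad χ v G) := by
  intro η hη
  have hv' : MemLp (Ω.indicator fun x => χ x * v x) 2 volume :=
    (memLp_indicator_iff_restrict hΩ.measurableSet).2 (hχ.memL2_mul hv)
  have hG' : MemLp (Ω.indicator (productGrad χ v G)) 2 volume :=
    (memLp_indicator_iff_restrict hΩ.measurableSet).2 (hχ.memL2_productGrad hv hG.1)
  obtain ⟨δ₁, hδ₁, h1⟩ := exists_eLpNorm_translate_sub_le hv' hη
  obtain ⟨δ₂, hδ₂, h2⟩ := exists_eLpNorm_translate_sub_le hG' hη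
  obtain ⟨a, ε, hε, hle, hsub⟩ := hshift (min δ₁ δ₂) (lt_min hδ₁ hδ₂)
  let ρ : ContDiffBump (0 : EuclideanSpace ℝ (Fin d)) := ⟨ε / 2, ε, by linarith, by linarith⟩
  have hφ : IsTest fun y => (ρ.normed volume ⋆[ContinuousLinearMap.lsmul ℝ ℝ, volume]
      Ω.indicator fun x => χ x * v x) (y + a) := by
    constructor
    · exact (ρ.hasCompactSupport_normed.contDiff_convolution_left _ ρ.contDiff_normed
        (hv'.locallyIntegrable (by norm_num))).comp (contDiff_id.add contDiff_const)
    · have hcs : HasCompactSupport (Ω.indicator fun x => χ x * v x) := by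
        refine hχ.2.mono ?_
        rw [Set.support_indicator]
        exact inter_subset_right.trans (Function.support_mul_subset_left _ _)
      exact (ρ.hasCompactSupport_normed.convolution _ hcs).comp_homeomorph (Homeomorph.addRight a)
  refine ⟨_, hφ, ?_, ?_⟩
  · have h3 := eLpNorm_convolution_sub_le hv' ρ a (η := η)
      fun t ht => h1 t (ht.trans (hle.trans (min_le_left _ _)))
    refine le_trans (le_of_eq ?_) ((eLpNorm_mono_measure _ (Measure.restrict_le_self
      (s := Ω))).trans h3)
    refine eLpNorm_congr_ae ?_
    filter_upwards [ae_restrict_mem hΩ.measurableSet] with y hy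
    simp only [Pi.sub_apply, indicator_of_mem hy]
  · have h3 := eLpNorm_convolution_sub_le hG' ρ a (η := η)
      fun t ht => h2 t (ht.trans (hle.trans (min_le_right _ _)))
    refine le_trans (le_of_eq ?_) ((eLpNorm_mono_measure _ (Measure.restrict_le_self
      (s := Ω))).trans h3)
    refine eLpNorm_congr_ae ?_
    filter_upwards [ae_restrict_mem hΩ.measurableSet] with y hy
    rw [Pi.sub_apply, gradient_translated_mollification hΩ hv hG hχ ρ (hsub y hy),
      indicator_of_mem hy]

/-- In a boundary chart, moving a point of `Ω` by `s e` creates a ball of radius comparable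
to `s` inside `Ω`. -/
lemma IsEpigraphChart.closedBall_subset {x e : EuclideanSpace ℝ (Fin d)} {g : (ℝ ∙ e)ᗮ → ℝ}
    {K : ℝ≥0} {r : ℝ} (h : IsEpigraphChart Ω x e g K r) {y : EuclideanSpace ℝ (Fin d)} (hy : y ∈ Ω)
    {s ε : ℝ} (hs : 0 < s) (hε : (K + 1) * ε ≤ s) (hsr : s + 3 * ε < r / 2)
    (hmeet : (Metric.closedBall (y + s • e) ε ∩ Metric.ball x (r / 2)).Nonempty) :
    Metric.closedBall (y + s • e) ε ⊆ Ω := by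
  obtain ⟨p, hp, hpx⟩ := hmeet
  intro z hz
  have he := h.norm_eq
  have hε0 : 0 ≤ ε := dist_nonneg.trans (Metric.mem_closedBall.1 hp)
  rw [Metric.mem_closedBall] at hp hz
  rw [Metric.mem_ball] at hpx
  have hys : dist y (y + s • e) = s := by
    rw [dist_eq_norm, sub_add_cancel_left, norm_neg, norm_smul, he, mul_one,
      Real.norm_of_nonneg hs.le]
  have hyr : y ∈ Metric.ball x r := by
    rw [Metric.mem_ball]
    have h1 := dist_triangle4 y (y + s • e) p x
    rw [dist_comm (y + s • e) p, hys] at h1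
    linarith
  have hzr : z ∈ Metric.ball x r := by
    rw [Metric.mem_ball]
    have h1 := dist_triangle4 z (y + s • e) p x
    rw [dist_comm (y + s • e) p] at h1
    linarith
  have hyepi : g (hyperplaneProj e y) < inner ℝ e y := (h.mem_iff y hyr).1 hy
  refine (h.mem_iff z hzr).2 ?_
  rw [dist_eq_norm] at hz
  set ζ := z - (y + s • e) with hζ
  have hzy : z = y + s • e + ζ := by rw [hζ]; abel
  have he0 : hyperplaneProj e e = 0 := by
    have := hyperplaneProj_coe_add_smul he 0 1
    simpa using this
  have hpz : hyperplaneProj e z = hyperplaneProj e y + hyperplaneProj e ζ := by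
    rw [hzy, map_add, map_add, map_smul, he0, smul_zero, add_zero]
  have hiz : inner ℝ e z = inner ℝ e y + s + inner ℝ e ζ := by
    rw [hzy, inner_add_right, inner_add_right, inner_smul_right, real_inner_self_eq_norm_sq, he]
    simp
  have h1 : g (hyperplaneProj e z) - g (hyperplaneProj e y) ≤ K * ε := by
    have h2 := h.lipschitz.dist_le_mul (hyperplaneProj e z) (hyperplaneProj e y)
    rw [hpz, dist_self_add_left, ← hpz, Real.dist_eq] at h2
    exact (le_abs_self _).trans (h2.trans (mul_le_mul_of_nonneg_left
      ((norm_hyperplaneProj_le e ζ).trans hz) K.2))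
  have h3 : -ε ≤ inner ℝ e ζ := by
    have := (abs_real_inner_le_norm e ζ)
    rw [he, one_mul] at this
    exact (neg_le_neg (this.trans hz)).trans (neg_abs_le _)
  change g (hyperplaneProj e z) < inner ℝ e z
  rw [hiz]
  linarith

/-- Localized functions in `H¹(Ω)` are approximable by test functions. -/
lemma testApproximable_mul {v χ : EuclideanSpace ℝ (Fin d) → ℝ} (hΩ : IsOpen Ω)
    (hLip : HasLipschitzBoundary Ω)
    {G : EuclideanSpace ℝ (Fin d) → EuclideanSpace ℝ (Fin d)} (hv : MemL2 Ω v)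
    (hG : HasWeakGrad Ω v G) (hχ : IsTest χ) :
    TestApproximable Ω (fun x => χ x * v x) (productGrad χ v G) := by
  refine hχ.induction_of_local
    (Q := fun χ => TestApproximable Ω (fun x => χ x * v x) (productGrad χ v G)) ?_ ?_ ?_
  · intro η _
    have h0 : gradient (0 : EuclideanSpace ℝ (Fin d) → ℝ) = 0 := by ext1 x; simp [gradient]
    have h1 : productGrad 0 v G = 0 := by ext1 x; simp [productGrad, h0]
    refine ⟨0, isTest_zero, ?_, ?_⟩
    · have : (0 : EuclideanSpace ℝ (Fin d) → ℝ) -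
        (fun x => (0 : EuclideanSpace ℝ (Fin d) → ℝ) x * v x) = 0 := by ext x; simp
      rw [this, eLpNorm_zero]; exact zero_le
    · rw [h0, h1, sub_zero, eLpNorm_zero]; exact zero_le
  · intro χ ψ hχ hψ h1 h2
    have h3 := TestApproximable.add (hχ.memL2_mul hv) (hψ.memL2_mul hv)
      (hχ.memL2_productGrad hv hG.1) (hψ.memL2_productGrad hv hG.1) h1 h2
    convert h3 using 1
    · ext x; simp [add_mul]
    · ext1 x
      simp only [productGrad, Pi.add_apply, gradient_add' hχ.differentiable hψ.differentiable,
        add_smul, smul_add]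
      abel
  · intro x
    by_cases hxΓ : x ∈ frontier Ω
    · obtain ⟨e, g, K, r, hch⟩ := hLip.exists_chart hxΓ
      have hr := hch.pos
      refine ⟨Metric.ball x (r / 2), Metric.ball_mem_nhds x (by linarith), fun χ hχ hs =>
        testApproximable_mul_of_shift hΩ hv hG hχ fun δ hδ => ?_⟩
      set s := min δ r / 16 with hs_def
      have hm : 0 < min δ r := lt_min hδ hr
      have hs0 : 0 < s := by positivity
      have hK : (0 : ℝ) < K + 1 := by positivity
      have hεs : s / (K + 1) ≤ s := div_le_self hs0.le (by simp)
      have hsδ : s ≤ δ / 16 := by rw [hs_def]; gcongr; exact min_le_left _ _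
      have hsr : s ≤ r / 16 := by rw [hs_def]; gcongr; exact min_le_right _ _
      refine ⟨s • e, s / (K + 1), by positivity, ?_, fun y hy hne => ?_⟩
      · rw [norm_smul, hch.norm_eq, mul_one, Real.norm_of_nonneg hs0.le]
        linarith
      · exact hch.closedBall_subset hy hs0 (mul_div_cancel₀ _ hK.ne').le (by linarith)
          (hne.mono (inter_subset_inter_right _ hs))
    by_cases hxΩ : x ∈ Ω
    · refine ⟨Ω, hΩ.mem_nhds hxΩ, fun χ hχ hs =>
        testApproximable_mul_of_shift hΩ hv hG hχ fun δ hδ => ?_⟩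
      obtain ⟨r, hr, hsub⟩ := (show IsCompact (tsupport χ) from hχ.2).exists_cthickening_subset_open
        hΩ hs
      refine ⟨0, min δ (r / 2), by positivity, by simp, ?_⟩
      rintro y - ⟨p, hp, hpχ⟩ z hz
      rw [add_zero, Metric.mem_closedBall] at hp hz
      refine hsub (Metric.mem_cthickening_of_dist_le z p r _ hpχ ?_)
      have h1 := dist_triangle_right z p y
      have h2 := min_le_right δ (r / 2)
      linarith
    · have hxc : x ∈ (closure Ω)ᶜ := fun h => hxΓ (by rw [hΩ.frontier_eq]; exact ⟨h, hxΩ⟩)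
      refine ⟨(closure Ω)ᶜ, isClosed_closure.isOpen_compl.mem_nhds hxc, fun χ hχ hs =>
        testApproximable_mul_of_shift hΩ hv hG hχ fun δ hδ => ?_⟩
      obtain ⟨r, hr, hsub⟩ := (show IsCompact (tsupport χ) from hχ.2).exists_cthickening_subset_open
        isClosed_closure.isOpen_compl hs
      refine ⟨0, min δ r, by positivity, by simp, ?_⟩
      rintro y hy ⟨p, hp, hpχ⟩
      rw [add_zero, Metric.mem_closedBall, dist_comm] at hp
      exact absurd (subset_closure hy)
        (hsub (Metric.mem_cthickening_of_dist_le y p r _ hpχ (hp.trans (min_le_right _ _))))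

/-- Dominated convergence in `L²`. -/
lemma tendsto_eLpNorm_sub_of_dominated {A F : Type*} [MeasurableSpace A] {μ : Measure A}
    [NormedAddCommGroup F] {f : ℕ → A → F} {f' : A → F} {b : A → ℝ} (hb : MemLp b 2 μ)
    (hf : ∀ n, AEStronglyMeasurable (f n - f') μ) (hbd : ∀ n x, ‖f n x - f' x‖ ≤ b x)
    (hlim : ∀ x, Tendsto (fun n => f n x) atTop (𝓝 (f' x))) :
    Tendsto (fun n => eLpNorm (f n - f') 2 μ) atTop (𝓝 0) := by
  have h1 : Tendsto (fun n => ∫⁻ x, ‖(f n - f') x‖ₑ ^ 2 ∂μ) atTop (𝓝 (∫⁻ _, 0 ∂μ)) := by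
    refine tendsto_lintegral_of_dominated_convergence' (fun x => ‖b x‖ₑ ^ 2)
      (fun n => (hf n).enorm.pow_const 2) (fun n => ae_of_all _ fun x => ?_) ?_
      (ae_of_all _ fun x => ?_)
    · refine pow_le_pow_left' ?_ 2
      change ‖f n x - f' x‖ₑ ≤ ‖b x‖ₑ
      rw [← ofReal_norm, Real.enorm_eq_ofReal ((norm_nonneg _).trans (hbd n x))]
      exact ENNReal.ofReal_le_ofReal (hbd n x)
    · rw [← eLpNorm_two_sq]; exact (ENNReal.pow_lt_top hb.2).ne
    · have h2 : Tendsto (fun n => ‖f n x - f' x‖ₑ) atTop (𝓝 0) := by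
        have := ((hlim x).sub_const (f' x)).enorm
        simpa using this
      simpa using ENNReal.Tendsto.pow (n := 2) h2
  simp only [lintegral_zero, ← eLpNorm_two_sq] at h1
  have h3 := h1.ennrpow_const (1 / 2)
  have h4 : ∀ a : ℝ≥0∞, (a ^ 2) ^ (1 / 2 : ℝ) = a := fun a => by
    rw [← ENNReal.rpow_natCast, ← ENNReal.rpow_mul]; norm_num
  rw [ENNReal.zero_rpow_of_pos (by norm_num)] at h3
  simpa only [h4] using h3

/-- Test functions are dense in `H¹(Ω)`. -/
theorem HasWeakGrad.testApproximable {v : EuclideanSpace ℝ (Fin d) → ℝ} (hΩ : IsOpen Ω)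
    (hLip : HasLipschitzBoundary Ω)
    {G : EuclideanSpace ℝ (Fin d) → EuclideanSpace ℝ (Fin d)} (hv : MemL2 Ω v)
    (hG : HasWeakGrad Ω v G) : TestApproximable Ω v G := by
  -- cutoffs `χₙ`, equal to one on the ball of radius `n + 1`, with bounded gradients
  let b : ContDiffBump (0 : EuclideanSpace ℝ (Fin d)) := ⟨1, 2, by norm_num, by norm_num⟩
  have hb : IsTest (b : EuclideanSpace ℝ (Fin d) → ℝ) := ⟨b.contDiff, b.hasCompactSupport⟩
  set χ : ℕ → EuclideanSpace ℝ (Fin d) → ℝ := fun n x => b (((n : ℝ) + 1)⁻¹ • x) with hχdef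
  have hn0 : ∀ n : ℕ, (0 : ℝ) < (n : ℝ) + 1 := fun n => by positivity
  have hχ : ∀ n, IsTest (χ n) := fun n =>
    ⟨b.contDiff.comp (contDiff_id.const_smul _),
      b.hasCompactSupport.comp_homeomorph (Homeomorph.smulOfNeZero _ (inv_ne_zero (hn0 n).ne'))⟩
  obtain ⟨M, hM⟩ := (hb.2.fderiv ℝ).exists_bound_of_continuous
    (hb.1.continuous_fderiv (by simp))
  have hM0 : 0 ≤ M := (norm_nonneg _).trans (hM 0)
  have hgrad : ∀ n x, ‖gradient (χ n) x‖ ≤ M := fun n x => by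
    have h1 : HasFDerivAt (fun x : EuclideanSpace ℝ (Fin d) => ((n : ℝ) + 1)⁻¹ • x)
        (((n : ℝ) + 1)⁻¹ • ContinuousLinearMap.id ℝ _) x :=
      (hasFDerivAt_id x).fun_const_smul _
    have h2 := (hb.differentiable (((n : ℝ) + 1)⁻¹ • x)).hasFDerivAt.comp x h1
    have h3 : fderiv ℝ (χ n) x = ((n : ℝ) + 1)⁻¹ • fderiv ℝ b (((n : ℝ) + 1)⁻¹ • x) := by
      rw [show fderiv ℝ (χ n) x = _ from h2.fderiv]
      ext z; simp
    rw [norm_gradient, h3, norm_smul, Real.norm_of_nonneg (inv_nonneg.2 (hn0 n).le)]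
    have h4 : ((n : ℝ) + 1)⁻¹ ≤ 1 := inv_le_one_of_one_le₀ (by linarith [n.cast_nonneg (α := ℝ)])
    exact (mul_le_mul h4 (hM _) (norm_nonneg _) zero_le_one).trans (one_mul M).le
  have hev : ∀ x, ∀ᶠ n in atTop, ∀ᶠ y in 𝓝 x, χ n y = 1 := by
    intro x
    obtain ⟨N, hN⟩ := exists_nat_gt ‖x‖
    filter_upwards [eventually_ge_atTop N] with n hn
    have hlt : ‖x‖ < (n : ℝ) + 1 := by
      have : (N : ℝ) ≤ n := by exact_mod_cast hn
      linarith
    filter_upwards [(continuous_norm.tendsto x).eventually_lt_const hlt] with y hy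
    refine b.one_of_mem_closedBall ?_
    rw [mem_closedBall_zero_iff, norm_smul, Real.norm_of_nonneg (inv_nonneg.2 (hn0 n).le),
      inv_mul_le_iff₀ (hn0 n)]
    simp only [b]
    linarith
  have hχ1 : ∀ n x, |χ n x - 1| ≤ 1 := fun n x => by
    rw [abs_le]
    have h1 : 0 ≤ χ n x := b.nonneg
    have h2 : χ n x ≤ 1 := b.le_one
    constructor <;> linarith
  refine TestApproximable.of_tendsto hv hG.1 (fun n => (hχ n).memL2_mul hv)
    (fun n => (hχ n).memL2_productGrad hv hG.1)
    (fun n => testApproximable_mul hΩ hLip hv hG (hχ n)) ?_ ?_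
  · refine tendsto_eLpNorm_sub_of_dominated (b := fun x => ‖v x‖) hv.norm
      (fun n => (((hχ n).memL2_mul hv).sub hv).1) (fun n x => ?_) fun x => ?_
    · rw [← sub_one_mul, norm_mul]
      exact mul_le_of_le_one_left (norm_nonneg _) (hχ1 n x)
    · refine tendsto_const_nhds.congr' ?_
      filter_upwards [hev x] with n hn
      rw [hn.self_of_nhds, one_mul]
  · refine tendsto_eLpNorm_sub_of_dominated (b := fun x => ‖G x‖ + M * ‖v x‖)
      (hG.1.norm.add (hv.norm.const_mul M))
      (fun n => (((hχ n).memL2_productGrad hv hG.1).sub hG.1).1) (fun n x => ?_) fun x => ?_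
    · have h1 : productGrad (χ n) v G x - G x = (χ n x - 1) • G x + v x • gradient (χ n) x := by
        rw [productGrad, sub_smul, one_smul]; abel
      rw [h1]
      refine (norm_add_le _ _).trans (add_le_add ?_ ?_)
      · rw [norm_smul]
        exact mul_le_of_le_one_left (norm_nonneg _) (hχ1 n x)
      · rw [norm_smul, mul_comm]
        exact mul_le_mul_of_nonneg_right (hgrad n x) (norm_nonneg _)
    · refine tendsto_const_nhds.congr' ?_
      filter_upwards [hev x] with n hn
      have h1 : gradient (χ n) x = 0 := by
        have h2 : χ n =ᶠ[𝓝 x] fun _ => 1 := hn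
        rw [gradient, h2.fderiv_eq]
        simp
      rw [productGrad, hn.self_of_nhds, h1, one_smul, smul_zero, add_zero]

end Density

/-! ### Weak gradients and weak divergences -/

section Weak

open Set
open scoped NNReal ENNReal

variable {d : ℕ} {Ω : Set (EuclideanSpace ℝ (Fin d))}

/-- `MemLp.integrable_mul`, stated for the pointwise product. -/
lemma _root_.MeasureTheory.MemLp.integrable_fun_mul {A : Type*} [MeasurableSpace A]
    {μ : Measure A} {f g : A → ℝ} (hf : MemLp f 2 μ) (hg : MemLp g 2 μ) :
    Integrable (fun x => f x * g x) μ := hf.integrable_mul hg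

lemma integrable_inner_of_memLp {A F : Type*} [MeasurableSpace A] {μ : Measure A}
    [NormedAddCommGroup F] [InnerProductSpace ℝ F] {f g : A → F}
    (hf : MemLp f 2 μ) (hg : MemLp g 2 μ) : Integrable (fun x => inner ℝ (f x) (g x)) μ := by
  refine (L2.integrable_inner (𝕜 := ℝ) (hf.toLp f) (hg.toLp g)).congr ?_
  filter_upwards [hf.coeFn_toLp, hg.coeFn_toLp] with x hx hx'
  rw [hx, hx']

/-- Two square integrable functions that agree when tested against test functions supported in `Ω`
agree almost everywhere on `Ω`. -/
lemma ae_eq_of_setIntegral_mul_eq (hΩ : IsOpen Ω) {f g : EuclideanSpace ℝ (Fin d) → ℝ}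
    (hf : MemL2 Ω f) (hg : MemL2 Ω g)
    (h : ∀ θ, IsTest θ → tsupport θ ⊆ Ω → ∫ x in Ω, f x * θ x = ∫ x in Ω, g x * θ x) :
    f =ᵐ[volume.restrict Ω] g := by
  have h1 : ∀ᵐ x ∂volume.restrict Ω, x ∈ Ω → (f - g) x = 0 := by
    refine hΩ.ae_eq_zero_of_integral_contDiff_smul_eq_zero
      ((hf.sub hg).locallyIntegrable (by norm_num) |>.locallyIntegrableOn _)
      fun θ hθ hc hs => ?_
    have hθt : IsTest θ := ⟨hθ, hc⟩
    have h2 : ∀ x, θ x • (f - g) x = f x * θ x - g x * θ x := fun x => by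
      simp only [Pi.sub_apply, smul_eq_mul]; ring
    simp only [h2]
    rw [integral_sub (hf.integrable_fun_mul (hθt.memLp _ (p := 2)))
      (hg.integrable_fun_mul (hθt.memLp _ (p := 2))), h θ hθt hs, sub_self]
  filter_upwards [h1, ae_restrict_mem hΩ.measurableSet] with x hx hxΩ
  exact sub_eq_zero.1 (hx hxΩ)

lemma HasWeakGrad.ae_eq (hΩ : IsOpen Ω) {v : EuclideanSpace ℝ (Fin d) → ℝ}
    {G G' : EuclideanSpace ℝ (Fin d) → EuclideanSpace ℝ (Fin d)} (h : HasWeakGrad Ω v G)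
    (h' : HasWeakGrad Ω v G') : G =ᵐ[volume.restrict Ω] G' := by
  have h1 : ∀ i, (fun x => G x i) =ᵐ[volume.restrict Ω] fun x => G' x i := fun i =>
    ae_eq_of_setIntegral_mul_eq hΩ (h.1.apply i) (h'.1.apply i) fun θ hθ hs => by
      rw [h.setIntegral_apply_mul hθ hs, h'.setIntegral_apply_mul hθ hs]
  filter_upwards [ae_all_iff.2 h1] with x hx
  ext i
  exact hx i

lemma HasWeakDiv.ae_eq (hΩ : IsOpen Ω) {ψ : EuclideanSpace ℝ (Fin d) → EuclideanSpace ℝ (Fin d)}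
    {δ δ' : EuclideanSpace ℝ (Fin d) → ℝ} (h : HasWeakDiv Ω ψ δ) (h' : HasWeakDiv Ω ψ δ') :
    δ =ᵐ[volume.restrict Ω] δ' :=
  ae_eq_of_setIntegral_mul_eq hΩ h.1 h'.1 fun θ hθ hs => by rw [h.2 θ hθ hs, h'.2 θ hθ hs]

lemma MemH1.hasWeakGrad {v : EuclideanSpace ℝ (Fin d) → ℝ} (h : MemH1 Ω v) :
    HasWeakGrad Ω v (weakGrad Ω v) := by
  rw [weakGrad, dif_pos h.2]
  exact h.2.choose_spec

lemma HasWeakDiv.hasWeakDiv_weakDiv {ψ : EuclideanSpace ℝ (Fin d) → EuclideanSpace ℝ (Fin d)}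
    {δ : EuclideanSpace ℝ (Fin d) → ℝ} (h : HasWeakDiv Ω ψ δ) :
    HasWeakDiv Ω ψ (weakDiv Ω ψ) := by
  have hex : ∃ δ, HasWeakDiv Ω ψ δ := ⟨δ, h⟩
  rw [weakDiv, dif_pos hex]
  exact hex.choose_spec

lemma IsTest.classicalDiv_eq {φ : EuclideanSpace ℝ (Fin d) → EuclideanSpace ℝ (Fin d)}
    (h : IsTest φ) (x : EuclideanSpace ℝ (Fin d)) :
    classicalDiv φ x = ∑ i, fderiv ℝ (fun y => φ y i) x (EuclideanSpace.single i 1) := by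
  refine Finset.sum_congr rfl fun i _ => ?_
  have h1 := (EuclideanSpace.proj (𝕜 := ℝ) i).hasFDerivAt.comp x (h.differentiable x).hasFDerivAt
  rw [show fderiv ℝ (fun y => φ y i) x = _ from h1.fderiv]
  rfl

lemma IsTest.classicalDiv {φ : EuclideanSpace ℝ (Fin d) → EuclideanSpace ℝ (Fin d)}
    (h : IsTest φ) : IsTest (classicalDiv φ) := by
  have h1 : RobinModel.classicalDiv φ
      = fun x => ∑ i, fderiv ℝ (fun y => φ y i) x (EuclideanSpace.single i 1) :=
    funext h.classicalDiv_eq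
  have h2 : ∀ s : Finset (Fin d), IsTest fun x =>
      ∑ i ∈ s, fderiv ℝ (fun y => φ y i) x (EuclideanSpace.single i 1) := by
    classical
    intro s
    induction s using Finset.induction_on with
    | empty => simp only [Finset.sum_empty]; exact isTest_zero
    | insert i s hi ih =>
      simp only [Finset.sum_insert hi]
      exact ((h.comp_apply i).fderiv_apply _).add ih
  rw [h1]
  exact h2 _

lemma HasWeakGrad.sub {v v' : EuclideanSpace ℝ (Fin d) → ℝ}
    {G G' : EuclideanSpace ℝ (Fin d) → EuclideanSpace ℝ (Fin d)} (hv : MemL2 Ω v)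
    (hv' : MemL2 Ω v') (h : HasWeakGrad Ω v G) (h' : HasWeakGrad Ω v' G') :
    HasWeakGrad Ω (v - v') (G - G') := by
  refine ⟨h.1.sub h'.1, fun φ hφ hs => ?_⟩
  simp only [Pi.sub_apply, inner_sub_left, sub_mul]
  have hi : ∀ {G : EuclideanSpace ℝ (Fin d) → EuclideanSpace ℝ (Fin d)}, MemL2 Ω G →
      Integrable (fun x => inner ℝ (G x) (φ x)) (volume.restrict Ω) := fun hG =>
    integrable_inner_of_memLp hG (hφ.memLp _)
  have hd : ∀ {v : EuclideanSpace ℝ (Fin d) → ℝ}, MemL2 Ω v →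
      Integrable (fun x => v x * RobinModel.classicalDiv φ x) (volume.restrict Ω) := fun hv =>
    hv.integrable_fun_mul (hφ.classicalDiv.memLp _ (p := 2))
  rw [integral_sub (hi h.1) (hi h'.1), integral_sub (hd hv) (hd hv'), h.2 φ hφ hs, h'.2 φ hφ hs]
  ring

lemma HasWeakDiv.sub {ψ ψ' : EuclideanSpace ℝ (Fin d) → EuclideanSpace ℝ (Fin d)}
    {δ δ' : EuclideanSpace ℝ (Fin d) → ℝ} (hψ : MemL2 Ω ψ) (hψ' : MemL2 Ω ψ')
    (h : HasWeakDiv Ω ψ δ) (h' : HasWeakDiv Ω ψ' δ') : HasWeakDiv Ω (ψ - ψ') (δ - δ') := by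
  refine ⟨h.1.sub h'.1, fun φ hφ hs => ?_⟩
  simp only [Pi.sub_apply, inner_sub_left, sub_mul]
  have hi : ∀ {G : EuclideanSpace ℝ (Fin d) → EuclideanSpace ℝ (Fin d)}, MemL2 Ω G →
      Integrable (fun x => inner ℝ (G x) (gradient φ x)) (volume.restrict Ω) := fun hG =>
    integrable_inner_of_memLp hG (hφ.memLp_gradient _)
  have hd : ∀ {v : EuclideanSpace ℝ (Fin d) → ℝ}, MemL2 Ω v →
      Integrable (fun x => v x * φ x) (volume.restrict Ω) := fun hv =>
    hv.integrable_fun_mul (hφ.memLp _ (p := 2))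
  rw [integral_sub (hi hψ) (hi hψ'), integral_sub (hd h.1) (hd h'.1), h.2 φ hφ hs, h'.2 φ hφ hs]
  ring

lemma MemH1.sub {v v' : EuclideanSpace ℝ (Fin d) → ℝ} (h : MemH1 Ω v) (h' : MemH1 Ω v') :
    MemH1 Ω (v - v') :=
  ⟨h.1.sub h'.1, _, h.hasWeakGrad.sub h.1 h'.1 h'.hasWeakGrad⟩

lemma MemH1Vec.sub {ψ ψ' : EuclideanSpace ℝ (Fin d) → EuclideanSpace ℝ (Fin d)}
    (h : MemH1Vec Ω ψ) (h' : MemH1Vec Ω ψ') : MemH1Vec Ω (ψ - ψ') := fun i => (h i).sub (h' i)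

lemma MemH1Vec.memL2 {ψ : EuclideanSpace ℝ (Fin d) → EuclideanSpace ℝ (Fin d)}
    (h : MemH1Vec Ω ψ) : MemL2 Ω ψ := by
  have h1 : ψ = fun x => ∑ i, ψ x i • EuclideanSpace.single i (1 : ℝ) := by
    ext x j
    simp [Pi.single_apply]
  rw [h1]
  refine memLp_finsetSum _ fun i _ => ?_
  exact (ContinuousLinearMap.toSpanSingleton ℝ
    (EuclideanSpace.single i (1 : ℝ))).comp_memLp' (h i).1

lemma inner_eq_sum (x y : EuclideanSpace ℝ (Fin d)) : inner ℝ x y = ∑ i, x i * y i := by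
  simp [PiLp.inner_apply, mul_comm]

/-- The weak divergence of a field with components in `H¹(Ω)`. -/
lemma MemH1Vec.hasWeakDiv {ψ : EuclideanSpace ℝ (Fin d) → EuclideanSpace ℝ (Fin d)}
    (h : MemH1Vec Ω ψ) : HasWeakDiv Ω ψ fun x => ∑ i, weakGrad Ω (fun y => ψ y i) x i := by
  refine ⟨memLp_finsetSum _ fun i _ => (h i).hasWeakGrad.1.apply i, fun φ hφ hs => ?_⟩
  simp only [Finset.sum_mul, inner_eq_sum, gradient_apply]
  rw [integral_finsetSum _ fun i _ =>
      ((h i).hasWeakGrad.1.apply i).integrable_fun_mul (hφ.memLp _ (p := 2)),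
    integral_finsetSum _ fun i _ =>
      (h i).1.integrable_fun_mul ((hφ.fderiv_apply _).memLp _ (p := 2)), ← Finset.sum_neg_distrib]
  exact Finset.sum_congr rfl fun i _ => (h i).hasWeakGrad.setIntegral_apply_mul hφ hs i

end Weak

/-! ### Traces and Green's formula -/

section Traces

open Set
open scoped NNReal ENNReal

variable {d : ℕ} {Ω : Set (EuclideanSpace ℝ (Fin d))}

/-- `L²` pairings are continuous. -/
lemma tendsto_integral_inner {A F : Type*} [MeasurableSpace A] {μ : Measure A}
    [NormedAddCommGroup F] [InnerProductSpace ℝ F] {a b : ℕ → A → F} {a' b' : A → F}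
    (ha : ∀ n, MemLp (a n) 2 μ) (ha' : MemLp a' 2 μ) (hb : ∀ n, MemLp (b n) 2 μ)
    (hb' : MemLp b' 2 μ) (hta : Tendsto (fun n => eLpNorm (a n - a') 2 μ) atTop (𝓝 0))
    (htb : Tendsto (fun n => eLpNorm (b n - b') 2 μ) atTop (𝓝 0)) :
    Tendsto (fun n => ∫ x, inner ℝ (a n x) (b n x) ∂μ) atTop (𝓝 (∫ x, inner ℝ (a' x) (b' x) ∂μ)) := by
  have h1 : Tendsto (fun n => (ha n).toLp (a n)) atTop (𝓝 (ha'.toLp a')) :=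
    (Lp.tendsto_Lp_iff_tendsto_eLpNorm'' _ ha _ ha').2 hta
  have h2 : Tendsto (fun n => (hb n).toLp (b n)) atTop (𝓝 (hb'.toLp b')) :=
    (Lp.tendsto_Lp_iff_tendsto_eLpNorm'' _ hb _ hb').2 htb
  have h3 := h1.inner (𝕜 := ℝ) h2
  have h4 : ∀ {f g : A → F} (hf : MemLp f 2 μ) (hg : MemLp g 2 μ),
      inner ℝ (hf.toLp f) (hg.toLp g) = ∫ x, inner ℝ (f x) (g x) ∂μ := fun hf hg => by
    rw [L2.inner_def]
    refine integral_congr_ae ?_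
    filter_upwards [hf.coeFn_toLp, hg.coeFn_toLp] with x hx hx'
    rw [hx, hx']
  simpa only [h4] using h3

lemma tendsto_integral_mul {A : Type*} [MeasurableSpace A] {μ : Measure A}
    {a b : ℕ → A → ℝ} {a' b' : A → ℝ}
    (ha : ∀ n, MemLp (a n) 2 μ) (ha' : MemLp a' 2 μ) (hb : ∀ n, MemLp (b n) 2 μ)
    (hb' : MemLp b' 2 μ) (hta : Tendsto (fun n => eLpNorm (a n - a') 2 μ) atTop (𝓝 0))
    (htb : Tendsto (fun n => eLpNorm (b n - b') 2 μ) atTop (𝓝 0)) :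
    Tendsto (fun n => ∫ x, a n x * b n x ∂μ) atTop (𝓝 (∫ x, a' x * b' x ∂μ)) := by
  simpa [mul_comm] using tendsto_integral_inner ha ha' hb hb' hta htb

lemma tendsto_eLpNorm_apply {μ : Measure (EuclideanSpace ℝ (Fin d))}
    {a : ℕ → EuclideanSpace ℝ (Fin d) → EuclideanSpace ℝ (Fin d)}
    {a' : EuclideanSpace ℝ (Fin d) → EuclideanSpace ℝ (Fin d)}
    (h : Tendsto (fun n => eLpNorm (a n - a') 2 μ) atTop (𝓝 0)) (i : Fin d) :
    Tendsto (fun n => eLpNorm ((fun x => a n x i) - fun x => a' x i) 2 μ) atTop (𝓝 0) := by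
  refine tendsto_of_tendsto_of_tendsto_of_le_of_le tendsto_const_nhds h (fun _ => zero_le)
    fun n => eLpNorm_mono fun x => ?_
  exact PiLp.norm_apply_le (a n x - a' x) i

lemma MemH1.exists_tendstoH1 (hΩ : IsOpen Ω) (hLip : HasLipschitzBoundary Ω)
    {v : EuclideanSpace ℝ (Fin d) → ℝ} (hv : MemH1 Ω v) :
    ∃ φ : ℕ → EuclideanSpace ℝ (Fin d) → ℝ, (∀ k, IsTest (φ k)) ∧ TendstoH1 Ω φ v := by
  have h := hv.hasWeakGrad.testApproximable hΩ hLip hv.1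
  choose φ hφ h1 h2 using fun n : ℕ => h ((n : ℝ≥0∞) + 1)⁻¹ (by simp)
  have ht : Tendsto (fun n : ℕ => ((n : ℝ≥0∞) + 1)⁻¹) atTop (𝓝 0) := by
    have := (tendsto_add_atTop_iff_nat 1).2 ENNReal.tendsto_inv_nat_nhds_zero
    simpa using this
  exact ⟨φ, hφ, tendsto_of_tendsto_of_tendsto_of_le_of_le tendsto_const_nhds ht
    (fun _ => zero_le) h1, tendsto_of_tendsto_of_tendsto_of_le_of_le tendsto_const_nhds ht
    (fun _ => zero_le) h2⟩

/-- The trace inequality controls the boundary distance of two test functions by their distances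
to a common element of `H¹(Ω)`. -/
lemma eLpNorm_sub_surfaceMeasure_le {C : ℝ≥0}
    (hC : ∀ φ : EuclideanSpace ℝ (Fin d) → ℝ, IsTest φ → eLpNorm φ 2 (surfaceMeasure Ω)
      ≤ C * (eLpNorm φ 2 (volume.restrict Ω) + eLpNorm (gradient φ) 2 (volume.restrict Ω)))
    {v : EuclideanSpace ℝ (Fin d) → ℝ} (hv : MemH1 Ω v)
    {φ ψ : EuclideanSpace ℝ (Fin d) → ℝ} (hφ : IsTest φ) (hψ : IsTest ψ) :
    eLpNorm (φ - ψ) 2 (surfaceMeasure Ω) ≤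
      C * (eLpNorm (φ - v) 2 (volume.restrict Ω)
        + eLpNorm (gradient φ - weakGrad Ω v) 2 (volume.restrict Ω)) +
      C * (eLpNorm (ψ - v) 2 (volume.restrict Ω)
        + eLpNorm (gradient ψ - weakGrad Ω v) 2 (volume.restrict Ω)) := by
  refine (hC _ (hφ.sub hψ)).trans ?_
  rw [← mul_add]
  refine mul_le_mul_right ?_ _
  rw [add_add_add_comm, gradient_sub' hφ.differentiable hψ.differentiable]
  refine add_le_add ?_ ?_
  · rw [← sub_sub_sub_cancel_right φ ψ v]
    exact eLpNorm_sub_le ((hφ.memLp _ (p := 2)).sub hv.1).1 ((hψ.memLp _ (p := 2)).sub hv.1).1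
      (by norm_num)
  · rw [← sub_sub_sub_cancel_right (gradient φ) (gradient ψ) (weakGrad Ω v)]
    exact eLpNorm_sub_le ((hφ.memLp_gradient _ (p := 2)).sub hv.hasWeakGrad.1).1
      ((hψ.memLp_gradient _ (p := 2)).sub hv.hasWeakGrad.1).1 (by norm_num)

lemma TendstoH1.tendsto_bound {φ : ℕ → EuclideanSpace ℝ (Fin d) → ℝ}
    {v : EuclideanSpace ℝ (Fin d) → ℝ} (h : TendstoH1 Ω φ v) (C : ℝ≥0) :
    Tendsto (fun k => (C : ℝ≥0∞) * (eLpNorm (φ k - v) 2 (volume.restrict Ω)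
      + eLpNorm (gradient (φ k) - weakGrad Ω v) 2 (volume.restrict Ω))) atTop (𝓝 0) := by
  simpa using ENNReal.Tendsto.const_mul (h.1.add h.2) (Or.inr ENNReal.coe_ne_top)

/-- Every function in `H¹(Ω)` has a trace. -/
theorem MemH1.exists_isTrace (hΩ : IsOpen Ω) (hΓ : IsCompact (frontier Ω))
    (hLip : HasLipschitzBoundary Ω) {v : EuclideanSpace ℝ (Fin d) → ℝ} (hv : MemH1 Ω v) :
    ∃ t, IsTrace Ω v t := by
  have := isFiniteMeasure_surfaceMeasure hΓ hLip
  obtain ⟨C, hC⟩ := exists_trace_bound hΩ hΓ hLip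
  obtain ⟨φ, hφ, hlim⟩ := hv.exists_tendstoH1 hΩ hLip
  have hm : ∀ k, MemLp (φ k) 2 (surfaceMeasure Ω) := fun k => (hφ k).memLp _
  have hcauchy : CauchySeq fun k => (hm k).toLp (φ k) := by
    refine EMetric.cauchySeq_iff.2 fun ε hε => ?_
    have hε2 : 0 < ε / 2 := ENNReal.half_pos hε.ne'
    obtain ⟨N, hN⟩ := eventually_atTop.1 ((hlim.tendsto_bound C).eventually_lt_const hε2)
    refine ⟨N, fun k hk l hl => ?_⟩
    rw [Lp.edist_toLp_toLp]
    refine (eLpNorm_sub_surfaceMeasure_le hC hv (hφ k) (hφ l)).trans_lt ?_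
    exact (ENNReal.add_lt_add (hN k hk) (hN l hl)).trans_eq (ENNReal.add_halves ε)
  obtain ⟨t, ht⟩ := cauchySeq_tendsto_of_complete hcauchy
  refine ⟨t, Lp.memLp t, φ, hφ, hlim, ?_⟩
  have h1 := (Lp.tendsto_Lp_iff_tendsto_eLpNorm' _ _).1 ht
  refine h1.congr fun k => eLpNorm_congr_ae ?_
  filter_upwards [(hm k).coeFn_toLp] with x hx
  simp only [Pi.sub_apply, hx]

lemma MemH1.isTrace_trace (hΩ : IsOpen Ω) (hΓ : IsCompact (frontier Ω))
    (hLip : HasLipschitzBoundary Ω) {v : EuclideanSpace ℝ (Fin d) → ℝ} (hv : MemH1 Ω v) :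
    IsTrace Ω v (trace Ω v) := by
  have h := hv.exists_isTrace hΩ hΓ hLip
  rw [trace, dif_pos h]
  exact h.choose_spec

/-- Boundary values of any sequence of test functions converging in `H¹(Ω)` converge to the
trace. -/
lemma IsTrace.tendsto (hΩ : IsOpen Ω) (hΓ : IsCompact (frontier Ω))
    (hLip : HasLipschitzBoundary Ω) {v t : EuclideanSpace ℝ (Fin d) → ℝ} (hv : MemH1 Ω v)
    (ht : IsTrace Ω v t) {φ : ℕ → EuclideanSpace ℝ (Fin d) → ℝ} (hφ : ∀ k, IsTest (φ k))
    (hlim : TendstoH1 Ω φ v) :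
    Tendsto (fun k => eLpNorm (φ k - t) 2 (surfaceMeasure Ω)) atTop (𝓝 0) := by
  have := isFiniteMeasure_surfaceMeasure hΓ hLip
  obtain ⟨C, hC⟩ := exists_trace_bound hΩ hΓ hLip
  obtain ⟨htm, ψ, hψ, hψlim, hψt⟩ := ht
  have h1 := ((hlim.tendsto_bound C).add (hψlim.tendsto_bound C)).add hψt
  simp only [add_zero] at h1
  refine tendsto_of_tendsto_of_tendsto_of_le_of_le tendsto_const_nhds h1 (fun _ => zero_le)
    fun k => ?_
  rw [← sub_add_sub_cancel (φ k) (ψ k) t]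
  refine (eLpNorm_add_le (((hφ k).memLp _ (p := 2)).sub ((hψ k).memLp _)).1
    (((hψ k).memLp _ (p := 2)).sub htm).1 (by norm_num)).trans ?_
  exact add_le_add (eLpNorm_sub_surfaceMeasure_le hC hv (hφ k) (hψ k)) le_rfl

/-- The `i`-th component of the normal. -/
lemma inner_single_outwardNormal (i : Fin d) (x : EuclideanSpace ℝ (Fin d)) :
    inner ℝ (EuclideanSpace.single i (1 : ℝ)) (outwardNormal Ω x) = outwardNormal Ω x i := by
  simp [EuclideanSpace.inner_single_left]

lemma abs_outwardNormal_apply_le (Ω : Set (EuclideanSpace ℝ (Fin d)))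
    (x : EuclideanSpace ℝ (Fin d)) (i : Fin d) : |outwardNormal Ω x i| ≤ 1 :=
  (PiLp.norm_apply_le _ i).trans (norm_outwardNormal_le Ω x)

lemma memLp_outwardNormal_mul (hΓ : IsCompact (frontier Ω)) (hLip : HasLipschitzBoundary Ω)
    {t : EuclideanSpace ℝ (Fin d) → ℝ} (ht : MemLp t 2 (surfaceMeasure Ω)) (i : Fin d) :
    MemLp (fun x => outwardNormal Ω x i * t x) 2 (surfaceMeasure Ω) := by
  have h1 : AEStronglyMeasurable (fun x => outwardNormal Ω x i) (surfaceMeasure Ω) :=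
    (EuclideanSpace.proj (𝕜 := ℝ) i).continuous.comp_aestronglyMeasurable
      (aestronglyMeasurable_outwardNormal hΓ hLip)
  have h2 : MemLp (fun x => outwardNormal Ω x i) ⊤ (surfaceMeasure Ω) :=
    memLp_top_of_bound h1 1 (ae_of_all _ fun x => abs_outwardNormal_apply_le Ω x i)
  exact ht.mul h2

/-- Green's formula for a pair of test functions. -/
lemma green_test (hΩ : IsOpen Ω) (hΓ : IsCompact (frontier Ω)) (hLip : HasLipschitzBoundary Ω)
    {φ ψ : EuclideanSpace ℝ (Fin d) → ℝ} (hφ : IsTest φ) (hψ : IsTest ψ) (i : Fin d) :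
    (∫ x in Ω, φ x * gradient ψ x i) + ∫ x in Ω, gradient φ x i * ψ x
      = ∫ x, φ x * (outwardNormal Ω x i * ψ x) ∂surfaceMeasure Ω := by
  have h := setIntegral_fderiv_eq_boundary hΩ hΓ hLip (IsTest.mul hφ.1 hψ)
    (EuclideanSpace.single i 1)
  simp only [inner_single_outwardNormal] at h
  have h1 : ∀ x, fderiv ℝ (fun x => φ x * ψ x) x (EuclideanSpace.single i 1)
      = φ x * gradient ψ x i + gradient φ x i * ψ x := fun x => by
    rw [fderiv_fun_mul (hφ.differentiable x) (hψ.differentiable x)]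
    simp only [add_apply, smul_apply, smul_eq_mul, gradient_apply]
    ring
  simp only [h1] at h
  have hg : ∀ {φ : EuclideanSpace ℝ (Fin d) → ℝ}, IsTest φ → MemL2 Ω fun x => gradient φ x i :=
    fun hφ => MemL2.apply (hφ.memLp_gradient _) i
  rw [integral_add ((hφ.memLp _ (p := 2)).integrable_fun_mul (hg hψ))
    ((hg hφ).integrable_fun_mul (hψ.memLp _ (p := 2)))] at h
  rw [h]
  refine integral_congr_ae (ae_of_all _ fun x => ?_)
  simp only
  ring

/-- Green's formula for a pair of functions in `H¹(Ω)`. -/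
theorem green (hΩ : IsOpen Ω) (hΓ : IsCompact (frontier Ω)) (hLip : HasLipschitzBoundary Ω)
    {v w t s : EuclideanSpace ℝ (Fin d) → ℝ} (hv : MemH1 Ω v) (hw : MemH1 Ω w)
    (ht : IsTrace Ω v t) (hs : IsTrace Ω w s) (i : Fin d) :
    (∫ x in Ω, v x * weakGrad Ω w x i) + ∫ x in Ω, weakGrad Ω v x i * w x
      = ∫ x, t x * (outwardNormal Ω x i * s x) ∂surfaceMeasure Ω := by
  have := isFiniteMeasure_surfaceMeasure hΓ hLip
  obtain ⟨htm, φ, hφ, hφv, hφt⟩ := ht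
  obtain ⟨hsm, ψ, hψ, hψw, hψs⟩ := hs
  have hg : ∀ {φ : EuclideanSpace ℝ (Fin d) → ℝ}, IsTest φ → MemL2 Ω fun x => gradient φ x i :=
    fun hφ => MemL2.apply (hφ.memLp_gradient _) i
  have h1 := tendsto_integral_mul (fun k => (hφ k).memLp (volume.restrict Ω)) hv.1
    (fun k => hg (hψ k)) (hw.hasWeakGrad.1.apply i) hφv.1 (tendsto_eLpNorm_apply hψw.2 i)
  have h2 := tendsto_integral_mul (fun k => hg (hφ k)) (hv.hasWeakGrad.1.apply i)
    (fun k => (hψ k).memLp (volume.restrict Ω)) hw.1 (tendsto_eLpNorm_apply hφv.2 i) hψw.1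
  have hns : Tendsto (fun k => eLpNorm ((fun x => outwardNormal Ω x i * ψ k x)
      - fun x => outwardNormal Ω x i * s x) 2 (surfaceMeasure Ω)) atTop (𝓝 0) := by
    refine tendsto_of_tendsto_of_tendsto_of_le_of_le tendsto_const_nhds hψs (fun _ => zero_le)
      fun k => eLpNorm_mono fun x => ?_
    simp only [Pi.sub_apply]
    rw [← mul_sub, norm_mul]
    exact mul_le_of_le_one_left (norm_nonneg _) (abs_outwardNormal_apply_le Ω x i)
  have h3 := tendsto_integral_mul (fun k => (hφ k).memLp (surfaceMeasure Ω)) htm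
    (fun k => memLp_outwardNormal_mul hΓ hLip ((hψ k).memLp _) i)
    (memLp_outwardNormal_mul hΓ hLip hsm i) hφt hns
  refine tendsto_nhds_unique (h1.add h2) (h3.congr fun k => ?_)
  exact (green_test hΩ hΓ hLip (hφ k) (hψ k) i).symm

lemma memLp_normalTrace (hΩ : IsOpen Ω) (hΓ : IsCompact (frontier Ω))
    (hLip : HasLipschitzBoundary Ω) {q : EuclideanSpace ℝ (Fin d) → EuclideanSpace ℝ (Fin d)}
    (hq : MemH1Vec Ω q) : MemLp (normalTrace Ω q) 2 (surfaceMeasure Ω) :=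
  memLp_finsetSum _ fun i _ =>
    memLp_outwardNormal_mul hΓ hLip ((hq i).isTrace_trace hΩ hΓ hLip).1 i

/-- Green's formula for a function and a vector field. -/
theorem green_normalTrace (hΩ : IsOpen Ω) (hΓ : IsCompact (frontier Ω))
    (hLip : HasLipschitzBoundary Ω) {v t : EuclideanSpace ℝ (Fin d) → ℝ}
    {q : EuclideanSpace ℝ (Fin d) → EuclideanSpace ℝ (Fin d)} (hv : MemH1 Ω v)
    (ht : IsTrace Ω v t) (hq : MemH1Vec Ω q) :
    (∫ x in Ω, v x * weakDiv Ω q x) + ∫ x in Ω, inner ℝ (weakGrad Ω v x) (q x)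
      = ∫ x, t x * normalTrace Ω q x ∂surfaceMeasure Ω := by
  have htr := fun i => (hq i).isTrace_trace hΩ hΓ hLip
  have h1 : ∫ x in Ω, v x * weakDiv Ω q x
      = ∑ i, ∫ x in Ω, v x * weakGrad Ω (fun y => q y i) x i := by
    rw [← integral_finsetSum _ fun i _ => hv.1.integrable_fun_mul ((hq i).hasWeakGrad.1.apply i)]
    refine integral_congr_ae ?_
    filter_upwards [hq.hasWeakDiv.hasWeakDiv_weakDiv.ae_eq hΩ hq.hasWeakDiv] with x hx
    rw [hx, Finset.mul_sum]
  have h2 : ∫ x in Ω, inner ℝ (weakGrad Ω v x) (q x)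
      = ∑ i, ∫ x in Ω, weakGrad Ω v x i * q x i := by
    rw [← integral_finsetSum _ fun i _ => (hv.hasWeakGrad.1.apply i).integrable_fun_mul (hq i).1]
    simp only [inner_eq_sum]
  have h3 : ∫ x, t x * normalTrace Ω q x ∂surfaceMeasure Ω
      = ∑ i, ∫ x, t x * (outwardNormal Ω x i * trace Ω (fun y => q y i) x) ∂surfaceMeasure Ω := by
    rw [← integral_finsetSum _ fun i _ =>
      ht.1.integrable_fun_mul (memLp_outwardNormal_mul hΓ hLip (htr i).1 i)]
    simp only [normalTrace, Finset.mul_sum]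
  rw [h1, h2, h3, ← Finset.sum_add_distrib]
  exact Finset.sum_congr rfl fun i _ => green hΩ hΓ hLip hv (hq i) ht (htr i) i

lemma SupportAwayFrom.eq_zero {F : Type*} [Zero F] {φ : EuclideanSpace ℝ (Fin d) → F}
    {S : Set (EuclideanSpace ℝ (Fin d))} (h : SupportAwayFrom φ S) {x : EuclideanSpace ℝ (Fin d)}
    (hx : x ∈ S) : φ x = 0 := by
  obtain ⟨δ, hδ, h⟩ := h
  by_contra hne
  have := h x (subset_tsupport φ hne) x hx
  rw [dist_self] at this
  linarith

/-- The trace of a function in `H¹_S(Ω)` vanishes on `S`. -/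
theorem MemH1Vanishing.ae_trace_eq_zero (hΩ : IsOpen Ω) (hΓ : IsCompact (frontier Ω))
    (hLip : HasLipschitzBoundary Ω) {S : Set (EuclideanSpace ℝ (Fin d))} (hS : MeasurableSet S)
    {v : EuclideanSpace ℝ (Fin d) → ℝ} (hv : MemH1Vanishing Ω S v) :
    ∀ᵐ x ∂surfaceMeasure Ω, x ∈ S → trace Ω v x = 0 := by
  obtain ⟨hv1, φ, hφ, hlim⟩ := hv
  have ht := hv1.isTrace_trace hΩ hΓ hLip
  have h1 := ht.tendsto hΩ hΓ hLip hv1 (fun k => (hφ k).1) hlim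
  have h2 : ∀ k, eLpNorm (trace Ω v) 2 ((surfaceMeasure Ω).restrict S)
      ≤ eLpNorm (φ k - trace Ω v) 2 (surfaceMeasure Ω) := fun k => by
    refine le_trans (le_of_eq ?_) (eLpNorm_mono_measure _ (Measure.restrict_le_self (s := S)))
    rw [← eLpNorm_neg]
    refine eLpNorm_congr_ae ?_
    filter_upwards [ae_restrict_mem hS] with x hx
    simp [(hφ k).2.eq_zero hx]
  have h3 : eLpNorm (trace Ω v) 2 ((surfaceMeasure Ω).restrict S) = 0 :=
    le_antisymm (ge_of_tendsto' h1 h2) zero_le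
  rw [eLpNorm_eq_zero_iff ht.1.1.restrict two_ne_zero] at h3
  exact (ae_restrict_iff' hS).1 h3

/-- The classical gradient of a test function is its weak gradient: Green's formula has no boundary
term against fields supported in `Ω`. -/
lemma IsTest.hasWeakGrad_gradient (hΩ : IsOpen Ω) (hΓ : IsCompact (frontier Ω))
    (hLip : HasLipschitzBoundary Ω) {θ : EuclideanSpace ℝ (Fin d) → ℝ} (hθ : IsTest θ) :
    HasWeakGrad Ω θ (gradient θ) := by
  refine ⟨hθ.memLp_gradient _, fun φ hφ hs => ?_⟩
  have hi := fun i => hφ.comp_apply i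
  have h0 : ∀ i, ∫ x, θ x * (outwardNormal Ω x i * φ x i) ∂surfaceMeasure Ω = 0 := fun i => by
    rw [← surfaceMeasure_restrict_frontier]
    refine (setIntegral_congr_fun isClosed_frontier.measurableSet
      (g := fun _ => (0 : ℝ)) fun z hz => ?_).trans (by simp)
    have hz' : z ∉ tsupport φ := fun h => by
      rw [hΩ.frontier_eq] at hz
      exact hz.2 (hs h)
    simp [image_eq_zero_of_notMem_tsupport hz']
  simp only [inner_eq_sum, hφ.classicalDiv_eq, Finset.mul_sum, ← gradient_apply]
  rw [integral_finsetSum _ fun i _ =>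
      (MemL2.apply (hθ.memLp_gradient _) i).integrable_fun_mul ((hi i).memLp _ (p := 2)),
    integral_finsetSum _ fun i _ =>
      (hθ.memLp _ (p := 2)).integrable_fun_mul (MemL2.apply ((hi i).memLp_gradient _) i),
    ← Finset.sum_neg_distrib]
  refine Finset.sum_congr rfl fun i _ => ?_
  have := green_test hΩ hΓ hLip hθ (hi i) i
  rw [h0 i] at this
  linarith

lemma IsTest.memH1 (hΩ : IsOpen Ω) (hΓ : IsCompact (frontier Ω))
    (hLip : HasLipschitzBoundary Ω) {θ : EuclideanSpace ℝ (Fin d) → ℝ} (hθ : IsTest θ) :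
    MemH1 Ω θ := ⟨hθ.memLp _, _, hθ.hasWeakGrad_gradient hΩ hΓ hLip⟩

lemma IsTest.weakGrad_ae_eq (hΩ : IsOpen Ω) (hΓ : IsCompact (frontier Ω))
    (hLip : HasLipschitzBoundary Ω) {θ : EuclideanSpace ℝ (Fin d) → ℝ} (hθ : IsTest θ) :
    weakGrad Ω θ =ᵐ[volume.restrict Ω] gradient θ :=
  (hθ.memH1 hΩ hΓ hLip).hasWeakGrad.ae_eq hΩ (hθ.hasWeakGrad_gradient hΩ hΓ hLip)

lemma IsTest.isTrace_self (hΩ : IsOpen Ω) (hΓ : IsCompact (frontier Ω))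
    (hLip : HasLipschitzBoundary Ω) {θ : EuclideanSpace ℝ (Fin d) → ℝ} (hθ : IsTest θ) :
    IsTrace Ω θ θ := by
  have := isFiniteMeasure_surfaceMeasure hΓ hLip
  refine ⟨hθ.memLp _, fun _ => θ, fun _ => hθ, ⟨by simp, ?_⟩, by simp⟩
  have h : eLpNorm (gradient θ - weakGrad Ω θ) 2 (volume.restrict Ω) = 0 := by
    rw [eLpNorm_congr_ae (g := 0), eLpNorm_zero]
    filter_upwards [hθ.weakGrad_ae_eq hΩ hΓ hLip] with x hx
    simp [hx]
  simp [h]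

/-- Green's formula for a test function and a test field, in terms of the classical divergence. -/
lemma green_test_classicalDiv (hΩ : IsOpen Ω) (hΓ : IsCompact (frontier Ω))
    (hLip : HasLipschitzBoundary Ω) {θ : EuclideanSpace ℝ (Fin d) → ℝ}
    {φ : EuclideanSpace ℝ (Fin d) → EuclideanSpace ℝ (Fin d)} (hθ : IsTest θ) (hφ : IsTest φ) :
    (∫ x in Ω, θ x * classicalDiv φ x) + ∫ x in Ω, inner ℝ (gradient θ x) (φ x)
      = ∑ i, ∫ x, θ x * (outwardNormal Ω x i * φ x i) ∂surfaceMeasure Ω := by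
  have hi := fun i => hφ.comp_apply i
  simp only [inner_eq_sum, hφ.classicalDiv_eq, Finset.mul_sum, ← gradient_apply]
  rw [integral_finsetSum _ fun i _ =>
      (MemL2.apply (hθ.memLp_gradient _) i).integrable_fun_mul ((hi i).memLp _ (p := 2)),
    integral_finsetSum _ fun i _ =>
      (hθ.memLp _ (p := 2)).integrable_fun_mul (MemL2.apply ((hi i).memLp_gradient _) i),
    ← Finset.sum_add_distrib]
  exact Finset.sum_congr rfl fun i _ => green_test hΩ hΓ hLip hθ (hi i) i

/-- If `q ∈ D_S(Ω)` has components in `H¹(Ω)`, then its normal trace vanishes on every relatively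
open part of the boundary that is contained in `S`: Green's formula against test functions
supported near that part has no boundary term, because it has none along an approximating
sequence. -/
theorem MemDVanishing.ae_normalTrace_eq_zero (hΩ : IsOpen Ω) (hΓ : IsCompact (frontier Ω))
    (hLip : HasLipschitzBoundary Ω) {S U : Set (EuclideanSpace ℝ (Fin d))} (hU : IsOpen U)
    (hUS : U ∩ frontier Ω ⊆ S)
    {q : EuclideanSpace ℝ (Fin d) → EuclideanSpace ℝ (Fin d)} (hq : MemDVanishing Ω S q)
    (hq1 : MemH1Vec Ω q) :
    ∀ᵐ x ∂surfaceMeasure Ω, x ∈ U → normalTrace Ω q x = 0 := by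
  have := isFiniteMeasure_surfaceMeasure hΓ hLip
  obtain ⟨hqD, φ, hφ, hlim1, hlim2⟩ := hq
  refine hU.ae_eq_zero_of_integral_contDiff_smul_eq_zero
    (((memLp_normalTrace hΩ hΓ hLip hq1).integrable (by norm_num)).locallyIntegrable
      |>.locallyIntegrableOn _) fun θ hθ hc hs => ?_
  have hθt : IsTest θ := ⟨hθ, hc⟩
  simp only [smul_eq_mul]
  rw [← green_normalTrace hΩ hΓ hLip (hθt.memH1 hΩ hΓ hLip) (hθt.isTrace_self hΩ hΓ hLip) hq1]
  have hgrad : ∫ x in Ω, inner ℝ (weakGrad Ω θ x) (q x) = ∫ x in Ω, inner ℝ (gradient θ x) (q x) := by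
    refine integral_congr_ae ?_
    filter_upwards [hθt.weakGrad_ae_eq hΩ hΓ hLip] with x hx
    rw [hx]
  rw [hgrad]
  have hdiv := hq1.hasWeakDiv.hasWeakDiv_weakDiv
  have h1 := tendsto_integral_mul (fun _ => hθt.memLp (volume.restrict Ω)) (hθt.memLp _)
    (fun k => (hφ k).1.classicalDiv.memLp (volume.restrict Ω)) hdiv.1 (by simp) hlim2
  have h2 := tendsto_integral_inner (fun _ => hθt.memLp_gradient (volume.restrict Ω))
    (hθt.memLp_gradient _) (fun k => (hφ k).1.memLp (volume.restrict Ω)) hq1.memL2 (by simp) hlim1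
  refine tendsto_nhds_unique (h1.add h2) (tendsto_const_nhds.congr fun k => ?_)
  rw [green_test_classicalDiv hΩ hΓ hLip hθt (hφ k).1]
  refine (Finset.sum_eq_zero fun i _ => ?_).symm
  rw [← surfaceMeasure_restrict_frontier]
  refine (setIntegral_congr_fun isClosed_frontier.measurableSet
    (g := fun _ => (0 : ℝ)) fun z hz => ?_).trans (by simp)
  by_cases hzU : z ∈ U
  · simp [(hφ k).2.eq_zero (hUS ⟨hzU, hz⟩)]
  · simp [image_eq_zero_of_notMem_tsupport fun h => hzU (hs h)]

end Traces

/-! ### The energy identity -/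

section Energy

variable {d : ℕ} {Ω : Set (EuclideanSpace ℝ (Fin d))}

lemma l2Norm_sq {F : Type*} [NormedAddCommGroup F] (v : EuclideanSpace ℝ (Fin d) → F) :
    l2Norm Ω v ^ 2 = ∫ x in Ω, ‖v x‖ ^ 2 :=
  Real.sq_sqrt (integral_nonneg fun _ => sq_nonneg _)

lemma l2Norm_congr {F : Type*} [NormedAddCommGroup F] {v w : EuclideanSpace ℝ (Fin d) → F}
    (h : v =ᵐ[volume.restrict Ω] w) : l2Norm Ω v = l2Norm Ω w := by
  refine congrArg Real.sqrt (integral_congr_ae ?_)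
  filter_upwards [h] with x hx
  rw [hx]

lemma l2Norm_sub_sq {F : Type*} [NormedAddCommGroup F] [InnerProductSpace ℝ F]
    {v w : EuclideanSpace ℝ (Fin d) → F} (hv : MemL2 Ω v) (hw : MemL2 Ω w) :
    l2Norm Ω (v - w) ^ 2
      = l2Norm Ω v ^ 2 - 2 * (∫ x in Ω, inner ℝ (v x) (w x)) + l2Norm Ω w ^ 2 := by
  have h1 : Integrable (fun x => ‖v x‖ ^ 2) (volume.restrict Ω) := hv.integrable_norm_pow two_ne_zero
  have h2 : Integrable (fun x => ‖w x‖ ^ 2) (volume.restrict Ω) := hw.integrable_norm_pow two_ne_zero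
  have h3 := (integrable_inner_of_memLp hv hw).const_mul 2
  simp only [l2Norm_sq, Pi.sub_apply, norm_sub_sq_real]
  rw [integral_add (h1.sub' h3) h2, integral_sub h1 h3, integral_const_mul]

lemma combinedNorm_sq (v : EuclideanSpace ℝ (Fin d) → ℝ)
    (q : EuclideanSpace ℝ (Fin d) → EuclideanSpace ℝ (Fin d)) :
    combinedNorm Ω v q ^ 2 = l2Norm Ω v ^ 2 + l2Norm Ω (weakGrad Ω v) ^ 2
      + (l2Norm Ω q ^ 2 + l2Norm Ω (weakDiv Ω q) ^ 2) := by
  rw [combinedNorm, Real.sq_sqrt (by positivity), h1Norm, dNorm, Real.sq_sqrt (by positivity),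
    Real.sq_sqrt (by positivity)]

/-- The combined norm differs from the residual of the first order system only by a boundary
term, since the cross terms are those of Green's formula. -/
theorem combinedNorm_sq_eq (hΩ : IsOpen Ω) (hΓ : IsCompact (frontier Ω))
    (hLip : HasLipschitzBoundary Ω) {v : EuclideanSpace ℝ (Fin d) → ℝ}
    {q : EuclideanSpace ℝ (Fin d) → EuclideanSpace ℝ (Fin d)} (hv : MemH1 Ω v)
    (hq : MemH1Vec Ω q) :
    combinedNorm Ω v q ^ 2 = l2Norm Ω (v - weakDiv Ω q) ^ 2 + l2Norm Ω (weakGrad Ω v - q) ^ 2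
      + 2 * ∫ x, trace Ω v x * normalTrace Ω q x ∂surfaceMeasure Ω := by
  have hdiv := hq.hasWeakDiv.hasWeakDiv_weakDiv
  have hg := green_normalTrace hΩ hΓ hLip hv (hv.isTrace_trace hΩ hΓ hLip) hq
  have hm : ∫ x in Ω, inner ℝ (v x) (weakDiv Ω q x) = ∫ x in Ω, v x * weakDiv Ω q x := by
    simp [mul_comm]
  rw [combinedNorm_sq, l2Norm_sub_sq hv.1 hdiv.1, l2Norm_sub_sq hv.hasWeakGrad.1 hq.memL2, ← hg, hm]
  ring

/-- If `t s` vanishes on the Dirichlet and the Neumann part and `s = -γ t` on the Robin part, the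
pairing of `t` and `s` lives on the Robin part. -/
lemma integral_mul_eq_neg_setIntegral {ΓD ΓN ΓR : Set (EuclideanSpace ℝ (Fin d))}
    (hdec : IsBoundaryDecomposition Ω ΓD ΓN ΓR) {γ t s : EuclideanSpace ℝ (Fin d) → ℝ}
    (hD : ∀ᵐ x ∂surfaceMeasure Ω, x ∈ ΓD → t x = 0)
    (hN : ∀ᵐ x ∂surfaceMeasure Ω, x ∈ ΓN → s x = 0)
    (hR : ∀ᵐ x ∂(surfaceMeasure Ω).restrict ΓR, s x + γ x * t x = 0) :
    ∫ x, t x * s x ∂surfaceMeasure Ω = -∫ x in ΓR, γ x * t x ^ 2 ∂surfaceMeasure Ω := by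
  have hcover : ∀ᵐ x ∂surfaceMeasure Ω, x ∈ ΓD ∪ ΓN ∪ ΓR := by
    have h1 : ∀ᵐ x ∂surfaceMeasure Ω, x ∈ frontier Ω :=
      ae_restrict_mem isClosed_frontier.measurableSet
    have h2 : ∀ᵐ x ∂surfaceMeasure Ω, x ∉ frontier Ω \ (ΓD ∪ ΓN ∪ ΓR) :=
      measure_eq_zero_iff_ae_notMem.1 hdec.cover
    filter_upwards [h1, h2] with x hx hx'
    by_contra h
    exact hx' ⟨hx, h⟩
  rw [← integral_neg, ← integral_indicator hdec.measurable_R]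
  refine integral_congr_ae ?_
  filter_upwards [hcover, hD, hN, (ae_restrict_iff' hdec.measurable_R).1 hR] with x hx hxD hxN hxR
  by_cases h : x ∈ ΓR
  · rw [Set.indicator_of_mem h]
    linear_combination t x * hxR h
  · rw [Set.indicator_of_notMem h]
    rcases hx with (hx | hx) | hx
    · rw [hxD hx, zero_mul]
    · rw [hxN hx, mul_zero]
    · exact absurd hx h

/-- The normal trace of a field in `D(Ω)` that is approximable by fields vanishing near the Neumann
part is zero there, the Neumann part being relatively open up to a null set. -/
lemma IsBoundaryDecomposition.ae_normalTrace_eq_zero {ΓD ΓN ΓR : Set (EuclideanSpace ℝ (Fin d))}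
    (hdec : IsBoundaryDecomposition Ω ΓD ΓN ΓR) (hΩ : IsOpen Ω) (hΓ : IsCompact (frontier Ω))
    (hLip : HasLipschitzBoundary Ω)
    {q : EuclideanSpace ℝ (Fin d) → EuclideanSpace ℝ (Fin d)} (hq : MemDVanishing Ω ΓN q)
    (hq1 : MemH1Vec Ω q) : ∀ᵐ x ∂surfaceMeasure Ω, x ∈ ΓN → normalTrace Ω q x = 0 := by
  obtain ⟨V, hV, hVN, hV0⟩ := hdec.open_N
  filter_upwards [hq.ae_normalTrace_eq_zero hΩ hΓ hLip hV hVN hq1,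
    measure_eq_zero_iff_ae_notMem.1 hV0] with x hx hx' hxN
  refine hx ?_
  by_contra h
  exact hx' ⟨hxN, h⟩

/-- On the Robin part, `γ⁻¹ s² = γ t²` if `s = -γ t`. -/
lemma boundaryNorm_inv_eq {ΓR : Set (EuclideanSpace ℝ (Fin d))}
    {γ t s : EuclideanSpace ℝ (Fin d) → ℝ} (hγ : IsRobinCoefficient Ω ΓR γ)
    (hR : ∀ᵐ x ∂(surfaceMeasure Ω).restrict ΓR, s x + γ x * t x = 0) :
    boundaryNorm Ω ΓR γ t = boundaryNorm Ω ΓR γ⁻¹ s := by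
  obtain ⟨γ₀, hγ₀, hle⟩ := hγ.2
  refine congrArg Real.sqrt (integral_congr_ae ?_)
  filter_upwards [hR, hle] with x hx hxγ
  have h0 : γ x ≠ 0 := (hγ₀.trans_le hxγ).ne'
  rw [eq_neg_of_add_eq_zero_left hx, Pi.inv_apply]
  field_simp

lemma boundaryNorm_sq {ΓR : Set (EuclideanSpace ℝ (Fin d))}
    {γ t : EuclideanSpace ℝ (Fin d) → ℝ} (hγ : IsRobinCoefficient Ω ΓR γ) :
    boundaryNorm Ω ΓR γ t ^ 2 = ∫ x in ΓR, γ x * t x ^ 2 ∂surfaceMeasure Ω := by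
  obtain ⟨γ₀, hγ₀, hle⟩ := hγ.2
  refine Real.sq_sqrt (integral_nonneg_of_ae ?_)
  filter_upwards [hle] with x hx
  exact mul_nonneg (hγ₀.le.trans hx) (sq_nonneg _)

/-- The majorant is the residual of the error: the exact solution makes both of its terms
vanish. -/
lemma mixMajorant_eq (hΩ : IsOpen Ω) {f u u' : EuclideanSpace ℝ (Fin d) → ℝ}
    {p' : EuclideanSpace ℝ (Fin d) → EuclideanSpace ℝ (Fin d)} (hu : MemH2 Ω u)
    (heq : ∀ᵐ x ∂volume.restrict Ω, -weakDiv Ω (weakGrad Ω u) x + u x = f x)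
    (hu' : MemH1 Ω u') (hp' : MemH1Vec Ω p') :
    mixMajorant Ω f u' p' = l2Norm Ω (u - u' - weakDiv Ω (weakGrad Ω u - p')) ^ 2
      + l2Norm Ω (weakGrad Ω (u - u') - (weakGrad Ω u - p')) ^ 2 := by
  have hdiv := hu.2.hasWeakDiv.hasWeakDiv_weakDiv
  have hdiv' := hp'.hasWeakDiv.hasWeakDiv_weakDiv
  have hd := hdiv.sub hu.2.memL2 hp'.memL2 hdiv'
  have hgrad := (hu.1.sub hu').hasWeakGrad.ae_eq hΩ
    (hu.1.hasWeakGrad.sub hu.1.1 hu'.1 hu'.hasWeakGrad)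
  rw [mixMajorant]
  congr 2
  · refine l2Norm_congr ?_
    filter_upwards [heq, hd.hasWeakDiv_weakDiv.ae_eq hΩ hd] with x hx hxd
    simp only [Pi.add_apply, Pi.sub_apply] at hxd ⊢
    rw [hxd, ← hx]
    ring
  · refine l2Norm_congr ?_
    filter_upwards [hgrad] with x hx
    simp only [Pi.sub_apply] at hx ⊢
    rw [hx]
    abel

end Energy

end RobinModel

end

open RobinModel in
theorem theorem5p1 (d : ℕ) (hd : 1 ≤ d)
    (Ω ΓD ΓN ΓR : Set (EuclideanSpace ℝ (Fin d)))
    (hΩ : IsOpen Ω) (hΓ : IsCompact (frontier Ω)) (hLip : HasLipschitzBoundary Ω)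
    (hdec : IsBoundaryDecomposition Ω ΓD ΓN ΓR)
    (γ f g₁ g₂ g₃ : EuclideanSpace ℝ (Fin d) → ℝ)
    (hγ : IsRobinCoefficient Ω ΓR γ) (hf : MemL2 Ω f)
    (u : EuclideanSpace ℝ (Fin d) → ℝ) (p : EuclideanSpace ℝ (Fin d) → EuclideanSpace ℝ (Fin d))
    (hu : SolvesModelProblem Ω ΓD ΓN ΓR γ f g₁ g₂ g₃ u) (hp : p = weakGrad Ω u)
    (u' : EuclideanSpace ℝ (Fin d) → ℝ) (p' : EuclideanSpace ℝ (Fin d) → EuclideanSpace ℝ (Fin d))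
    (hu' : MemH2 Ω u') (hp' : MemH1Vec Ω p')
    (hD : MemH1Vanishing Ω ΓD (u - u')) (hN : MemDVanishing Ω ΓN (p - p'))
    (hR : ∀ᵐ x ∂(surfaceMeasure Ω).restrict ΓR,
      normalTrace Ω (p - p') x + γ x * trace Ω (u - u') x = 0) :
    combinedNorm Ω (u - u') (p - p') ^ 2
        + boundaryNorm Ω ΓR γ (trace Ω (u - u')) ^ 2
        + boundaryNorm Ω ΓR γ⁻¹ (normalTrace Ω (p - p')) ^ 2
      = mixMajorant Ω f u' p' ∧
    boundaryNorm Ω ΓR γ (trace Ω (u - u'))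
      = boundaryNorm Ω ΓR γ⁻¹ (normalTrace Ω (p - p')) := by
  subst hp
  have hb := boundaryNorm_inv_eq hγ hR
  refine ⟨?_, hb⟩
  have hq := hu.memH2.2.sub hp'
  rw [combinedNorm_sq_eq hΩ hΓ hLip hD.1 hq, integral_mul_eq_neg_setIntegral hdec
    (hD.ae_trace_eq_zero hΩ hΓ hLip hdec.measurable_D)
    (hdec.ae_normalTrace_eq_zero hΩ hΓ hLip hN hq) hR, ← boundaryNorm_sq hγ, ← hb,
    mixMajorant_eq hΩ hu.memH2 hu.equation hu'.1 hp']
  ring
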